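/- **Many-to-one posets and DFC.** A *many-to-one poset* is a finite set $C$ of cells with a dimension function $\dim:C\to\mathbb N\cup\{-1\}$ (write $C_k=\dim^{-1}(k)$) and maps $\delta,\gamma:C_{k+1}\to\mathcal P(C_k)$ ($k\ge-1$) such that $\gamma(x)$ is a singleton if $\dim x\ge 0$; $\delta(x)\cap\gamma(x)\ne\emptyset$ implies $\delta(x)=\gamma(x)$; there is exactly one cell $\ast$ of dimension $-1$, and $\gamma(x)\setminus\delta(x)=\{\ast\}$ if $\dim x=0$. Write $y\prec^{-}x$, $y\prec^{+}x$, $y\prec^{\circ}x$ for $y\in\delta(x)\setminus\gamma(x)$, $y\in\gamma(x)\setminus\delta(x)$, $y\in\delta(x)\cap\gamma(x)$ respectively (in the last case $x$ is a *loop* on $y$), $y\prec x$ for $y\in\delta(x)\cup\gamma(x)$, and compute with the signs $+,-,\circ$ as with $1,-1,0$. Let $\Lambda$ be the set of cells $x$ with $x\prec^+w$ for no $w$, $\Lambda_k=\Lambda\cap C_k$, and $N=\{x\mid\delta(x)=\emptyset\}$. Moreover, for each $x\in\Lambda$ and each $z$, a strict total order $\triangleleft$ (the *local order*) on $\{y\mid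 z\prec^{\circ}y\prec^-x\}$ is given. A morphism is a map of cells that preserves dimensions, local orders and targets, $f(\gamma(x))=\gamma(f(x))$, and restricts to bijections $\delta(x)\to\delta(f(x))$. A *dendritic face complex* (DFC) is a many-to-one poset such that: (1) there is a greatest cell $\omega$, for the reflexive transitive closure of $\prec$, and $\dim\omega>0$; (2) if $z\prec^{\circ}y$ then $y\prec^+x$ for some $x$; (3) if $z\prec^\beta y\prec^\alpha x$ with $\alpha,\beta\in\{+,-\}$, there is a unique $y'\ne y$ with $z\prec^{\beta'}y'\prec^{\alpha'}x$ for some $\alpha',\beta'\in\{+,-\}$, and $\alpha\beta=-\alpha'\beta'$; (4) if $z\prec^{\circ}y\prec^-x$, there is $y'\ne y$ with $z\prec^\beta y'\prec^\alpha x$ and $(\alpha,\beta)\ne(-,\circ)$; (5) for $\dim x\ge1$ there is no cyclic sequence $y_1,\dots,y_p,y_{p+1}=y_1$ ($p\ge 1$) of cells $y_i\prec^-x$ with $y_i\succ^-\gamma(y_{i+1})\prec^+y_{i+1}$ for all $i$. Its dimension is $n=\dim\omega$; $\gamma^{(k)}\omega\in C_k$ denotes the iterated target of $\omega$. $\mathbf{DFC}^{\mathsf{core}}$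 is the groupoid of DFC and their isomorphisms. **Loop orders.** For $a\in\Lambda$, $c\prec^{\circ}b\prec^+a$ and $c\prec^{\circ}b'\prec^-a$ write $b'\subset b$, and let $\subseteq$ be the reflexive transitive closure. For a cell $c$, let $a\to_c a'$ if $a,a'\in\Lambda$ and some $b$ satisfies either $c\prec^-b$, $b\prec^+a$, $b\prec^-a'$, or $c\prec^+b$, $b\prec^-a$, $b\prec^+a'$; let $<_c$ be the transitive closure of $\to_c$. Put $b_1\blacktriangleleft^1b_1'$ if $b_1\subseteq b$, $b_1'\subseteq b'$ for some $c\prec^{\circ}b\prec^-a$, $c\prec^{\circ}b'\prec^-a'$ with $a<_ca'$. Let $V(c)$ be the set of $b$ with $c\prec^{\circ}b\prec^+a$ for some $a\in\Lambda\cap N$. For distinct $b,b'\in V(c)$ not comparable by $\blacktriangleleft^1$, put $b\blacktriangleleft^2b'$ if there are $a''\in\Lambda$ and $d\ne d'$ with $c\prec^{\circ}d\prec^-a''$, $c\prec^{\circ}d'\prec^-a''$, $b\subseteq d$, $b'\subseteq d'$ and $d\triangleleft d'$. The loop total order on $V(c)$ is $\blacktriangleleft\,=\,\blacktriangleleft^1\cup\blacktriangleleft^2$.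 For $W(c)=\{w\in\Lambda\cap N\mid\gamma^2(w)=c\}$ put $w\blacktriangleleft w'$ if $\gamma(w)\blacktriangleleft\gamma(w')$ in $V(c)$. **Opetopes.** A *rooted tree* $T$ has a finite set of nodes and a finite set of edges; each node has exactly one target edge, each edge has at most one source node (it is the target edge of at most one node) and at most one target node (it is then a source edge of that node); there is a root edge without target node, reached from every edge by a descending path (passing to targets). A leaf is an edge without source node, a nulldot is a node without source edges. A *subdivision* $T'$ of $T$ is a finite totally ordered set $W(b)$ for each edge $b$; its blackdots are the nodes of $T$, its whitedots the elements of $\bigsqcup_bW(b)$; each edge $b$ is replaced by a linear tree on $W(b)$, with smaller elements closer to the root. A *constellation* $T\to U$ is a subdivision $T'$ of $T$ with bijections $\sigma$ from the blackdots of $T'$ to the leaves of $U$ and from the whitedots of $T'$ to the nulldots of $U$ satisfying the kernel rule: for each node $x$ of $U$, the dots $t$ of $T'$ with a descending path from $\sigma(t)$ to $x$ in $U$ induce a connected full subgraph of $T'$. It is *exact* if the bijections are identities. An *$n$-opetope* is a sequence $T_0\to T_1\to\dots\to T_n$ of rooted trees and exact constellations such that $T_0$, and $T_1$ if $n\ge1$,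 have one node and one leaf, and, if $n\ge2$, $T_2$ is linear (each node has exactly one source edge). An isomorphism of opetopes of the same dimension is a sequence of isomorphisms of (subdivided, rooted) trees compatible with the bijections of the constellations. $\mathbf{KJBM}$ is the category of opetopes and their isomorphisms. **Theorem.** There is a functor $Z:\mathbf{DFC}^{\mathsf{core}}\to\mathbf{KJBM}$ with the following properties. * For a DFC $C$ of dimension $n$, $Z(C)=(T_0\to T_1\to\dots\to T_n)$ is an $n$-opetope in which, for $2\le k\le n$, the nodes of $T_k$ are the elements of $\Lambda_{k-1}$, the edges of $T_k$ are the elements of $C_{k-2}$, an edge $y$ is a source of a node $x$ if and only if $y\prec^-x$, it is the target of $x$ if and only if $y\prec^+x$, and the root edge is $\gamma^{(k-2)}\omega$; for $2\le k<n$, the subdivision of $T_k$ in the constellation $T_k\to T_{k+1}$ is $y\mapsto W(y)$, ordered by $\blacktriangleleft$. The node of $T_1$ is the unique element of $\Lambda_0$ (the rest of $T_0$ and $T_1$ is determined up to renaming). * For an isomorphism $f:C\to D$ of DFC, the isomorphism of opetopes $Z(f):Z(C)\to Z(D)$ is given by $f$ on the nodes of $T_1$ and on the nodes, edges and whitedots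 of $T_k$ for $k\ge2$ (on the rest of $T_0$ and $T_1$ it is the only possible isomorphism). -/

import Mathlib

open CategoryTheory

universe u

/-! ## Many-to-one posets -/

/-- The cells of a many-to-one poset with their dimensions, source sets `δ` and target sets `γ`
(everything except the local orders). Since all dimensions are at least `-1`, the fields
`dim_of_mem_δ` and `dim_of_mem_γ` say that `δ` and `γ` send a cell of dimension `k + 1` to sets of
cells of dimension `k`, and that they are empty (that is, absent) on cells of dimension `-1`. -/
structure FacetPoset where
  Cell : Type u
  finite : Finite Cell
  dim : Cell → ℤ
  neg_one_le_dim : ∀ x, -1 ≤ dim x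
  δ : Cell → Set Cell
  γ : Cell → Set Cell
  dim_of_mem_δ : ∀ x y, y ∈ δ x → dim y + 1 = dim x
  dim_of_mem_γ : ∀ x y, y ∈ γ x → dim y + 1 = dim x
  γ_singleton : ∀ x, 0 ≤ dim x → ∃ y, γ x = {y}
  δ_eq_γ : ∀ x, (δ x ∩ γ x).Nonempty → δ x = γ x
  existsUnique_bot : ∃! x, dim x = -1
  γ_diff_δ_of_dim_zero : ∀ b x, dim b = -1 → dim x = 0 → γ x \ δ x = {b}

namespace FacetPoset

variable (P : FacetPoset.{u})

/-- `y ≺⁺ x`: `y` is the target of `x` and not a source of `x`. -/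
def Pos (y x : P.Cell) : Prop := y ∈ P.γ x \ P.δ x

/-- `y ≺⁻ x`: `y` is a source of `x` and not the target of `x`. -/
def Neg (y x : P.Cell) : Prop := y ∈ P.δ x \ P.γ x

/-- `y ≺ᵒ x`: `y` is both a source and the target of `x`, that is, `x` is a loop on `y`. -/
def Loop (y x : P.Cell) : Prop := y ∈ P.δ x ∩ P.γ x

/-- `y ≺^α x` for a sign `α ∈ {+, -, o} = {1, -1, 0}`. -/
def Facet : SignType → P.Cell → P.Cell → Prop
  | .pos => P.Pos
  | .neg => P.Neg
  | .zero => P.Loop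

/-- The partial order on cells: the reflexive transitive closure of `y ≺ x`. -/
def Le : P.Cell → P.Cell → Prop :=
  Relation.ReflTransGen fun y x => y ∈ P.δ x ∪ P.γ x

/-- `ω` is the greatest element. -/
def IsGreatestCell (ω : P.Cell) : Prop := ∀ x, P.Le x ω

/-- `Λ`: the cells `x` for which there is no `w` with `x ≺⁺ w`. -/
def Lam : Set P.Cell := {x | ∀ w, ¬ P.Pos x w}

/-- `N`: the cells without sources. -/
def Null : Set P.Cell := {x | P.δ x = ∅}

/-- `n` is the dimension of `P`, the maximum of the dimensions of its cells. -/
def HasDim (n : ℕ) : Prop := IsGreatest (Set.range P.dim) (n : ℤ)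

/-- `x` is an iterated target of the greatest element `ω`; the one of dimension `k` is
`γ^(k)(ω)`. -/
def IsIteratedTarget (x : P.Cell) : Prop :=
  ∃ ω, P.IsGreatestCell ω ∧ Relation.ReflTransGen (fun y z => z ∈ P.γ y) ω x

/-- One step of a cycle inside the sources of `x`: `y ≻⁻ z ≺⁺ y'` with `y, y' ≺⁻ x`. -/
def CycleStep (x y y' : P.Cell) : Prop :=
  P.Neg y x ∧ P.Neg y' x ∧ ∃ z, P.Neg z y ∧ P.Pos z y'

end FacetPoset

/-- Many-to-one posets. The relation `LocalLT x` is the disjoint union, over all `z`, of the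
(strict) local orders on the sets `{y | z ≺ᵒ y ≺⁻ x}`, for `x ∈ Λ`; it relates nothing else.
(A `z` with `z ≺ᵒ y ≺⁻ x` is in `∂²(x)`, and it is determined by `y`.) -/
structure MOP extends FacetPoset.{u} where
  LocalLT : Cell → Cell → Cell → Prop
  localLT_supp : ∀ x y y', LocalLT x y y' → x ∈ toFacetPoset.Lam ∧
    ∃ z, (toFacetPoset.Loop z y ∧ toFacetPoset.Neg y x) ∧
      (toFacetPoset.Loop z y' ∧ toFacetPoset.Neg y' x)
  localLT_total : ∀ x ∈ toFacetPoset.Lam, ∀ z,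
    IsStrictTotalOrder {y // toFacetPoset.Loop z y ∧ toFacetPoset.Neg y x}
      (fun y y' => LocalLT x y y')

namespace MOP

/-- Morphisms of many-to-one posets. -/
@[ext]
structure Hom (C D : MOP.{u}) where
  toFun : C.Cell → D.Cell
  map_dim : ∀ x, D.dim (toFun x) = C.dim x
  bijOn_δ : ∀ x, 0 ≤ C.dim x → Set.BijOn toFun (C.δ x) (D.δ (toFun x))
  map_γ : ∀ x, 0 ≤ C.dim x → toFun '' C.γ x = D.γ (toFun x)
  map_localLT : ∀ x y y', C.LocalLT x y y' → D.LocalLT (toFun x) (toFun y) (toFun y')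

/-- The category of many-to-one posets. -/
instance : Category MOP.{u} where
  Hom := Hom
  id C :=
    { toFun := id
      map_dim := fun _ => rfl
      bijOn_δ := fun _ _ => Set.bijOn_id _
      map_γ := fun _ _ => Set.image_id _
      map_localLT := fun _ _ _ h => h }
  comp {C D E} f g :=
    { toFun := g.toFun ∘ f.toFun
      map_dim := fun x => (g.map_dim _).trans (f.map_dim x)
      bijOn_δ := fun x hx =>
        (g.bijOn_δ (f.toFun x) ((f.map_dim x).symm ▸ hx)).comp (f.bijOn_δ x hx)
      map_γ := fun x hx => by
        rw [Set.image_comp, f.map_γ x hx, g.map_γ (f.toFun x) ((f.map_dim x).symm ▸ hx)]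
        rfl
      map_localLT := fun x y y' h => g.map_localLT _ _ _ (f.map_localLT x y y' h) }

/-! ### Dendritic face complexes -/

/-- A many-to-one poset is a dendritic face complex. -/
structure IsDFC (C : MOP.{u}) : Prop where
  greatest : ∃ ω, C.IsGreatestCell ω ∧ 0 < C.dim ω
  loops : ∀ z y, C.Loop z y → ∃ x, C.Pos y x
  /-- Lozenge completion, the completion being unique among the chains with signs in `{+, -}`. -/
  thin : ∀ (α β : SignType) (z y x : C.Cell), α ≠ 0 → β ≠ 0 → C.Facet β z y → C.Facet α y x →
    ∃! y', y' ≠ y ∧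
      ∃ α' β' : SignType, α' ≠ 0 ∧ β' ≠ 0 ∧ C.Facet β' z y' ∧ C.Facet α' y' x
  /-- The sign rule. -/
  sign : ∀ (α β α' β' : SignType) (z y y' x : C.Cell),
    α ≠ 0 → β ≠ 0 → α' ≠ 0 → β' ≠ 0 → y' ≠ y →
    C.Facet β z y → C.Facet α y x → C.Facet β' z y' → C.Facet α' y' x →
    α * β = -(α' * β')
  thin_loop : ∀ z y x, C.Loop z y → C.Neg y x →
    ∃ (y' : C.Cell) (α β : SignType), y' ≠ y ∧ C.Facet β z y' ∧ C.Facet α y' x ∧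
      (α, β) ≠ (-1, 0)
  acyclic : ∀ x, 1 ≤ C.dim x → ∀ y, ¬ Relation.TransGen (C.CycleStep x) y y

/-! ### The order of loops -/

variable (C : MOP.{u})

/-- `b' ⊂ b`: there are `c` and `a ∈ Λ` with `c ≺ᵒ b ≺⁺ a` and `c ≺ᵒ b' ≺⁻ a`. -/
def LoopIncl (b' b : C.Cell) : Prop :=
  ∃ c a, a ∈ C.Lam ∧ (C.Loop c b ∧ C.Pos b a) ∧ (C.Loop c b' ∧ C.Neg b' a)

/-- `b' ⊆ b`: the reflexive transitive closure of `⊂`. -/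
def LoopInclEq : C.Cell → C.Cell → Prop := Relation.ReflTransGen C.LoopIncl

/-- `a`, `a'` are two consecutive upper vertices `aᵢ`, `aᵢ₊₁` of the zig-zag over `c` that lists
all the chains `c ≺^± b ≺^± a ∈ Λ`: on its left part they are linked by some `b` with `c ≺⁻ b` and
`a ≻⁺ b ≺⁻ a'`, on its right part by some `b` with `c ≺⁺ b` and `a ≻⁻ b ≺⁺ a'`. -/
def ZigStep (c a a' : C.Cell) : Prop :=
  a ∈ C.Lam ∧ a' ∈ C.Lam ∧
    ∃ b, (C.Neg c b ∧ C.Pos b a ∧ C.Neg b a') ∨ (C.Pos c b ∧ C.Neg b a ∧ C.Pos b a')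

/-- The loops order `◂¹`, for loops on `c`. -/
def LoopLT₁ (c b₁ b₁' : C.Cell) : Prop :=
  ∃ a a' b b', Relation.TransGen (C.ZigStep c) a a' ∧
    (C.Loop c b ∧ C.Neg b a) ∧ (C.Loop c b' ∧ C.Neg b' a') ∧
    C.LoopInclEq b₁ b ∧ C.LoopInclEq b₁' b'

/-- `V(c)`: the loops `b` on `c` with `c ≺ᵒ b ≺⁺ a` for some `a ∈ Λ ∩ N`. -/
def MinLoops (c : C.Cell) : Set C.Cell :=
  {b | C.Loop c b ∧ ∃ a ∈ C.Lam ∩ C.Null, C.Pos b a}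

/-- The order `◂²` on `V(c)`: two loops that are not comparable by `◂¹` are compared by the local
order at the cell `a'' ∈ Λ` where the paths that start from them meet. -/
def LoopLT₂ (c b b' : C.Cell) : Prop :=
  b ∈ C.MinLoops c ∧ b' ∈ C.MinLoops c ∧ b ≠ b' ∧
    ¬ C.LoopLT₁ c b b' ∧ ¬ C.LoopLT₁ c b' b ∧
    ∃ a'' ∈ C.Lam, ∃ d d', d ≠ d' ∧
      (C.Loop c d ∧ C.Neg d a'') ∧ (C.Loop c d' ∧ C.Neg d' a'') ∧
      C.LoopInclEq b d ∧ C.LoopInclEq b' d' ∧ C.LocalLT a'' d d'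

/-- The loops total order `◂` on `V(c)`. -/
def LoopLT (c b b' : C.Cell) : Prop :=
  b ∈ C.MinLoops c ∧ b' ∈ C.MinLoops c ∧ (C.LoopLT₁ c b b' ∨ C.LoopLT₂ c b b')

/-- `W(c) = {w ∈ Λ ∩ N | γ²(w) = c}`. -/
def White (c : C.Cell) : Set C.Cell :=
  {w | w ∈ C.Lam ∩ C.Null ∧ ∃ b ∈ C.γ w, c ∈ C.γ b}

/-- The order on `W(c)`: `w` is below `w'` if `γ(w) ◂ γ(w')`. -/
def WhiteLT (c w w' : C.Cell) : Prop :=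
  ∃ b ∈ C.γ w, ∃ b' ∈ C.γ w', C.LoopLT c b b'

end MOP

/-- The category of dendritic face complexes, a full subcategory of `MOP`. -/
abbrev DFC := ObjectProperty.FullSubcategory (C := MOP.{u}) MOP.IsDFC

/-! ## Rooted trees

The nodes and edges of the trees, and the whitedots of the subdivisions, are named by elements of a
type `α`, so that it makes sense for the structural maps of a constellation to be identities. -/

/-- Rooted trees with nodes and edges named in `α`. -/
structure DotTree (α : Type u) where
  nodes : Finset α
  edges : Finset α
  /-- The target edge of a node. -/
  target : nodes → edges
  /-- The target node of an edge, if there is one. -/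
  targetNode : edges → Option nodes
  /-- An edge has at most one source node. -/
  target_injective : Function.Injective target
  root : edges
  targetNode_root : targetNode root = none
  /-- There is a descending path from every edge to the root. -/
  exists_path : ∀ b : edges,
    Relation.ReflTransGen (fun b b' => ∃ a, targetNode b = some a ∧ target a = b') b root

namespace DotTree

variable {α : Type u} (T : DotTree α)

/-- An edge without source node. -/
def IsLeaf (b : T.edges) : Prop := ∀ a, T.target a ≠ b

/-- A node without source edges. -/
def IsNulldot (a : T.nodes) : Prop := ∀ b, T.targetNode b ≠ some a

/-- `T.Next x x'`: `x'` is the target of `x`, for `x`, `x'` nodes or edges. -/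
inductive Next : T.nodes ⊕ T.edges → T.nodes ⊕ T.edges → Prop
  | node (a : T.nodes) : Next (.inl a) (.inr (T.target a))
  | edge (b : T.edges) (a : T.nodes) : T.targetNode b = some a → Next (.inr b) (.inl a)

/-- `x ⊑ x'`: there is a descending path from `x` to `x'`. -/
def Descends : T.nodes ⊕ T.edges → T.nodes ⊕ T.edges → Prop := Relation.ReflTransGen T.Next

/-- The tree has one root, one leaf and one node. -/
def IsUnary : Prop := T.nodes.card = 1 ∧ ∃! b, T.IsLeaf b

/-- The tree is linear: every node has exactly one source edge. -/
def IsLinear : Prop := ∀ a, ∃! b, T.targetNode b = some a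

/-- Isomorphisms of rooted trees. -/
@[ext]
structure Iso {α β : Type u} (T : DotTree α) (U : DotTree β) where
  node : T.nodes ≃ U.nodes
  edge : T.edges ≃ U.edges
  map_target : ∀ a, edge (T.target a) = U.target (node a)
  map_targetNode : ∀ b, (T.targetNode b).map node = U.targetNode (edge b)
  map_root : edge T.root = U.root

/-- The identity isomorphism. -/
def Iso.refl : T.Iso T where
  node := Equiv.refl _
  edge := Equiv.refl _
  map_target _ := rfl
  map_targetNode _ := by simp
  map_root := rfl

/-- The composite of two isomorphisms. -/
def Iso.trans {α β κ : Type u} {T : DotTree α} {U : DotTree β} {V : DotTree κ}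
    (f : T.Iso U) (g : U.Iso V) : T.Iso V where
  node := f.node.trans g.node
  edge := f.edge.trans g.edge
  map_target a := by simp [f.map_target, g.map_target]
  map_targetNode b := by
    simp only [Equiv.trans_apply, ← g.map_targetNode, ← f.map_targetNode, Option.map_map]
    rfl
  map_root := by simp [f.map_root, g.map_root]

/-- A subdivision: a finite totally ordered set `W b` for each edge `b`. -/
structure Subdivision where
  W : T.edges → Finset α
  lt : ∀ b, W b → W b → Prop
  lt_total : ∀ b, IsStrictTotalOrder (W b) (lt b)

namespace Subdivision

variable {T} (S : T.Subdivision)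

/-- The whitedots: the disjoint union of the sets `W b`. -/
abbrev Whitedot := Σ b : T.edges, S.W b

/-- The dots: blackdots (the nodes) and whitedots. -/
abbrev Dot := T.nodes ⊕ S.Whitedot

/-- The first whitedot is below the second one, on the same edge. -/
inductive WhiteLT : S.Whitedot → S.Whitedot → Prop
  | mk (b : T.edges) (w w' : S.W b) : S.lt b w w' → WhiteLT ⟨b, w⟩ ⟨b, w'⟩

/-- `S.Step d d'`: in the rooted tree obtained by replacing each edge `b` by the linear tree on
`W b` (in increasing order, the least element being the closest to the root), some edge has target
node `d` and source node `d'`. -/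
inductive Step : S.Dot → S.Dot → Prop
  | node_node (b : T.edges) (a a' : T.nodes) : T.targetNode b = some a → T.target a' = b →
      S.W b = ∅ → Step (.inl a) (.inl a')
  | node_white (b : T.edges) (a : T.nodes) (w : S.W b) : T.targetNode b = some a →
      (∀ v, ¬ S.lt b v w) → Step (.inl a) (.inr ⟨b, w⟩)
  | white_white (b : T.edges) (w w' : S.W b) : S.lt b w w' →
      (∀ v, ¬ (S.lt b w v ∧ S.lt b v w')) → Step (.inr ⟨b, w⟩) (.inr ⟨b, w'⟩)
  | white_node (b : T.edges) (w : S.W b) (a' : T.nodes) : T.target a' = b →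
      (∀ v, ¬ S.lt b w v) → Step (.inr ⟨b, w⟩) (.inl a')

/-- The graph on the dots of the subdivided tree. -/
def graph : SimpleGraph S.Dot := SimpleGraph.fromRel S.Step

end Subdivision

end DotTree

/-! ## Constellations, zoom complexes and opetopes -/

/-- Constellations from `T` to `U`. -/
structure Constellation {α : Type u} (T U : DotTree α) where
  sub : T.Subdivision
  σBlack : T.nodes ≃ {b : U.edges // U.IsLeaf b}
  σWhite : sub.Whitedot ≃ {a : U.nodes // U.IsNulldot a}
  /-- The kernel rule. -/
  kernel : ∀ x : U.nodes, (sub.graph.induce {t | U.Descends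
    (Sum.elim (fun a => .inr (σBlack a).1) (fun w => .inl (σWhite w).1) t) (.inl x)}).Connected

/-- A constellation is exact when its structural maps are identities. -/
def Constellation.IsExact {α : Type u} {T U : DotTree α} (K : Constellation T U) : Prop :=
  (∀ a, ((K.σBlack a).1 : α) = a) ∧ ∀ w, ((K.σWhite w).1 : α) = w.2

/-- Zoom complexes `T₀ ⟶ T₁ ⟶ ⋯ ⟶ Tₙ` of degree `n`. -/
structure ZoomComplex (α : Type u) (n : ℕ) where
  tree : ∀ k, k ≤ n → DotTree α
  con : ∀ (k : ℕ) (h : k + 1 ≤ n), Constellation (tree k (Nat.le_of_succ_le h)) (tree (k + 1) h)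

/-- `n`-opetopes. -/
structure Opetope (α : Type u) (n : ℕ) extends ZoomComplex α n where
  exact : ∀ k h, (con k h).IsExact
  unary_zero : (tree 0 (Nat.zero_le n)).IsUnary
  unary_one : ∀ h : 1 ≤ n, (tree 1 h).IsUnary
  linear_two : ∀ h : 2 ≤ n, (tree 2 h).IsLinear

/-- Objects of the category of opetopes. -/
structure KJBM where
  Name : Type u
  dim : ℕ
  opetope : Opetope Name dim

namespace KJBM

/-- The tree `Tₖ` of an opetope. -/
abbrev tree (Y : KJBM.{u}) (k : ℕ) (h : k ≤ Y.dim) : DotTree Y.Name := Y.opetope.tree k h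

/-- The constellation from `Tₖ` to `Tₖ₊₁` of an opetope. -/
abbrev con (Y : KJBM.{u}) (k : ℕ) (h : k + 1 ≤ Y.dim) :
    Constellation (Y.tree k (Nat.le_of_succ_le h)) (Y.tree (k + 1) h) := Y.opetope.con k h

/-- Isomorphisms of opetopes of the same dimension: sequences of isomorphisms of (subdivided) trees,
compatible with the structural maps of the constellations. -/
@[ext]
structure Hom (X Y : KJBM.{u}) where
  dim_eq : X.dim = Y.dim
  tree : ∀ k (h : k ≤ X.dim), (X.tree k h).Iso (Y.tree k (dim_eq ▸ h))
  white : ∀ k (h : k + 1 ≤ X.dim),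
    (X.con k h).sub.Whitedot ≃ (Y.con k (dim_eq ▸ h)).sub.Whitedot
  white_edge : ∀ k h w, (white k h w).1 = (tree k (Nat.le_of_succ_le h)).edge w.1
  white_lt : ∀ k h w w', (X.con k h).sub.WhiteLT w w' ↔
    (Y.con k (dim_eq ▸ h)).sub.WhiteLT (white k h w) (white k h w')
  map_σBlack : ∀ k (h : k + 1 ≤ X.dim) a, (tree (k + 1) h).edge ((X.con k h).σBlack a).1 =
    ((Y.con k (dim_eq ▸ h)).σBlack ((tree k (Nat.le_of_succ_le h)).node a)).1
  map_σWhite : ∀ k (h : k + 1 ≤ X.dim) w, (tree (k + 1) h).node ((X.con k h).σWhite w).1 =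
    ((Y.con k (dim_eq ▸ h)).σWhite (white k h w)).1

/-- The category of opetopes and their isomorphisms. -/
instance : Category KJBM.{u} where
  Hom := Hom
  id X :=
    { dim_eq := rfl
      tree := fun _ _ => DotTree.Iso.refl _
      white := fun _ _ => Equiv.refl _
      white_edge := fun _ _ _ => rfl
      white_lt := fun _ _ _ _ => Iff.rfl
      map_σBlack := fun _ _ _ => rfl
      map_σWhite := fun _ _ _ => rfl }
  comp {X Y Z} f g :=
    { dim_eq := f.dim_eq.trans g.dim_eq
      tree := fun k h => (f.tree k h).trans (g.tree k (f.dim_eq ▸ h))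
      white := fun k h => (f.white k h).trans (g.white k (f.dim_eq ▸ h))
      white_edge := fun k h w => by
        simp [DotTree.Iso.trans, f.white_edge, g.white_edge]
      white_lt := fun k h w w' => (f.white_lt k h w w').trans (g.white_lt k _ _ _)
      map_σBlack := fun k h a => by
        simp [DotTree.Iso.trans, f.map_σBlack, g.map_σBlack]
      map_σWhite := fun k h w => by
        simp [DotTree.Iso.trans, f.map_σWhite, g.map_σWhite] }

end KJBM

/-! ## The opetope of a dendritic face complex -/

/-- The opetope `Y` is the opetope `Z(C)` of `C`, the cell `c` of `C` being named `ι c` in `Y`.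
The trees of index `0` and `1`, which are determined by the others up to renaming, are only
constrained through the definition of opetopes and the name of the node of `T₁`. -/
structure IsZoomOf (C : MOP.{u}) (Y : KJBM.{u}) (ι : C.Cell ↪ Y.Name) : Prop where
  hasDim : C.HasDim Y.dim
  /-- The node of `T₁` is the cell in `Λ₀`. -/
  mem_nodes_one : ∀ (h : 1 ≤ Y.dim) (x : Y.Name),
    x ∈ (Y.tree 1 h).nodes ↔ ∃ a ∈ C.Lam, C.dim a = 0 ∧ ι a = x
  /-- The set of nodes of `Tₖ₊₂` is `Λₖ₊₁`. -/
  mem_nodes : ∀ (k : ℕ) (h : k + 2 ≤ Y.dim) (x : Y.Name),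
    x ∈ (Y.tree (k + 2) h).nodes ↔ ∃ a ∈ C.Lam, C.dim a = k + 1 ∧ ι a = x
  /-- The set of edges of `Tₖ₊₂` is `Cₖ`. -/
  mem_edges : ∀ (k : ℕ) (h : k + 2 ≤ Y.dim) (x : Y.Name),
    x ∈ (Y.tree (k + 2) h).edges ↔ ∃ c, C.dim c = k ∧ ι c = x
  /-- The edge `c` is the target of the node `a` if and only if `c ≺⁺ a`. -/
  target_iff : ∀ (k : ℕ) (h : k + 2 ≤ Y.dim) (a : (Y.tree (k + 2) h).nodes)
    (b : (Y.tree (k + 2) h).edges) (a₀ c₀ : C.Cell), ι a₀ = a → ι c₀ = b →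
    ((Y.tree (k + 2) h).target a = b ↔ C.Pos c₀ a₀)
  /-- The edge `c` is a source of the node `a` if and only if `c ≺⁻ a`. -/
  targetNode_iff : ∀ (k : ℕ) (h : k + 2 ≤ Y.dim) (a : (Y.tree (k + 2) h).nodes)
    (b : (Y.tree (k + 2) h).edges) (a₀ c₀ : C.Cell), ι a₀ = a → ι c₀ = b →
    ((Y.tree (k + 2) h).targetNode b = some a ↔ C.Neg c₀ a₀)
  /-- The root edge of `Tₖ₊₂` is the `k`-dimensional iterated target of the greatest cell. -/
  root_eq : ∀ (k : ℕ) (h : k + 2 ≤ Y.dim),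
    ∃ c, C.IsIteratedTarget c ∧ C.dim c = k ∧ ι c = (Y.tree (k + 2) h).root
  /-- The whitedots of `Tₖ₊₂` on the edge `c` are the elements of `W(c)`. -/
  mem_white : ∀ (k : ℕ) (h : k + 2 + 1 ≤ Y.dim)
    (b : (Y.tree (k + 2) (Nat.le_of_succ_le h)).edges) (c : C.Cell), ι c = b →
    ∀ x : Y.Name, x ∈ (Y.con (k + 2) h).sub.W b ↔ ∃ w ∈ C.White c, ι w = x
  /-- The order of the whitedots on the edge `c` is the loops total order. -/
  white_lt_iff : ∀ (k : ℕ) (h : k + 2 + 1 ≤ Y.dim)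
    (b : (Y.tree (k + 2) (Nat.le_of_succ_le h)).edges) (c : C.Cell), ι c = b →
    ∀ (w w' : (Y.con (k + 2) h).sub.W b) (w₀ w₀' : C.Cell), ι w₀ = w → ι w₀' = w' →
    ((Y.con (k + 2) h).sub.lt b w w' ↔ C.WhiteLT c w₀ w₀')

/-- The isomorphism of opetopes `g` is given by the map of cells `f` on nodes (blackdots), on edges
and on whitedots. On the edges of `T₁` and on `T₀`, whose elements are not cells, it is the only
possible isomorphism. -/
structure ActsAs {C D : MOP.{u}} {X Y : KJBM.{u}} (ι : C.Cell ↪ X.Name) (κ : D.Cell ↪ Y.Name)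
    (f : C ⟶ D) (g : X ⟶ Y) : Prop where
  node_one : ∀ (h : 1 ≤ X.dim) (a : (X.tree 1 h).nodes) (a₀ : C.Cell), ι a₀ = a →
    ((g.tree 1 h).node a : Y.Name) = κ (f.toFun a₀)
  node : ∀ (k : ℕ) (h : k + 2 ≤ X.dim) (a : (X.tree (k + 2) h).nodes) (a₀ : C.Cell), ι a₀ = a →
    ((g.tree (k + 2) h).node a : Y.Name) = κ (f.toFun a₀)
  edge : ∀ (k : ℕ) (h : k + 2 ≤ X.dim) (b : (X.tree (k + 2) h).edges) (c : C.Cell), ι c = b →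
    ((g.tree (k + 2) h).edge b : Y.Name) = κ (f.toFun c)
  white : ∀ (k : ℕ) (h : k + 2 + 1 ≤ X.dim) (w : (X.con (k + 2) h).sub.Whitedot) (w₀ : C.Cell),
    ι w₀ = w.2 → ((g.white (k + 2) h w).2 : Y.Name) = κ (f.toFun w₀)

/-!
Fix a dimension `k`. By downward induction along the iterated targets of `ω`, the cells of dimension
`k` are the edges of a tree with root `γ^(k) ω` and nodes `Λₖ₊₁`: when `g` is the root in dimension
`k + 1`, the lozenge axioms let one push a path of sources of `g` through the nodes that refine `g`.

For a cell `c`, the descending paths from two cells with face `c` meet at a node, and the sources of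
this node with face `c` are totally ordered: the one with source `c`, then the loops on `c` in the
local order, then the one with target `c`. Comparing at the meeting node gives a strict total order,
the planar order over `c`, whose restriction to `V(c)` is the loop order.

The planar order also gives the kernel rule. The blackdots and whitedots of a subdivision correspond
to the tips of the tree one dimension higher, its leaves and nulldots, and dots that are adjacent
along an edge `c` correspond to consecutive tips for the planar order over `c`. The tips above a
given cell are convex for this order, and acyclicity of the sources of a node links the tips above
its different sources.
-/

lemma wellFounded_of_acyclic {α : Type*} [Finite α] {r : α → α → Prop}
    (h : ∀ a, ¬ Relation.TransGen r a a) : WellFounded r := by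
  have : Std.Irrefl (Relation.TransGen r) := ⟨h⟩
  exact Subrelation.wf .single (Finite.wellFounded_of_trans_of_irrefl (Relation.TransGen r))

lemma wellFounded_swap_of_acyclic {α : Type*} [Finite α] {r : α → α → Prop}
    (h : ∀ a, ¬ Relation.TransGen r a a) : WellFounded (Function.swap r) :=
  wellFounded_of_acyclic fun a ha => h a (Relation.transGen_swap.1 ha)

namespace FacetPoset

variable {P : FacetPoset.{u}} {x x' y y' z : P.Cell}

/-- `y ≺ x`: `y` is a source or the target of `x`. -/
def Face (P : FacetPoset.{u}) (y x : P.Cell) : Prop := y ∈ P.δ x ∪ P.γ x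

lemma Neg.face (h : P.Neg y x) : P.Face y x := .inl h.1

lemma Pos.face (h : P.Pos y x) : P.Face y x := .inr h.1

lemma Loop.face (h : P.Loop y x) : P.Face y x := .inl h.1

lemma neg_or_loop_of_mem_δ (h : y ∈ P.δ x) : P.Neg y x ∨ P.Loop y x :=
  (em (y ∈ P.γ x)).symm.imp (⟨h, ·⟩) (⟨h, ·⟩)

lemma pos_or_loop_of_mem_γ (h : y ∈ P.γ x) : P.Pos y x ∨ P.Loop y x :=
  (em (y ∈ P.δ x)).symm.imp (⟨h, ·⟩) (⟨·, h⟩)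

lemma Face.neg_or_pos_or_loop (h : P.Face y x) : P.Neg y x ∨ P.Pos y x ∨ P.Loop y x := by
  rcases h with h | h
  · exact (neg_or_loop_of_mem_δ h).imp_right .inr
  · exact .inr (pos_or_loop_of_mem_γ h)

lemma Face.dim_add_one (h : P.Face y x) : P.dim y + 1 = P.dim x :=
  h.elim (P.dim_of_mem_δ x y) (P.dim_of_mem_γ x y)

lemma Face.dim_nonneg (h : P.Face y x) : 0 ≤ P.dim x := by
  linarith [h.dim_add_one, P.neg_one_le_dim y]

lemma Face.dim_eq (h : P.Face y x) (h' : P.Face y' x) : P.dim y = P.dim y' := by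
  linarith [h.dim_add_one, h'.dim_add_one]

lemma Face.dim_eq_dim_coface (h : P.Face y x) (h' : P.Face y x') : P.dim x = P.dim x' := by
  linarith [h.dim_add_one, h'.dim_add_one]

lemma exists_mem_γ (h : 0 ≤ P.dim x) : ∃ y, y ∈ P.γ x :=
  (P.γ_singleton x h).imp fun y hy => by simp [hy]

lemma eq_of_mem_γ (h : y ∈ P.γ x) (h' : y' ∈ P.γ x) : y = y' := by
  obtain ⟨w, hw⟩ := P.γ_singleton x (Face.dim_nonneg (.inr h))
  rw [hw] at h h'
  exact h.trans h'.symm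

lemma Pos.unique (h : P.Pos y x) (h' : P.Pos y' x) : y = y' := eq_of_mem_γ h.1 h'.1

lemma Pos.not_neg (h : P.Pos y x) : ¬ P.Neg y x := fun h' => h.2 h'.1

lemma Loop.not_neg (h : P.Loop y x) : ¬ P.Neg y' x := fun h' =>
  h'.2 (P.δ_eq_γ x ⟨y, h⟩ ▸ h'.1)

lemma Loop.not_pos (h : P.Loop y x) : ¬ P.Pos y' x := fun h' =>
  h'.2 (P.δ_eq_γ x ⟨y, h⟩ ▸ h'.1)

lemma Loop.eq_of_face (h : P.Loop y x) (h' : P.Face y' x) : y' = y := by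
  rcases h'.neg_or_pos_or_loop with h' | h' | h'
  · exact (h.not_neg h').elim
  · exact (h.not_pos h').elim
  · exact eq_of_mem_γ h'.2 h.2

lemma Neg.exists_pos (h : P.Neg y x) : ∃ z, P.Pos z x :=
  have ⟨z, hz⟩ := exists_mem_γ h.face.dim_nonneg
  ⟨z, (pos_or_loop_of_mem_γ hz).resolve_right fun hl => hl.not_neg h⟩

lemma Le.eq_or_dim_lt (h : P.Le x y) : x = y ∨ P.dim x < P.dim y := by
  induction h with
  | refl => exact .inl rfl
  | tail _ h ih =>
    have := Face.dim_add_one h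
    rcases ih with rfl | ih <;> exact .inr (by lia)

lemma IsGreatestCell.exists_coface {ω : P.Cell} (hω : P.IsGreatestCell ω)
    (h : P.dim x < P.dim ω) : ∃ y, P.Face x y := by
  rcases Relation.ReflTransGen.cases_head (hω x) with rfl | ⟨y, hy, -⟩
  · exact (lt_irrefl _ h).elim
  · exact ⟨y, hy⟩

lemma IsGreatestCell.exists_isIteratedTarget {ω : P.Cell} (hω : P.IsGreatestCell ω) {d : ℤ}
    (hd : -1 ≤ d) (hdω : d ≤ P.dim ω) : ∃ g, P.IsIteratedTarget g ∧ P.dim g = d := by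
  induction d, hdω using Int.leInductionDown with
  | base => exact ⟨ω, ⟨ω, hω, .refl⟩, rfl⟩
  | pred d _ ih =>
    obtain ⟨g, ⟨ω', hω', hg⟩, hgd⟩ := ih (by lia)
    obtain ⟨g', hg'⟩ := exists_mem_γ (x := g) (by lia)
    exact ⟨g', ⟨ω', hω', hg.tail hg'⟩, by linarith [P.dim_of_mem_γ _ _ hg']⟩

lemma IsIteratedTarget.exists_mem_γ_of_face (hy : P.IsIteratedTarget y) (h : P.Face y x) :
    ∃ g, y ∈ P.γ g ∧ P.IsIteratedTarget g ∧ P.dim g = P.dim x := by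
  obtain ⟨ω, hω, hωy⟩ := hy
  rcases Relation.ReflTransGen.cases_tail hωy with rfl | ⟨g, hg, hgy⟩
  · have := h.dim_add_one
    rcases (hω x).eq_or_dim_lt with rfl | h' <;> lia
  · exact ⟨g, hgy, ⟨ω, hω, hg⟩, Face.dim_eq_dim_coface (.inr hgy) h⟩

end FacetPoset

namespace MOP.IsDFC

variable {C : MOP.{u}} {α β : SignType} {x y y' z : C.Cell}

open FacetPoset

/-! ### Lozenge completion -/

lemma exists_facet_facet_of_ne_zero (hC : C.IsDFC) (hα : α ≠ 0) (hβ : β ≠ 0)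
    (h : C.Facet β z y) (h' : C.Facet α y x) :
    ∃ (y' : C.Cell) (α' β' : SignType), α' ≠ 0 ∧ β' ≠ 0 ∧ C.Facet β' z y' ∧ C.Facet α' y' x ∧
      α * β = -(α' * β') := by
  obtain ⟨y', ⟨hne, α', β', hα', hβ', hz, hx⟩, -⟩ := hC.thin α β z y x hα hβ h h'
  exact ⟨y', α', β', hα', hβ', hz, hx,
    hC.sign α β α' β' z y y' x hα hβ hα' hβ' hne h h' hz hx⟩

lemma exists_pos_neg_or_neg_pos_of_mul_eq_one (hC : C.IsDFC) (hαβ : α * β = 1)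
    (h : C.Facet β z y) (h' : C.Facet α y x) :
    ∃ y', (C.Pos z y' ∧ C.Neg y' x) ∨ (C.Neg z y' ∧ C.Pos y' x) := by
  obtain ⟨y', α', β', hα', hβ', hz, hx, hs⟩ := hC.exists_facet_facet_of_ne_zero
    (by rintro rfl; simp at hαβ) (by rintro rfl; simp at hαβ) h h'
  rw [hαβ] at hs
  cases α' <;> cases β' <;> first | exact absurd hs (by decide) | skip
  exacts [⟨y', .inl ⟨hz, hx⟩⟩, ⟨y', .inr ⟨hz, hx⟩⟩]

lemma exists_neg_neg_or_pos_pos_of_mul_eq_neg_one (hC : C.IsDFC) (hαβ : α * β = -1)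
    (h : C.Facet β z y) (h' : C.Facet α y x) :
    ∃ y', (C.Neg z y' ∧ C.Neg y' x) ∨ (C.Pos z y' ∧ C.Pos y' x) := by
  obtain ⟨y', α', β', hα', hβ', hz, hx, hs⟩ := hC.exists_facet_facet_of_ne_zero
    (by rintro rfl; simp at hαβ) (by rintro rfl; simp at hαβ) h h'
  rw [hαβ] at hs
  cases α' <;> cases β' <;> first | exact absurd hs (by decide) | skip
  exacts [⟨y', .inl ⟨hz, hx⟩⟩, ⟨y', .inr ⟨hz, hx⟩⟩]

lemma exists_pos_neg_or_neg_pos_of_neg_neg (hC : C.IsDFC) (h : C.Neg z y) (h' : C.Neg y x) :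
    ∃ y', (C.Pos z y' ∧ C.Neg y' x) ∨ (C.Neg z y' ∧ C.Pos y' x) :=
  hC.exists_pos_neg_or_neg_pos_of_mul_eq_one (α := .neg) (β := .neg) (by decide) h h'

lemma exists_neg_neg_or_pos_pos_of_pos_neg (hC : C.IsDFC) (h : C.Pos z y) (h' : C.Neg y x) :
    ∃ y', (C.Neg z y' ∧ C.Neg y' x) ∨ (C.Pos z y' ∧ C.Pos y' x) :=
  hC.exists_neg_neg_or_pos_pos_of_mul_eq_neg_one (α := .neg) (β := .pos) (by decide) h h'

lemma exists_neg_neg_of_neg_pos (hC : C.IsDFC) (h : C.Neg z y) (h' : C.Pos y x) :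
    ∃ y', C.Neg z y' ∧ C.Neg y' x := by
  obtain ⟨y', hy' | ⟨hz, hx⟩⟩ :=
    hC.exists_neg_neg_or_pos_pos_of_mul_eq_neg_one (α := .pos) (β := .neg) (by decide) h h'
  · exact ⟨y', hy'⟩
  · exact ((h'.unique hx ▸ hz).not_neg h).elim

lemma exists_pos_neg_of_pos_pos (hC : C.IsDFC) (h : C.Pos z y) (h' : C.Pos y x) :
    ∃ y', C.Pos z y' ∧ C.Neg y' x := by
  obtain ⟨y', hy' | ⟨hz, hx⟩⟩ :=
    hC.exists_pos_neg_or_neg_pos_of_mul_eq_one (α := .pos) (β := .pos) (by decide) h h'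
  · exact ⟨y', hy'⟩
  · exact (h.not_neg (h'.unique hx ▸ hz)).elim

lemma eq_of_facet_facet_of_mul_eq (hC : C.IsDFC) {α' β' : SignType} (hαβ : α * β ≠ 0)
    (h : C.Facet β z y) (h' : C.Facet α y x) (k : C.Facet β' z y') (k' : C.Facet α' y' x)
    (hs : α * β = α' * β') : y = y' := by
  by_contra hne
  have hα := left_ne_zero_of_mul hαβ
  have hβ := right_ne_zero_of_mul hαβ
  have hs' := hC.sign α β α' β' z y y' x hα hβ (left_ne_zero_of_mul (hs ▸ hαβ))
    (right_ne_zero_of_mul (hs ▸ hαβ)) (Ne.symm hne) h h' k k'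
  rw [← hs] at hs'
  revert hs' hα hβ
  cases α <;> cases β <;> decide

lemma neg_neg_unique (hC : C.IsDFC) (h : C.Neg z y) (h' : C.Neg y x) (k : C.Neg z y')
    (k' : C.Neg y' x) : y = y' :=
  hC.eq_of_facet_facet_of_mul_eq (α := .neg) (β := .neg) (α' := .neg) (β' := .neg)
    (by decide) h h' k k' rfl

lemma pos_neg_unique (hC : C.IsDFC) (h : C.Pos z y) (h' : C.Neg y x) (k : C.Pos z y')
    (k' : C.Neg y' x) : y = y' :=
  hC.eq_of_facet_facet_of_mul_eq (α := .neg) (β := .pos) (α' := .neg) (β' := .pos)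
    (by decide) h h' k k' rfl

lemma not_neg_neg_of_pos_pos (hC : C.IsDFC) (h : C.Pos z y) (h' : C.Pos y x) (k : C.Neg z y') :
    ¬ C.Neg y' x := by
  intro k'
  obtain rfl := hC.eq_of_facet_facet_of_mul_eq (α := .pos) (β := .pos) (α' := .neg) (β' := .neg)
    (by decide) h h' k k' (by decide)
  exact h'.not_neg k'

lemma not_pos_neg_of_neg_pos (hC : C.IsDFC) (h : C.Neg z y) (h' : C.Pos y x) (k : C.Pos z y') :
    ¬ C.Neg y' x := by
  intro k'
  obtain rfl := hC.eq_of_facet_facet_of_mul_eq (α := .pos) (β := .neg) (α' := .neg) (β' := .pos)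
    (by decide) h h' k k' (by decide)
  exact h'.not_neg k'

lemma exists_loop_pos_or_neg_neg_or_pos_neg (hC : C.IsDFC) (h : C.Loop z y) (h' : C.Neg y x) :
    ∃ y', (C.Loop z y' ∧ C.Pos y' x) ∨ (C.Neg z y' ∧ C.Neg y' x) ∨ (C.Pos z y' ∧ C.Neg y' x) := by
  obtain ⟨y', α, β, -, hz, hx, hne⟩ := hC.thin_loop z y x h h'
  cases α <;> cases β
  case zero.zero | zero.neg | zero.pos => exact (Loop.not_neg hx h').elim
  case neg.zero => exact (hne rfl).elim
  case neg.neg => exact ⟨y', .inr (.inl ⟨hz, hx⟩)⟩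
  case neg.pos => exact ⟨y', .inr (.inr ⟨hz, hx⟩)⟩
  case pos.zero => exact ⟨y', .inl ⟨hz, hx⟩⟩
  case pos.neg => exact (hC.exists_neg_neg_of_neg_pos hz hx).imp fun _ hw => .inr (.inl hw)
  case pos.pos => exact (hC.exists_pos_neg_of_pos_pos hz hx).imp fun _ hw => .inr (.inr hw)

lemma exists_neg_neg_or_face_pos (hC : C.IsDFC) (h : C.Face z y) (h' : C.Neg y x) :
    ∃ y', (C.Neg z y' ∧ C.Neg y' x) ∨ (C.Face z y' ∧ C.Pos y' x) := by
  have of_pos {w} (hz : C.Pos z w) (hx : C.Neg w x) :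
      ∃ y', (C.Neg z y' ∧ C.Neg y' x) ∨ (C.Face z y' ∧ C.Pos y' x) :=
    (hC.exists_neg_neg_or_pos_pos_of_pos_neg hz hx).imp fun _ hw =>
      hw.imp_right (.imp_left Pos.face)
  rcases h.neg_or_pos_or_loop with h | h | h
  · exact ⟨y, .inl ⟨h, h'⟩⟩
  · exact of_pos h h'
  · obtain ⟨y', ⟨hz, hx⟩ | hy' | ⟨hz, hx⟩⟩ := hC.exists_loop_pos_or_neg_neg_or_pos_neg h h'
    exacts [⟨y', .inr ⟨hz.face, hx⟩⟩, ⟨y', .inl hy'⟩, of_pos hz hx]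

lemma not_pos_neg_of_loop_pos (hC : C.IsDFC) (h : C.Loop z y) (h' : C.Pos y x) {v w : C.Cell}
    (hv : C.Pos v w) : ¬ C.Neg w x := by
  have := C.finite
  have hx : 1 ≤ C.dim x := by linarith [h.face.dim_nonneg, h'.face.dim_add_one]
  induction w using (wellFounded_of_acyclic (hC.acyclic x hx)).induction generalizing v with
  | _ w ih =>
  intro hw
  obtain ⟨w', ⟨hvw', hw'⟩ | ⟨hvw', hw'⟩⟩ := hC.exists_neg_neg_or_pos_pos_of_pos_neg hv hw
  · obtain ⟨v', hv'⟩ := exists_mem_γ hvw'.face.dim_nonneg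
    rcases pos_or_loop_of_mem_γ hv' with hv' | hv'
    · exact ih w' ⟨hw', hw, v, hvw', hv⟩ hv' hw'
    · exact hv'.not_neg hvw'
  · exact h.not_pos (hw'.unique h' ▸ hvw')

lemma loop_of_loop_pos (hC : C.IsDFC) (h : C.Loop z y) (h' : C.Pos y x) (k : C.Neg y' x) :
    C.Loop z y' := by
  have loop_of_neg {w} (hw : C.Neg w x) : ∃ v, C.Loop v w := by
    obtain ⟨v, hv⟩ := exists_mem_γ (x := w)
      (by rw [hw.face.dim_eq h'.face]; exact h.face.dim_nonneg)
    exact ⟨v, (pos_or_loop_of_mem_γ hv).resolve_left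
      fun hv => hC.not_pos_neg_of_loop_pos h h' hv hw⟩
  obtain ⟨v, hv⟩ := loop_of_neg k
  obtain ⟨w, ⟨hvw, hw⟩ | ⟨hvw, hw⟩ | ⟨hvw, hw⟩⟩ := hC.exists_loop_pos_or_neg_neg_or_pos_neg hv k
  · obtain rfl := hw.unique h'
    rwa [eq_of_mem_γ h.2 hvw.2]
  · exact ((loop_of_neg hw).choose_spec.not_neg hvw).elim
  · exact ((loop_of_neg hw).choose_spec.not_pos hvw).elim

lemma not_loop_of_mem_lam (hC : C.IsDFC) (hy : y ∈ C.Lam) : ¬ C.Loop z y :=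
  fun h => (hC.loops z y h).elim hy

lemma exists_pos_of_mem_lam (hC : C.IsDFC) (hy : y ∈ C.Lam) (h : 0 ≤ C.dim y) :
    ∃ z, C.Pos z y :=
  (exists_mem_γ h).imp fun _ hz =>
    (pos_or_loop_of_mem_γ hz).resolve_right (hC.not_loop_of_mem_lam hy)

lemma exists_isIteratedTarget_dim_eq (hC : C.IsDFC) (x : C.Cell) :
    ∃ g, C.IsIteratedTarget g ∧ C.dim g = C.dim x := by
  obtain ⟨ω, hω, -⟩ := hC.greatest
  exact hω.exists_isIteratedTarget (C.neg_one_le_dim x)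
    (by rcases (hω x).eq_or_dim_lt with rfl | h <;> lia)

end MOP.IsDFC

/-! ### The tree of cells of a given dimension -/

namespace MOP

variable {C : MOP.{u}} {a a' b b' d d' e g g' t t' x y z z' : C.Cell}

open FacetPoset Relation

/-- One step towards the root in the tree whose edges are the cells of a given dimension `k` and
whose nodes are the elements of `Λₖ₊₁`: `b'` is the target of a node of which `b` is a source. -/
def EdgeStep (C : MOP.{u}) (b b' : C.Cell) : Prop := ∃ a ∈ C.Lam, C.Neg b a ∧ C.Pos b' a

/-- There is a descending path from the edge `b` to the edge `b'` in the tree of `EdgeStep`. -/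
abbrev Descends (C : MOP.{u}) : C.Cell → C.Cell → Prop := ReflTransGen C.EdgeStep

lemma EdgeStep.dim_eq (h : C.EdgeStep b b') : C.dim b = C.dim b' := by
  obtain ⟨a, -, hb, hb'⟩ := h
  exact hb.face.dim_eq hb'.face

lemma Descends.dim_eq (h : C.Descends b b') : C.dim b = C.dim b' := by
  induction h with
  | refl => rfl
  | tail _ h ih => exact ih.trans h.dim_eq

/-- The cells of the dimension `k` of `g` are the edges of a rooted tree with root `g`, whose nodes
are the elements of `Λₖ₊₁` and whose leaves are in `Λₖ`; moreover `Λₖ` consists either of `g` alone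
or of the sources of a cell with target `g`. The latter is what the induction on `k` runs on. -/
structure IsLevelRoot (C : MOP.{u}) (g : C.Cell) : Prop where
  lam : (∀ y, C.dim y = C.dim g → (y ∈ C.Lam ↔ y = g)) ∨
    ∃ G, C.Pos g G ∧ ∀ y, C.dim y = C.dim g → (y ∈ C.Lam ↔ C.Neg y G)
  eq_or_neg : ∀ y, C.dim y = C.dim g → y = g ∨ ∃ a ∈ C.Lam, C.Neg y a
  lam_or_pos : ∀ y, C.dim y = C.dim g → y ∈ C.Lam ∨ ∃ a ∈ C.Lam, C.Pos y a
  acyclic : ∀ y, C.dim y = C.dim g → ¬ TransGen C.EdgeStep y y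

lemma isLevelRoot_of_isGreatestCell (hg : C.IsGreatestCell g) : C.IsLevelRoot g := by
  have eq_greatest : ∀ y, C.dim y = C.dim g → y = g := fun y hy =>
    (hg y).eq_or_dim_lt.resolve_right (by lia)
  have not_face : ∀ y w, C.dim y = C.dim g → ¬ C.Face y w := fun y w hy h => by
    have := h.dim_add_one
    rcases (hg w).eq_or_dim_lt with rfl | h' <;> lia
  have mem_lam : ∀ y, C.dim y = C.dim g → y ∈ C.Lam := fun y hy w hw => not_face y w hy hw.face
  refine ⟨.inl fun y hy => ⟨fun _ => eq_greatest y hy, fun _ => mem_lam y hy⟩,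
    fun y hy => .inl (eq_greatest y hy), fun y hy => .inl (mem_lam y hy), fun y hy h => ?_⟩
  obtain ⟨-, ⟨a, -, ha, -⟩, -⟩ := TransGen.head'_iff.1 h
  exact not_face y a hy ha.face

lemma exists_cycleStep_of_transGen_edgeStep {G : C.Cell}
    (hG : ∀ y ∈ C.Lam, C.dim y + 1 = C.dim G → C.Neg y G) (hz : C.dim z + 2 = C.dim G)
    (h : TransGen C.EdgeStep z z') :
    ∃ a a', C.Neg z a ∧ C.Neg a G ∧ C.Pos z' a' ∧ C.Neg a' G ∧
      ReflTransGen (C.CycleStep G) a' a := by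
  induction h with
  | single h =>
    obtain ⟨a, ha, hza, hz'a⟩ := h
    have haG := hG a ha (by linarith [hza.face.dim_add_one])
    exact ⟨a, a, hza, haG, hz'a, haG, .refl⟩
  | tail h' h ih =>
    obtain ⟨a, a', hza, haG, hwa', ha'G, hpath⟩ := ih
    obtain ⟨a'', ha'', hwa'', hz'a''⟩ := h
    have ha''G := hG a'' ha''
      (by linarith [Descends.dim_eq h'.to_reflTransGen, hwa''.face.dim_add_one])
    exact ⟨a, a'', hza, haG, hz'a'', ha''G, .head ⟨ha''G, ha'G, _, hwa'', hwa'⟩ hpath⟩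

namespace IsLevelRoot

lemma acyclic_of_mem_γ (hC : C.IsDFC) (hg : C.IsLevelRoot g) (h : g' ∈ C.γ g)
    (hy : C.dim y = C.dim g') : ¬ TransGen C.EdgeStep y y := by
  have hdim := C.dim_of_mem_γ _ _ h
  intro hcycle
  rcases hg.lam with hlam | ⟨G, hgG, hlam⟩
  · obtain ⟨-, ⟨a, ha, hya, -⟩, -⟩ := TransGen.head'_iff.1 hcycle
    obtain ⟨-, -, ⟨a', ha', -, hya'⟩⟩ := TransGen.tail'_iff.1 hcycle
    obtain rfl := (hlam a (by linarith [hya.face.dim_add_one])).1 ha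
    obtain rfl := (hlam a' (by linarith [hya'.face.dim_add_one])).1 ha'
    exact hya'.not_neg hya
  · have hG := hgG.face.dim_add_one
    obtain ⟨a, a', hya, haG, hya', ha'G, hpath⟩ := exists_cycleStep_of_transGen_edgeStep
      (fun y hy hyG => (hlam y (by lia)).1 hy) (by lia) hcycle
    exact hC.acyclic G (by linarith [hya.face.dim_nonneg, haG.face.dim_add_one]) a
      (.head' ⟨haG, ha'G, _, hya, hya'⟩ hpath)

lemma acyclic_restrict (hg : C.IsLevelRoot g) (y : C.Cell) :
    ¬ TransGen (fun b b' => C.dim b = C.dim g ∧ C.EdgeStep b b') y y := by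
  intro h
  obtain ⟨-, ⟨hy, -⟩, -⟩ := TransGen.head'_iff.1 h
  exact hg.acyclic y hy (h.lift id fun _ _ h => h.2)

lemma wellFounded (hg : C.IsLevelRoot g) :
    WellFounded fun b b' => C.dim b = C.dim g ∧ C.EdgeStep b b' :=
  have := C.finite
  wellFounded_of_acyclic hg.acyclic_restrict

lemma wellFounded_swap (hg : C.IsLevelRoot g) :
    WellFounded fun b' b => C.dim b = C.dim g ∧ C.EdgeStep b b' :=
  have := C.finite
  wellFounded_swap_of_acyclic (r := fun b b' => C.dim b = C.dim g ∧ C.EdgeStep b b')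
    hg.acyclic_restrict

lemma exists_lam_descends (hg : C.IsLevelRoot g) {p : C.Cell → Prop}
    (hp : ∀ {y x}, p y → C.Pos y x → ∃ y', p y' ∧ C.Neg y' x) (hy : C.dim y = C.dim g)
    (h : p y) : ∃ t ∈ C.Lam, C.Descends t y ∧ p t := by
  induction y using hg.wellFounded.induction with
  | _ y ih =>
  rcases hg.lam_or_pos y hy with hyΛ | ⟨a, ha, hya⟩
  · exact ⟨y, hyΛ, .refl, h⟩
  · obtain ⟨y', hy', hy'a⟩ := hp h hya
    have hdim : C.dim y' = C.dim g := (hy'a.face.dim_eq hya.face).trans hy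
    have hstep : C.EdgeStep y' y := ⟨a, ha, hy'a, hya⟩
    obtain ⟨t, ht, hty', htp⟩ := ih y' ⟨hdim, hstep⟩ hdim hy'
    exact ⟨t, ht, hty'.tail hstep, htp⟩

lemma eq_or_exists_neg_of_face (hC : C.IsDFC) (hg : C.IsLevelRoot g) (h : g' ∈ C.γ g)
    (hy : C.dim y = C.dim g) (hz : C.Face z y) : z = g' ∨ ∃ y', C.Neg z y' := by
  induction y using hg.wellFounded_swap.induction with
  | _ y ih =>
  rcases hg.eq_or_neg y hy with rfl | ⟨a, ha, hya⟩
  · rcases hz.neg_or_pos_or_loop with hz | hz | hz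
    exacts [.inr ⟨y, hz⟩, .inl (eq_of_mem_γ hz.1 h), .inl (eq_of_mem_γ hz.2 h)]
  · obtain ⟨y', ⟨hzy', -⟩ | ⟨hzy', hy'a⟩⟩ := hC.exists_neg_neg_or_face_pos hz hya
    · exact .inr ⟨y', hzy'⟩
    · exact ih y' ⟨hy, a, ha, hya, hy'a⟩ ((hy'a.face.dim_eq hya.face).trans hy) hzy'

lemma eq_or_neg_of_mem_γ (hC : C.IsDFC) (hg : C.IsLevelRoot g) (h : g' ∈ C.γ g)
    (hy : C.dim y = C.dim g) (hz : C.Face z y) : z = g' ∨ ∃ a ∈ C.Lam, C.Neg z a := by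
  refine (eq_or_exists_neg_of_face hC hg h hy hz).imp_right fun ⟨y', hzy'⟩ => ?_
  obtain ⟨a, ha, -, hza⟩ := hg.exists_lam_descends (p := C.Neg z)
    hC.exists_neg_neg_of_neg_pos ((hzy'.face.dim_eq_dim_coface hz).trans hy) hzy'
  exact ⟨a, ha, hza⟩

lemma lam_or_pos_of_mem_γ (hC : C.IsDFC) (hg : C.IsLevelRoot g) (h : g' ∈ C.γ g)
    (hz : C.dim z = C.dim g') : z ∈ C.Lam ∨ ∃ a ∈ C.Lam, C.Pos z a := by
  refine or_iff_not_imp_left.2 fun hzΛ => ?_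
  obtain ⟨y, hzy⟩ : ∃ y, C.Pos z y := by simpa only [Lam, Set.mem_ofPred_eq, not_forall, not_not]
    using hzΛ
  obtain ⟨a, ha, -, hza⟩ := hg.exists_lam_descends (p := C.Pos z) hC.exists_pos_neg_of_pos_pos
    (by linarith [hzy.face.dim_add_one, C.dim_of_mem_γ _ _ h]) hzy
  exact ⟨a, ha, hza⟩

lemma mem_δ_of_mem_lam (hC : C.IsDFC) (hg : C.IsLevelRoot g) (h : g' ∈ C.γ g)
    (hz : z = g' ∨ ∃ a ∈ C.Lam, C.Neg z a) (hzdim : C.dim z = C.dim g') (hzΛ : z ∈ C.Lam) :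
    z ∈ C.δ g := by
  have hg' := C.dim_of_mem_γ _ _ h
  rcases hz with rfl | ⟨y, hyΛ, hzy⟩
  · exact ((pos_or_loop_of_mem_γ h).resolve_left (hzΛ g)).1
  have hy : C.dim y = C.dim g := by linarith [hzy.face.dim_add_one]
  rcases hg.lam with hlam | ⟨G, hgG, hlam⟩
  · rw [← (hlam y hy).1 hyΛ]
    exact hzy.1
  · obtain ⟨y', ⟨hzy', -⟩ | ⟨hzy', hy'G⟩⟩ :=
      hC.exists_pos_neg_or_neg_pos_of_neg_neg hzy ((hlam y hy).1 hyΛ)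
    · exact (hzΛ _ hzy').elim
    · rw [← hy'G.unique hgG]
      exact hzy'.1

lemma mem_lam_of_mem_δ (hC : C.IsDFC) (hg : C.IsLevelRoot g)
    (hz : z ∈ C.Lam ∨ ∃ a ∈ C.Lam, C.Pos z a) (hzg : z ∈ C.δ g) : z ∈ C.Lam := by
  refine hz.resolve_right fun ⟨y, hyΛ, hzy⟩ => ?_
  have hy : C.dim y = C.dim g := hzy.face.dim_eq_dim_coface (.inl hzg)
  rcases hg.lam with hlam | ⟨G, hgG, hlam⟩
  · exact hzy.2 ((hlam y hy).1 hyΛ ▸ hzg)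
  · have hyG := (hlam y hy).1 hyΛ
    rcases neg_or_loop_of_mem_δ hzg with hzg | hzg
    · exact hC.not_pos_neg_of_neg_pos hzg hgG hzy hyG
    · exact (hC.loop_of_loop_pos hzg hgG hyG).not_pos hzy

lemma of_mem_γ (hC : C.IsDFC) (hg : C.IsLevelRoot g) (h : g' ∈ C.γ g)
    (hcoface : ∀ z, C.dim z = C.dim g' → ∃ y, C.Face z y) : C.IsLevelRoot g' := by
  have eq_or_neg : ∀ z, C.dim z = C.dim g' → z = g' ∨ ∃ a ∈ C.Lam, C.Neg z a := fun z hz =>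
    have ⟨y, hzy⟩ := hcoface z hz
    eq_or_neg_of_mem_γ hC hg h
      (by linarith [hzy.dim_add_one, C.dim_of_mem_γ _ _ h]) hzy
  have lam_or_pos : ∀ z, C.dim z = C.dim g' → z ∈ C.Lam ∨ ∃ a ∈ C.Lam, C.Pos z a := fun z hz =>
    lam_or_pos_of_mem_γ hC hg h hz
  have mem_lam_iff : ∀ z, C.dim z = C.dim g' → (z ∈ C.Lam ↔ z ∈ C.δ g) := fun z hz =>
    ⟨mem_δ_of_mem_lam hC hg h (eq_or_neg z hz) hz, mem_lam_of_mem_δ hC hg (lam_or_pos z hz)⟩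
  refine ⟨?_, eq_or_neg, lam_or_pos, fun y hy => acyclic_of_mem_γ hC hg h hy⟩
  rcases pos_or_loop_of_mem_γ h with hg'g | hg'g
  · refine .inr ⟨g, hg'g, fun z hz => (mem_lam_iff z hz).trans ⟨fun hzg => ?_, And.left⟩⟩
    exact (neg_or_loop_of_mem_δ hzg).resolve_right fun hzg => hzg.not_pos hg'g
  · refine .inl fun z hz => (mem_lam_iff z hz).trans ⟨fun hzg => hg'g.eq_of_face (.inl hzg), ?_⟩
    rintro rfl
    exact hg'g.1

end IsLevelRoot

namespace IsDFC

lemma isLevelRoot_of_isIteratedTarget (hC : C.IsDFC) (hg : C.IsIteratedTarget g) :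
    C.IsLevelRoot g := by
  obtain ⟨ω, hω, h⟩ := hg
  suffices C.IsLevelRoot g ∧ C.dim g ≤ C.dim ω from this.1
  induction h with
  | refl => exact ⟨isLevelRoot_of_isGreatestCell hω, le_rfl⟩
  | tail _ h ih =>
    have hdim := C.dim_of_mem_γ _ _ h
    exact ⟨ih.1.of_mem_γ hC h fun z hz => hω.exists_coface (by lia), by lia⟩

lemma lam_or_pos (hC : C.IsDFC) (b : C.Cell) : b ∈ C.Lam ∨ ∃ a ∈ C.Lam, C.Pos b a := by
  obtain ⟨g, hg, hgb⟩ := hC.exists_isIteratedTarget_dim_eq b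
  exact (hC.isLevelRoot_of_isIteratedTarget hg).lam_or_pos b hgb.symm

lemma isIteratedTarget_or_neg (hC : C.IsDFC) (b : C.Cell) :
    C.IsIteratedTarget b ∨ ∃ a ∈ C.Lam, C.Neg b a := by
  obtain ⟨g, hg, hgb⟩ := hC.exists_isIteratedTarget_dim_eq b
  exact ((hC.isLevelRoot_of_isIteratedTarget hg).eq_or_neg b hgb.symm).imp_left
    fun (h : b = g) => h ▸ hg

lemma edgeStep_acyclic (hC : C.IsDFC) (b : C.Cell) : ¬ TransGen C.EdgeStep b b := by
  obtain ⟨g, hg, hgb⟩ := hC.exists_isIteratedTarget_dim_eq b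
  exact (hC.isLevelRoot_of_isIteratedTarget hg).acyclic b hgb.symm

lemma wellFounded_edgeStep (hC : C.IsDFC) : WellFounded C.EdgeStep :=
  have := C.finite
  wellFounded_of_acyclic hC.edgeStep_acyclic

lemma wellFounded_swap_edgeStep (hC : C.IsDFC) : WellFounded (Function.swap C.EdgeStep) :=
  have := C.finite
  wellFounded_swap_of_acyclic hC.edgeStep_acyclic

lemma eq_of_pos_of_pos (hC : C.IsDFC) (ha : a ∈ C.Lam) (ha' : a' ∈ C.Lam) (h : C.Pos b a)
    (h' : C.Pos b a') : a = a' := by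
  obtain ⟨g, hg, hga⟩ := hC.exists_isIteratedTarget_dim_eq a
  have hga' : C.dim a' = C.dim g := (h'.face.dim_eq_dim_coface h.face).trans hga.symm
  rcases (hC.isLevelRoot_of_isIteratedTarget hg).lam with hlam | ⟨G, -, hlam⟩
  · exact ((hlam a hga.symm).1 ha).trans ((hlam a' hga').1 ha').symm
  · exact hC.pos_neg_unique h ((hlam a hga.symm).1 ha) h' ((hlam a' hga').1 ha')

lemma eq_of_neg_of_neg (hC : C.IsDFC) (ha : a ∈ C.Lam) (ha' : a' ∈ C.Lam) (h : C.Neg b a)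
    (h' : C.Neg b a') : a = a' := by
  obtain ⟨g, hg, hga⟩ := hC.exists_isIteratedTarget_dim_eq a
  have hga' : C.dim a' = C.dim g := (h'.face.dim_eq_dim_coface h.face).trans hga.symm
  rcases (hC.isLevelRoot_of_isIteratedTarget hg).lam with hlam | ⟨G, -, hlam⟩
  · exact ((hlam a hga.symm).1 ha).trans ((hlam a' hga').1 ha').symm
  · exact hC.neg_neg_unique h ((hlam a hga.symm).1 ha) h' ((hlam a' hga').1 ha')

lemma not_neg_of_isIteratedTarget (hC : C.IsDFC) (hb : C.IsIteratedTarget b) (ha : a ∈ C.Lam) :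
    ¬ C.Neg b a := by
  intro hba
  obtain ⟨g, hbg, hg, hga⟩ := hb.exists_mem_γ_of_face hba.face
  rcases (hC.isLevelRoot_of_isIteratedTarget hg).lam with hlam | ⟨G, hgG, hlam⟩
  · exact ((hlam a hga.symm).1 ha ▸ hba).2 hbg
  · have haG := (hlam a hga.symm).1 ha
    rcases pos_or_loop_of_mem_γ hbg with hbg | hbg
    · exact hC.not_neg_neg_of_pos_pos hbg hgG hba haG
    · exact (hC.loop_of_loop_pos hbg hgG haG).not_neg hba

lemma isIteratedTarget_unique (hC : C.IsDFC) (hb : C.IsIteratedTarget b)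
    (hb' : C.IsIteratedTarget b') (hd : C.dim b = C.dim b') : b = b' := by
  rcases (hC.isLevelRoot_of_isIteratedTarget hb).eq_or_neg b' hd.symm with h | ⟨a, ha, h⟩
  · exact h.symm
  · exact (hC.not_neg_of_isIteratedTarget hb' ha h).elim

lemma edgeStep_unique (hC : C.IsDFC) (h : C.EdgeStep t b) (h' : C.EdgeStep t b') : b = b' := by
  obtain ⟨a, ha, hta, hba⟩ := h
  obtain ⟨a', ha', hta', hba'⟩ := h'
  obtain rfl := hC.eq_of_neg_of_neg ha ha' hta hta'
  exact hba.unique hba'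

lemma exists_descends_isIteratedTarget (hC : C.IsDFC) (b : C.Cell) :
    ∃ g, C.IsIteratedTarget g ∧ C.Descends b g := by
  induction b using hC.wellFounded_swap_edgeStep.induction with
  | _ b ih =>
  rcases hC.isIteratedTarget_or_neg b with h | ⟨a, ha, hba⟩
  · exact ⟨b, h, .refl⟩
  · obtain ⟨b', hb'a⟩ := hC.exists_pos_of_mem_lam ha hba.face.dim_nonneg
    have hstep : C.EdgeStep b b' := ⟨a, ha, hba, hb'a⟩
    obtain ⟨g, hg, hb'g⟩ := ih b' hstep
    exact ⟨g, hg, .head hstep hb'g⟩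

lemma descends_total (hC : C.IsDFC) (h : C.Descends t b) (h' : C.Descends t b') :
    C.Descends b b' ∨ C.Descends b' b :=
  ReflTransGen.total_of_right_unique (fun _ _ _ => hC.edgeStep_unique) h h'

lemma descends_antisymm (hC : C.IsDFC) (h : C.Descends b b') (h' : C.Descends b' b) :
    b = b' := by
  rcases reflTransGen_iff_eq_or_transGen.1 h with rfl | h
  · rfl
  · exact (hC.edgeStep_acyclic b (h.trans_left h')).elim

lemma descends_of_neg_of_pos_of_ne (hC : C.IsDFC) (ha : a ∈ C.Lam) (hd : C.Neg d a)
    (hb : C.Pos b a) (h : C.Descends d e) (hne : d ≠ e) : C.Descends b e := by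
  rcases ReflTransGen.cases_head h with rfl | ⟨b', hdb', hb'e⟩
  · exact (hne rfl).elim
  · rwa [hC.edgeStep_unique ⟨a, ha, hd, hb⟩ hdb']

lemma eq_of_neg_of_descends (hC : C.IsDFC) (ha : a ∈ C.Lam) (hd : C.Neg d a)
    (hd' : C.Neg d' a) (h : C.Descends t d) (h' : C.Descends t d') : d = d' := by
  wlog hdd : C.Descends d d' generalizing d d'
  · exact (this hd' hd h' h ((hC.descends_total h h').resolve_left hdd)).symm
  by_contra hne
  obtain ⟨b, hb⟩ := hC.exists_pos_of_mem_lam ha hd.face.dim_nonneg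
  have hbd' := hC.descends_of_neg_of_pos_of_ne ha hd hb hdd hne
  exact hC.edgeStep_acyclic b (.tail' hbd' ⟨a, ha, hd', hb⟩)

lemma exists_meet (hC : C.IsDFC) (hdim : C.dim t = C.dim t') (h : ¬ C.Descends t t')
    (h' : ¬ C.Descends t' t) :
    ∃ a ∈ C.Lam, ∃ d d', d ≠ d' ∧ C.Neg d a ∧ C.Neg d' a ∧ C.Descends t d ∧ C.Descends t' d' := by
  obtain ⟨g, hg, htg⟩ := hC.exists_descends_isIteratedTarget t
  obtain ⟨g', hg', htg'⟩ := hC.exists_descends_isIteratedTarget t'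
  obtain rfl := hC.isIteratedTarget_unique hg hg'
    (by rw [← Descends.dim_eq htg, hdim, Descends.dim_eq htg'])
  clear hdim
  induction htg using ReflTransGen.head_induction_on with
  | refl => exact (h' htg').elim
  | @head t s hts _ ih =>
    by_cases ht's : C.Descends t' s
    · rcases ReflTransGen.cases_tail ht's with rfl | ⟨d', ht'd', hd's⟩
      · exact (h (.single hts)).elim
      · obtain ⟨a, ha, hta, hsa⟩ := hts
        obtain ⟨a', ha', hd'a', hsa'⟩ := hd's
        obtain rfl := hC.eq_of_pos_of_pos ha ha' hsa hsa'
        exact ⟨a, ha, t, d', fun htd' => h' (htd' ▸ ht'd'), hta, hd'a', .refl, ht'd'⟩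
    · obtain ⟨a, ha, d, d', hne, hda, hd'a, hsd, ht'd'⟩ := ih (fun hst' => h (.head hts hst')) ht's
      exact ⟨a, ha, d, d', hne, hda, hd'a, .head hts hsd, ht'd'⟩

end IsDFC

end MOP

/-! ### Descending paths over a cell -/

namespace MOP

variable {C : MOP.{u}} {a a' b b' c d d' d'' e e' f t t' t'' w w' : C.Cell}

open FacetPoset Relation

namespace IsDFC

lemma loop_of_descends (hC : C.IsDFC) (h : C.Descends t d) (hd : C.Loop c d) : C.Loop c t := by
  induction h using ReflTransGen.head_induction_on with
  | refl => exact hd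
  | head hstep _ ih =>
    obtain ⟨a, -, hta, hsa⟩ := hstep
    exact hC.loop_of_loop_pos ih hsa hta

lemma exists_lam_descends (hC : C.IsDFC) {p : C.Cell → Prop}
    (hp : ∀ {y x}, p y → C.Pos y x → ∃ y', p y' ∧ C.Neg y' x) (hd : p d) :
    ∃ l ∈ C.Lam, C.Descends l d ∧ ∀ f, C.Descends l f → C.Descends f d → p f := by
  induction d using hC.wellFounded_edgeStep.induction with
  | _ d ih =>
  rcases hC.lam_or_pos d with hdΛ | ⟨a, ha, hda⟩
  · exact ⟨d, hdΛ, .refl, fun f hdf hfd => hC.descends_antisymm hdf hfd ▸ hd⟩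
  · obtain ⟨y, hy, hya⟩ := hp hd hda
    have hyd : C.EdgeStep y d := ⟨a, ha, hya, hda⟩
    obtain ⟨l, hl, hly, hpl⟩ := ih y hyd hy
    refine ⟨l, hl, hly.tail hyd, fun f hlf hfd => ?_⟩
    by_cases hfy : C.Descends f y
    · exact hpl f hlf hfy
    · have hyf := (hC.descends_total hly hlf).resolve_right hfy
      have hne : y ≠ f := fun h => hfy (h ▸ .refl)
      rwa [← hC.descends_antisymm (hC.descends_of_neg_of_pos_of_ne ha hya hda hyf hne) hfd]

lemma descends_and_neg_of_lam (hC : C.IsDFC) (ht : t ∈ C.Lam) (htc : C.Neg c t)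
    (hd : C.Neg c d) :
    C.Descends t d ∧ ∀ f, C.Descends t f → C.Descends f d → C.Neg c f := by
  obtain ⟨l, hl, hld, hlc⟩ := hC.exists_lam_descends hC.exists_neg_neg_of_neg_pos hd
  obtain rfl := hC.eq_of_neg_of_neg hl ht (hlc l .refl hld) htc
  exact ⟨hld, hlc⟩

lemma descends_and_pos_of_lam (hC : C.IsDFC) (ht : t ∈ C.Lam) (htc : C.Pos c t)
    (hd : C.Pos c d) :
    C.Descends t d ∧ ∀ f, C.Descends t f → C.Descends f d → C.Pos c f := by
  obtain ⟨l, hl, hld, hlc⟩ := hC.exists_lam_descends hC.exists_pos_neg_of_pos_pos hd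
  obtain rfl := hC.eq_of_pos_of_pos hl ht (hlc l .refl hld) htc
  exact ⟨hld, hlc⟩

lemma exists_neg_neg_and_pos_neg_of_not_face (hC : C.IsDFC) (he : C.Neg e a) (hb : C.Pos b a)
    (hce : C.Face c e) (hcb : ¬ C.Face c b) :
    (∃ d, C.Neg c d ∧ C.Neg d a) ∧ ∃ d', C.Pos c d' ∧ C.Neg d' a := by
  have not_face_pos {y} (hy : C.Face c y) : ¬ C.Pos y a := fun hya => hcb (hya.unique hb ▸ hy)
  have of_neg {d} (hcd : C.Neg c d) (hda : C.Neg d a) :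
      (∃ d, C.Neg c d ∧ C.Neg d a) ∧ ∃ d', C.Pos c d' ∧ C.Neg d' a := by
    obtain ⟨d', hd' | ⟨hcd', hd'a⟩⟩ := hC.exists_pos_neg_or_neg_pos_of_neg_neg hcd hda
    exacts [⟨⟨d, hcd, hda⟩, d', hd'⟩, (not_face_pos hcd'.face hd'a).elim]
  have of_pos {d} (hcd : C.Pos c d) (hda : C.Neg d a) :
      (∃ d, C.Neg c d ∧ C.Neg d a) ∧ ∃ d', C.Pos c d' ∧ C.Neg d' a := by
    obtain ⟨d', hd' | ⟨hcd', hd'a⟩⟩ := hC.exists_neg_neg_or_pos_pos_of_pos_neg hcd hda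
    exacts [⟨⟨d', hd'⟩, d, hcd, hda⟩, (not_face_pos hcd'.face hd'a).elim]
  rcases hce.neg_or_pos_or_loop with hce | hce | hce
  · exact of_neg hce he
  · exact of_pos hce he
  · obtain ⟨d', ⟨hcd', hd'a⟩ | hd' | hd'⟩ := hC.exists_loop_pos_or_neg_neg_or_pos_neg hce he
    exacts [(not_face_pos hcd'.face hd'a).elim, of_neg hd'.1 hd'.2, of_pos hd'.1 hd'.2]

lemma exists_lam_neg_and_lam_pos_of_not_face (hC : C.IsDFC) (h : C.Descends e f)
    (he : C.Face c e) (hf : ¬ C.Face c f) :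
    (∃ l ∈ C.Lam, C.Neg c l ∧ C.Descends l f) ∧ ∃ l' ∈ C.Lam, C.Pos c l' ∧ C.Descends l' f := by
  induction h using ReflTransGen.head_induction_on with
  | refl => exact (hf he).elim
  | @head e s hstep hsf ih =>
    by_cases hcs : C.Face c s
    · exact ih hcs
    obtain ⟨a, ha, hea, hsa⟩ := hstep
    have descends_f {d} (hda : C.Neg d a) : C.Descends d f := .head ⟨a, ha, hda, hsa⟩ hsf
    obtain ⟨⟨d, hcd, hda⟩, d', hcd', hd'a⟩ :=
      hC.exists_neg_neg_and_pos_neg_of_not_face hea hsa he hcs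
    obtain ⟨l, hl, hld, hcl⟩ := hC.exists_lam_descends hC.exists_neg_neg_of_neg_pos hcd
    obtain ⟨l', hl', hl'd', hcl'⟩ := hC.exists_lam_descends hC.exists_pos_neg_of_pos_pos hcd'
    exact ⟨⟨l, hl, hcl l .refl hld, hld.trans (descends_f hda)⟩,
      l', hl', hcl' l' .refl hl'd', hl'd'.trans (descends_f hd'a)⟩

lemma face_of_descends (hC : C.IsDFC) (h : C.Descends e f) (h' : C.Descends f d)
    (he : C.Face c e) (hd : C.Face c d) : C.Face c f := by
  by_contra hf
  obtain ⟨⟨l, hl, hcl, hlf⟩, l', hl', hcl', hl'f⟩ :=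
    hC.exists_lam_neg_and_lam_pos_of_not_face h he hf
  rcases hd.neg_or_pos_or_loop with hd | hd | hd
  · exact hf ((hC.descends_and_neg_of_lam hl hcl hd).2 f hlf h').face
  · exact hf ((hC.descends_and_pos_of_lam hl' hcl' hd).2 f hl'f h').face
  · exact (hC.loop_of_descends (hlf.trans h') hd).not_neg hcl

lemma neg_of_descends (hC : C.IsDFC) (h : C.Descends e d) (he : C.Neg c e) (hd : C.Face c d) :
    C.Neg c d := by
  induction h using ReflTransGen.head_induction_on with
  | refl => exact he
  | head hstep hsd ih =>
    have hcs := hC.face_of_descends (.single hstep) hsd he.face hd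
    obtain ⟨a, -, hea, hsa⟩ := hstep
    rcases hcs.neg_or_pos_or_loop with hcs | hcs | hcs
    · exact ih hcs
    · exact (hC.not_neg_neg_of_pos_pos hcs hsa he hea).elim
    · exact ((hC.loop_of_loop_pos hcs hsa hea).not_neg he).elim

lemma pos_of_descends (hC : C.IsDFC) (h : C.Descends e d) (he : C.Pos c e) (hd : C.Face c d) :
    C.Pos c d := by
  induction h using ReflTransGen.head_induction_on with
  | refl => exact he
  | head hstep hsd ih =>
    have hcs := hC.face_of_descends (.single hstep) hsd he.face hd
    obtain ⟨a, -, hea, hsa⟩ := hstep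
    rcases hcs.neg_or_pos_or_loop with hcs | hcs | hcs
    · exact (hC.not_pos_neg_of_neg_pos hcs hsa he hea).elim
    · exact ih hcs
    · exact ((hC.loop_of_loop_pos hcs hsa hea).not_pos he).elim

lemma loop_or_exists_descends (hC : C.IsDFC) (h : C.Descends e d) (he : C.Loop c e) :
    C.Loop c d ∨ ∃ f, (C.Neg c f ∨ C.Pos c f) ∧ C.Descends f d := by
  induction h using ReflTransGen.head_induction_on with
  | refl => exact .inl he
  | head hstep hsd ih =>
    obtain ⟨a, ha, hea, hsa⟩ := hstep
    obtain ⟨y, ⟨hcy, hya⟩ | ⟨hcy, hya⟩ | ⟨hcy, hya⟩⟩ :=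
      hC.exists_loop_pos_or_neg_neg_or_pos_neg he hea
    · exact ih (hya.unique hsa ▸ hcy)
    · exact .inr ⟨y, .inl hcy, .head ⟨a, ha, hya, hsa⟩ hsd⟩
    · exact .inr ⟨y, .inr hcy, .head ⟨a, ha, hya, hsa⟩ hsd⟩

lemma face_of_meet (hC : C.IsDFC) (ha : a ∈ C.Lam) (hd : C.Neg d a) (hd' : C.Neg d' a)
    (hne : d ≠ d') (h : C.Descends e d) (h' : C.Descends e' d') (he : C.Face c e)
    (he' : C.Face c e') : C.Face c d := by
  by_contra hcd
  obtain ⟨⟨l, hl, hcl, hld⟩, l', hl', hcl', hl'd⟩ :=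
    hC.exists_lam_neg_and_lam_pos_of_not_face h he hcd
  have eq_of_neg {f k} (hf : C.Neg c f) (hk : C.Neg k a) (hfk : C.Descends f k) : k = d :=
    hC.eq_of_neg_of_descends ha hk hd ((hC.descends_and_neg_of_lam hl hcl hf).1.trans hfk) hld
  have eq_of_pos {f k} (hf : C.Pos c f) (hk : C.Neg k a) (hfk : C.Descends f k) : k = d :=
    hC.eq_of_neg_of_descends ha hk hd ((hC.descends_and_pos_of_lam hl' hcl' hf).1.trans hfk) hl'd
  rcases he'.neg_or_pos_or_loop with he' | he' | he'
  · exact hne (eq_of_neg he' hd' h').symm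
  · exact hne (eq_of_pos he' hd' h').symm
  obtain hcd' | ⟨f, hf | hf, hfd'⟩ := hC.loop_or_exists_descends h' he'
  · obtain ⟨y, ⟨hcy, hya⟩ | ⟨hcy, hya⟩ | ⟨hcy, hya⟩⟩ :=
      hC.exists_loop_pos_or_neg_neg_or_pos_neg hcd' hd'
    · exact hcd (hC.loop_of_loop_pos hcy hya hd).face
    · exact hcd (eq_of_neg hcy hya .refl ▸ hcy.face)
    · exact hcd (eq_of_pos hcy hya .refl ▸ hcy.face)
  · exact hne (eq_of_neg hf hd' hfd').symm
  · exact hne (eq_of_pos hf hd' hfd').symm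

end IsDFC

/-! ### The planar order over a cell -/

lemma LocalLT.trans (h : C.LocalLT a d d') (h' : C.LocalLT a d' d'') : C.LocalLT a d d'' := by
  obtain ⟨ha, z, hd, hd'⟩ := C.localLT_supp a d d' h
  obtain ⟨-, z', hd₁', hd''⟩ := C.localLT_supp a d' d'' h'
  obtain rfl := eq_of_mem_γ hd'.1.2 hd₁'.1.2
  have := C.localLT_total a ha z
  exact _root_.trans (r := fun y y' : {y // C.Loop z y ∧ C.Neg y a} => C.LocalLT a y y')
    (a := ⟨d, hd⟩) (b := ⟨d', hd'⟩) (c := ⟨d'', hd''⟩) h h'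

lemma LocalLT.irrefl : ¬ C.LocalLT a d d := by
  intro h
  obtain ⟨ha, z, hd, -⟩ := C.localLT_supp a d d h
  have := C.localLT_total a ha z
  exact _root_.irrefl (r := fun y y' : {y // C.Loop z y ∧ C.Neg y a} => C.LocalLT a y y')
    ⟨d, hd⟩ h

lemma localLT_or_localLT (ha : a ∈ C.Lam) (hd : C.Loop c d) (hda : C.Neg d a)
    (hd' : C.Loop c d') (hda' : C.Neg d' a) (hne : d ≠ d') :
    C.LocalLT a d d' ∨ C.LocalLT a d' d := by
  have := C.localLT_total a ha c
  by_contra! h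
  exact hne (congrArg Subtype.val
    (this.toTrichotomous.trichotomous ⟨d, hd, hda⟩ ⟨d', hd', hda'⟩ h.1 h.2))

lemma LocalLT.not_pos_left (h : C.LocalLT a d d') : ¬ C.Pos c d :=
  have ⟨_, _, hd, _⟩ := C.localLT_supp a d d' h
  hd.1.not_pos

lemma LocalLT.not_neg_right (h : C.LocalLT a d d') : ¬ C.Neg c d' :=
  have ⟨_, _, _, hd'⟩ := C.localLT_supp a d d' h
  hd'.1.not_neg

/-- The order of the sources of `a` with face `c`: first the one with source `c`, then the loops
on `c` in the local order, then the one with target `c`. -/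
structure SourceLT (C : MOP.{u}) (c a d d' : C.Cell) : Prop where
  neg_left : C.Neg d a
  neg_right : C.Neg d' a
  face_left : C.Face c d
  face_right : C.Face c d'
  ne : d ≠ d'
  neg_or_pos_or_localLT : C.Neg c d ∨ C.Pos c d' ∨ C.LocalLT a d d'

/-- The planar order over `c`: the descending paths from `t` and `t'` meet at a node, and the one
from `t` arrives first for the order of the sources of this node. -/
def Planar (C : MOP.{u}) (c t t' : C.Cell) : Prop :=
  ∃ a ∈ C.Lam, ∃ d d', C.SourceLT c a d d' ∧ C.Descends t d ∧ C.Descends t' d'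

namespace SourceLT

lemma not_pos_left (hC : C.IsDFC) (h : C.SourceLT c a d d') : ¬ C.Pos c d := by
  intro hd
  rcases h.neg_or_pos_or_localLT with h' | h' | h'
  exacts [hd.not_neg h', h.ne (hC.pos_neg_unique hd h.neg_left h' h.neg_right),
    h'.not_pos_left hd]

lemma not_neg_right (hC : C.IsDFC) (h : C.SourceLT c a d d') : ¬ C.Neg c d' := by
  intro hd'
  rcases h.neg_or_pos_or_localLT with h' | h' | h'
  exacts [h.ne (hC.neg_neg_unique h' h.neg_left hd' h.neg_right), h'.not_neg hd',
    h'.not_neg_right hd']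

lemma asymm (hC : C.IsDFC) (h : C.SourceLT c a d d') : ¬ C.SourceLT c a d' d := by
  intro h'
  rcases h.neg_or_pos_or_localLT with hlt | hlt | hlt
  · exact h'.not_neg_right hC hlt
  · exact h'.not_pos_left hC hlt
  · rcases h'.neg_or_pos_or_localLT with hlt' | hlt' | hlt'
    exacts [h.not_neg_right hC hlt', h.not_pos_left hC hlt', (hlt.trans hlt').irrefl]

lemma trans (hC : C.IsDFC) (h : C.SourceLT c a d d') (h' : C.SourceLT c a d' d'') :
    C.SourceLT c a d d'' where
  neg_left := h.neg_left
  neg_right := h'.neg_right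
  face_left := h.face_left
  face_right := h'.face_right
  ne := by
    rintro rfl
    exact h.asymm hC h'
  neg_or_pos_or_localLT := by
    rcases h.neg_or_pos_or_localLT with hlt | hlt | hlt
    · exact .inl hlt
    · exact (h'.not_pos_left hC hlt).elim
    · rcases h'.neg_or_pos_or_localLT with hlt' | hlt' | hlt'
      exacts [(h.not_neg_right hC hlt').elim, .inr (.inl hlt'), .inr (.inr (hlt.trans hlt'))]

end SourceLT

lemma sourceLT_or_sourceLT (ha : a ∈ C.Lam) (hd : C.Neg d a) (hd' : C.Neg d' a) (hne : d ≠ d')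
    (hc : C.Face c d) (hc' : C.Face c d') : C.SourceLT c a d d' ∨ C.SourceLT c a d' d := by
  suffices (C.Neg c d ∨ C.Pos c d' ∨ C.LocalLT a d d') ∨
      (C.Neg c d' ∨ C.Pos c d ∨ C.LocalLT a d' d) from
    this.imp (⟨hd, hd', hc, hc', hne, ·⟩) (⟨hd', hd, hc', hc, hne.symm, ·⟩)
  rcases hc.neg_or_pos_or_loop with h | h | h
  · exact .inl (.inl h)
  · exact .inr (.inr (.inl h))
  rcases hc'.neg_or_pos_or_loop with h' | h' | h'
  · exact .inr (.inl h')
  · exact .inl (.inr (.inl h'))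
  · exact (localLT_or_localLT ha h hd h' hd' hne).imp (.inr ∘ .inr) (.inr ∘ .inr)

/-- The tips: the leaves, and the targets of the nodes without sources. -/
def IsTip (C : MOP.{u}) (b : C.Cell) : Prop := b ∈ C.Lam ∨ ∃ a ∈ C.Lam ∩ C.Null, C.Pos b a

lemma not_neg_of_mem_null (ha : a ∈ C.Null) : ¬ C.Neg b a :=
  fun h => (ha : C.δ a = ∅).subset h.1

namespace IsDFC

lemma planar_irrefl (hC : C.IsDFC) : ¬ C.Planar c t t := by
  rintro ⟨a, ha, d, d', h, htd, htd'⟩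
  exact h.ne (hC.eq_of_neg_of_descends ha h.neg_left h.neg_right htd htd')

lemma descends_of_neg_of_neg_of_ne (hC : C.IsDFC) (ha : a ∈ C.Lam) (hd : C.Neg d a)
    (hd' : C.Neg d' a) (h : C.Descends d e) (hne : d ≠ e) : C.Descends d' e := by
  obtain ⟨b, hb⟩ := hC.exists_pos_of_mem_lam ha hd.face.dim_nonneg
  exact .head ⟨a, ha, hd', hb⟩ (hC.descends_of_neg_of_pos_of_ne ha hd hb h hne)

lemma planar_trans (hC : C.IsDFC) (h : C.Planar c t t') (h' : C.Planar c t' t'') :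
    C.Planar c t t'' := by
  obtain ⟨a, ha, d, d', hdd', htd, ht'd'⟩ := h
  obtain ⟨a', ha', e, e', hee', ht'e, ht''e'⟩ := h'
  rcases eq_or_ne d' e with rfl | hne
  · obtain rfl := hC.eq_of_neg_of_neg ha ha' hdd'.neg_right hee'.neg_left
    exact ⟨a, ha, d, e', hdd'.trans hC hee', htd, ht''e'⟩
  rcases hC.descends_total ht'd' ht'e with hd'e | hed'
  · exact ⟨a', ha', e, e', hee', htd.trans (hC.descends_of_neg_of_neg_of_ne ha hdd'.neg_right
      hdd'.neg_left hd'e hne), ht''e'⟩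
  · exact ⟨a, ha, d, d', hdd', htd, ht''e'.trans (hC.descends_of_neg_of_neg_of_ne ha'
      hee'.neg_left hee'.neg_right hed' hne.symm)⟩

lemma planar_asymm (hC : C.IsDFC) (h : C.Planar c t t') : ¬ C.Planar c t' t :=
  fun h' => hC.planar_irrefl (hC.planar_trans h h')

lemma descends_of_planar (hC : C.IsDFC) (h : C.Planar c t t') (h' : C.Planar c t' t'')
    (ht : C.Descends t b) (ht'' : C.Descends t'' b) : C.Descends t' b := by
  obtain ⟨a, ha, d, d', hdd', htd, ht'd'⟩ := h
  obtain ⟨a', ha', e, e', hee', ht'e, ht''e'⟩ := h'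
  by_contra ht'b
  have hbd : C.Descends b d := by
    by_contra hbd
    have hne : d ≠ b := fun h => hbd (h ▸ .refl)
    exact ht'b (ht'd'.trans (hC.descends_of_neg_of_neg_of_ne ha hdd'.neg_left hdd'.neg_right
      ((hC.descends_total htd ht).resolve_right hbd) hne))
  have hbe' : C.Descends b e' := by
    by_contra hbe'
    have hne : e' ≠ b := fun h => hbe' (h ▸ .refl)
    exact ht'b (ht'e.trans (hC.descends_of_neg_of_neg_of_ne ha' hee'.neg_right hee'.neg_left
      ((hC.descends_total ht''e' ht'').resolve_right hbe') hne))
  rcases eq_or_ne d e' with rfl | hne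
  · obtain rfl := hC.eq_of_neg_of_neg ha ha' hdd'.neg_left hee'.neg_right
    obtain rfl := hC.eq_of_neg_of_descends ha hdd'.neg_right hee'.neg_left ht'd' ht'e
    exact hdd'.asymm hC hee'
  rcases hC.descends_total hbd hbe' with hde' | he'd
  · exact hee'.ne (hC.eq_of_neg_of_descends ha' hee'.neg_left hee'.neg_right ht'e (ht'd'.trans
      (hC.descends_of_neg_of_neg_of_ne ha hdd'.neg_left hdd'.neg_right hde' hne)))
  · exact hdd'.ne (hC.eq_of_neg_of_descends ha hdd'.neg_left hdd'.neg_right (ht'e.trans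
      (hC.descends_of_neg_of_neg_of_ne ha' hee'.neg_right hee'.neg_left he'd hne.symm)) ht'd')

lemma eq_of_descends_of_isTip (hC : C.IsDFC) (h : C.Descends t b) (hb : C.IsTip b) : t = b := by
  rcases ReflTransGen.cases_tail h with rfl | ⟨s, -, a, ha, hsa, hba⟩
  · rfl
  rcases hb with hb | ⟨a', ha', hba'⟩
  · exact (hb _ hba).elim
  · obtain rfl := hC.eq_of_pos_of_pos ha ha'.1 hba hba'
    exact (not_neg_of_mem_null ha'.2 hsa).elim

lemma planar_total (hC : C.IsDFC) (ht : C.IsTip t) (ht' : C.IsTip t') (hc : C.Face c t)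
    (hc' : C.Face c t') (hne : t ≠ t') : C.Planar c t t' ∨ C.Planar c t' t := by
  obtain ⟨a, ha, d, d', hdd', hd, hd', htd, ht'd'⟩ :=
    hC.exists_meet (hc.dim_eq_dim_coface hc') (fun h => hne (hC.eq_of_descends_of_isTip h ht'))
      (fun h => hne (hC.eq_of_descends_of_isTip h ht).symm)
  exact (sourceLT_or_sourceLT ha hd hd' hdd' (hC.face_of_meet ha hd hd' hdd' htd ht'd' hc hc')
    (hC.face_of_meet ha hd' hd hdd'.symm ht'd' htd hc' hc)).imp
    (fun h => ⟨a, ha, d, d', h, htd, ht'd'⟩) (fun h => ⟨a, ha, d', d, h, ht'd', htd⟩)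

lemma planar_of_neg (hC : C.IsDFC) (ht : C.IsTip t) (ht' : C.IsTip t') (hc : C.Neg c t)
    (hc' : C.Face c t') (hne : t ≠ t') : C.Planar c t t' := by
  refine (hC.planar_total ht ht' hc.face hc' hne).resolve_right ?_
  rintro ⟨a, -, d, d', h, -, htd'⟩
  exact h.not_neg_right hC (hC.neg_of_descends htd' hc h.face_right)

lemma planar_of_pos (hC : C.IsDFC) (ht : C.IsTip t) (ht' : C.IsTip t') (hc : C.Face c t)
    (hc' : C.Pos c t') (hne : t ≠ t') : C.Planar c t t' := by
  refine (hC.planar_total ht ht' hc hc'.face hne).resolve_right ?_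
  rintro ⟨a, -, d, d', h, ht'd, -⟩
  exact h.not_pos_left hC (hC.pos_of_descends ht'd hc' h.face_left)

lemma neg_of_planar (hC : C.IsDFC) (ht : t ∈ C.Lam) (ht' : C.IsTip t') (hc : C.Face c t)
    (hc' : C.Face c t') (h : C.Planar c t t') : C.Neg c t := by
  refine hc.neg_or_pos_or_loop.resolve_right ?_
  rintro (hpos | hloop)
  · refine hC.planar_asymm h (hC.planar_of_pos ht' (.inl ht) hc' hpos ?_)
    rintro rfl
    exact hC.planar_irrefl h
  · exact hC.not_loop_of_mem_lam ht hloop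

lemma pos_of_planar (hC : C.IsDFC) (ht : C.IsTip t) (ht' : t' ∈ C.Lam) (hc : C.Face c t)
    (hc' : C.Face c t') (h : C.Planar c t t') : C.Pos c t' := by
  rcases hc'.neg_or_pos_or_loop with hneg | hpos | hloop
  · refine (hC.planar_asymm h (hC.planar_of_neg (.inl ht') ht hneg hc ?_)).elim
    rintro rfl
    exact hC.planar_irrefl h
  · exact hpos
  · exact (hC.not_loop_of_mem_lam ht' hloop).elim

end IsDFC

/-! ### The loops total order is the planar order -/

lemma LoopInclEq.descends (h : C.LoopInclEq b d) : C.Descends b d :=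
  ReflTransGen.mono (fun _ _ ⟨_, a, ha, hb, hb'⟩ => ⟨a, ha, hb'.2, hb.2⟩) _ _ h

lemma IsDFC.loopInclEq_of_descends (hC : C.IsDFC) (h : C.Descends b d) (hd : C.Loop c d) :
    C.LoopInclEq b d := by
  induction h using ReflTransGen.head_induction_on with
  | refl => exact .refl
  | head hstep hsd ih =>
    have hs := hC.loop_of_descends hsd hd
    have hb := hC.loop_of_descends (.head hstep hsd) hd
    obtain ⟨a, ha, hba, hsa⟩ := hstep
    exact .head ⟨c, a, ha, ⟨hs, hsa⟩, hb, hba⟩ ih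

/-- The shapes of a path in the zig-zag over `c`: it stays in its left part, or in its right part,
or it turns at `a₁`. -/
inductive ZigShape (C : MOP.{u}) (c a a' : C.Cell) : Prop
  | left {b d : C.Cell} (hba : C.Pos b a) (hbd : C.Descends b d) (hcd : C.Neg c d)
    (hda' : C.Neg d a')
  | right {b' d' : C.Cell} (hb'a' : C.Pos b' a') (hcb' : C.Pos c b') (hb'd' : C.Descends b' d')
    (hcd' : C.Pos c d') (hd'a : C.Neg d' a)
  | turn {a₁ b b' d d' : C.Cell} (ha₁ : a₁ ∈ C.Lam) (hba : C.Pos b a) (hbd : C.Descends b d)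
    (hcd : C.Neg c d) (hda₁ : C.Neg d a₁) (hb'a' : C.Pos b' a') (hcb' : C.Pos c b')
    (hb'd' : C.Descends b' d') (hcd' : C.Pos c d') (hd'a₁ : C.Neg d' a₁)

lemma ZigShape.of_transGen_zigStep (h : TransGen (C.ZigStep c) a a') : C.ZigShape c a a' := by
  induction h with
  | single h =>
    obtain ⟨-, -, b, ⟨hcb, hba, hba'⟩ | ⟨hcb, hba, hba'⟩⟩ := h
    · exact .left hba .refl hcb hba'
    · exact .right hba' hcb .refl hcb hba
  | tail _ h ih =>
    obtain ⟨ha', -, e, ⟨hce, hea', hea''⟩ | ⟨hce, hea', hea''⟩⟩ := h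
    · rcases ih with ⟨hba, hbd, _, hda'⟩ | ⟨hb'a', hcb'⟩ | ⟨-, -, -, -, -, hb'a', hcb'⟩
      · exact .left hba (hbd.tail ⟨_, ha', hda', hea'⟩) hce hea''
      all_goals exact (hcb'.not_neg (hea'.unique hb'a' ▸ hce)).elim
    · rcases ih with ⟨hba, hbd, hcd, hda'⟩ | ⟨hb'a', _, hb'd', hcd', hd'a⟩ |
        ⟨ha₁, hba, hbd, hcd, hda₁, hb'a', _, hb'd', hcd', hd'a₁⟩
      · exact .turn ha' hba hbd hcd hda' hea'' hce .refl hce hea'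
      · exact .right hea'' hce (.head ⟨_, ha', hea', hb'a'⟩ hb'd') hcd' hd'a
      · exact .turn ha₁ hba hbd hcd hda₁ hea'' hce (.head ⟨_, ha', hea', hb'a'⟩ hb'd') hcd' hd'a₁

lemma mem_lam_of_transGen_zigStep (h : TransGen (C.ZigStep c) a a') :
    a ∈ C.Lam ∧ a' ∈ C.Lam := by
  obtain ⟨_, hfirst, _⟩ := TransGen.head'_iff.1 h
  obtain ⟨_, _, hlast⟩ := TransGen.tail'_iff.1 h
  exact ⟨hfirst.1, hlast.2.1⟩

lemma planar_of_loopLT₁ (h : C.LoopLT₁ c b b') : C.Planar c b b' := by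
  obtain ⟨a, a', d, d', hzig, ⟨hcd, hda⟩, ⟨hcd', hd'a'⟩, hbd, hb'd'⟩ := h
  replace hbd := hbd.descends
  replace hb'd' := hb'd'.descends
  obtain ⟨ha, ha'⟩ := mem_lam_of_transGen_zigStep hzig
  rcases ZigShape.of_transGen_zigStep hzig with ⟨hsa, hsf, hcf, hfa'⟩ |
    ⟨hs'a', -, hs'f', hcf', hf'a⟩ | ⟨ha₁, hsa, hsf, hcf, hfa₁, hs'a', -, hs'f', hcf', hf'a₁⟩
  · refine ⟨a', ha', _, d', ⟨hfa', hd'a', hcf.face, hcd'.face, ?_, .inl hcf⟩,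
      hbd.trans (.head ⟨a, ha, hda, hsa⟩ hsf), hb'd'⟩
    rintro rfl
    exact hcd'.not_neg hcf
  · refine ⟨a, ha, d, _, ⟨hda, hf'a, hcd.face, hcf'.face, ?_, .inr (.inl hcf')⟩, hbd,
      hb'd'.trans (.head ⟨a', ha', hd'a', hs'a'⟩ hs'f')⟩
    rintro rfl
    exact hcd.not_pos hcf'
  · refine ⟨_, ha₁, _, _, ⟨hfa₁, hf'a₁, hcf.face, hcf'.face, ?_, .inl hcf⟩,
      hbd.trans (.head ⟨a, ha, hda, hsa⟩ hsf), hb'd'.trans (.head ⟨a', ha', hd'a', hs'a'⟩ hs'f')⟩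
    rintro rfl
    exact hcf'.not_neg hcf

lemma planar_of_loopLT (h : C.LoopLT c b b') : C.Planar c b b' := by
  obtain ⟨-, -, h | ⟨-, -, -, -, -, a, ha, d, d', hne, hd, hd', hbd, hb'd', hlt⟩⟩ := h
  · exact planar_of_loopLT₁ h
  · exact ⟨a, ha, d, d', ⟨hd.2, hd'.2, hd.1.face, hd'.1.face, hne, .inr (.inr hlt)⟩,
      hbd.descends, hb'd'.descends⟩

namespace IsDFC

lemma exists_transGen_zigStep_of_neg (hC : C.IsDFC) (hb : C.Loop c b) (h : C.Descends b d)
    (hd : C.Neg c d) (ha : a ∈ C.Lam) (hda : C.Neg d a) :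
    ∃ a₁ e, (C.Loop c e ∧ C.Neg e a₁) ∧ C.LoopInclEq b e ∧ TransGen (C.ZigStep c) a₁ a := by
  induction h generalizing a with
  | refl => exact (hb.not_neg hd).elim
  | @tail e d h hstep ih =>
    have he := hC.face_of_descends h (.single hstep) hb.face hd.face
    obtain ⟨a₁, ha₁, hea₁, hda₁⟩ := hstep
    have hzig : C.ZigStep c a₁ a := ⟨ha₁, ha, d, .inl ⟨hd, hda₁, hda⟩⟩
    rcases he.neg_or_pos_or_loop with he | he | he
    · obtain ⟨a₂, k, hk, hbk, hpath⟩ := ih he ha₁ hea₁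
      exact ⟨a₂, k, hk, hbk, hpath.tail hzig⟩
    · exact (hC.not_pos_neg_of_neg_pos hd hda₁ he hea₁).elim
    · exact ⟨a₁, e, ⟨he, hea₁⟩, hC.loopInclEq_of_descends h he, .single hzig⟩

lemma exists_transGen_zigStep_of_pos (hC : C.IsDFC) (hb : C.Loop c b) (h : C.Descends b d)
    (hd : C.Pos c d) (ha : a ∈ C.Lam) (hda : C.Neg d a) :
    ∃ a₁ e, (C.Loop c e ∧ C.Neg e a₁) ∧ C.LoopInclEq b e ∧ TransGen (C.ZigStep c) a a₁ := by
  induction h generalizing a with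
  | refl => exact (hb.not_pos hd).elim
  | @tail e d h hstep ih =>
    have he := hC.face_of_descends h (.single hstep) hb.face hd.face
    obtain ⟨a₁, ha₁, hea₁, hda₁⟩ := hstep
    have hzig : C.ZigStep c a a₁ := ⟨ha, ha₁, d, .inr ⟨hd, hda, hda₁⟩⟩
    rcases he.neg_or_pos_or_loop with he | he | he
    · exact (hC.not_neg_neg_of_pos_pos hd hda₁ he hea₁).elim
    · obtain ⟨a₂, k, hk, hbk, hpath⟩ := ih he ha₁ hea₁
      exact ⟨a₂, k, hk, hbk, .head hzig hpath⟩
    · exact ⟨a₁, e, ⟨he, hea₁⟩, hC.loopInclEq_of_descends h he, .single hzig⟩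

lemma exists_reflTransGen_zigStep_of_not_pos (hC : C.IsDFC) (hb : C.Loop c b)
    (h : C.Descends b d) (hcd : C.Face c d) (hd : ¬ C.Pos c d) (ha : a ∈ C.Lam)
    (hda : C.Neg d a) :
    ∃ a₁ e, (C.Loop c e ∧ C.Neg e a₁) ∧ C.LoopInclEq b e ∧ ReflTransGen (C.ZigStep c) a₁ a := by
  rcases hcd.neg_or_pos_or_loop with hcd | hcd | hcd
  · obtain ⟨a₁, e, he, hbe, hpath⟩ := hC.exists_transGen_zigStep_of_neg hb h hcd ha hda
    exact ⟨a₁, e, he, hbe, hpath.to_reflTransGen⟩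
  · exact (hd hcd).elim
  · exact ⟨a, d, ⟨hcd, hda⟩, hC.loopInclEq_of_descends h hcd, .refl⟩

lemma exists_reflTransGen_zigStep_of_not_neg (hC : C.IsDFC) (hb : C.Loop c b)
    (h : C.Descends b d) (hcd : C.Face c d) (hd : ¬ C.Neg c d) (ha : a ∈ C.Lam)
    (hda : C.Neg d a) :
    ∃ a₁ e, (C.Loop c e ∧ C.Neg e a₁) ∧ C.LoopInclEq b e ∧ ReflTransGen (C.ZigStep c) a a₁ := by
  rcases hcd.neg_or_pos_or_loop with hcd | hcd | hcd
  · exact (hd hcd).elim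
  · obtain ⟨a₁, e, he, hbe, hpath⟩ := hC.exists_transGen_zigStep_of_pos hb h hcd ha hda
    exact ⟨a₁, e, he, hbe, hpath.to_reflTransGen⟩
  · exact ⟨a, d, ⟨hcd, hda⟩, hC.loopInclEq_of_descends h hcd, .refl⟩

lemma loopLT_of_planar (hC : C.IsDFC) (hb : b ∈ C.MinLoops c) (hb' : b' ∈ C.MinLoops c)
    (hpl : C.Planar c b b') : C.LoopLT c b b' := by
  refine ⟨hb, hb', ?_⟩
  by_cases hlt₁ : C.LoopLT₁ c b b'
  · exact .inl hlt₁
  obtain ⟨a, ha, d, d', hdd', hbd, hb'd'⟩ := id hpl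
  have left_of_not_pos := hC.exists_reflTransGen_zigStep_of_not_pos hb.1 hbd hdd'.face_left
    (hdd'.not_pos_left hC) ha hdd'.neg_left
  have right_of_not_neg := hC.exists_reflTransGen_zigStep_of_not_neg hb'.1 hb'd' hdd'.face_right
    (hdd'.not_neg_right hC) ha hdd'.neg_right
  rcases hdd'.neg_or_pos_or_localLT with hd | hd' | hlt
  · obtain ⟨a₁, e, he, hbe, hpath⟩ :=
      hC.exists_transGen_zigStep_of_neg hb.1 hbd hd ha hdd'.neg_left
    obtain ⟨a₂, e', he', hbe', hpath'⟩ := right_of_not_neg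
    exact .inl ⟨a₁, a₂, e, e', hpath.trans_left hpath', he, he', hbe, hbe'⟩
  · obtain ⟨a₁, e, he, hbe, hpath⟩ := left_of_not_pos
    obtain ⟨a₂, e', he', hbe', hpath'⟩ :=
      hC.exists_transGen_zigStep_of_pos hb'.1 hb'd' hd' ha hdd'.neg_right
    exact .inl ⟨a₁, a₂, e, e', .trans_right hpath hpath', he, he', hbe, hbe'⟩
  · obtain ⟨-, z, hd, hd'⟩ := C.localLT_supp _ _ _ hlt
    obtain rfl := hd.1.eq_of_face hdd'.face_left
    exact .inr ⟨hb, hb', fun h => hC.planar_irrefl (h ▸ hpl), hlt₁,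
      fun h => hC.planar_asymm hpl (planar_of_loopLT₁ h), a, ha, d, d', hdd'.ne, hd, hd',
      hC.loopInclEq_of_descends hbd hd.1, hC.loopInclEq_of_descends hb'd' hd'.1, hlt⟩

end IsDFC

end MOP

namespace MOP

variable {C : MOP.{u}} {a b b' c c₀ d d' d₀ s s' t t' w w' z : C.Cell}

open FacetPoset Relation

namespace IsDFC

lemma mem_white_iff (hC : C.IsDFC) :
    w ∈ C.White c ↔ w ∈ C.Lam ∩ C.Null ∧ ∃ b, C.Pos b w ∧ C.Loop c b := by
  constructor
  · rintro ⟨hw, b, hb, hc⟩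
    have hb := (pos_or_loop_of_mem_γ hb).resolve_right (hC.not_loop_of_mem_lam hw.1)
    refine ⟨hw, b, hb, (pos_or_loop_of_mem_γ hc).resolve_left fun hc => ?_⟩
    obtain ⟨y, -, hy⟩ := hC.exists_pos_neg_of_pos_pos hc hb
    exact not_neg_of_mem_null hw.2 hy
  · rintro ⟨hw, b, hb, hc⟩
    exact ⟨hw, b, hb.1, hc.2⟩

lemma whiteLT_iff (hC : C.IsDFC) (hw : w ∈ C.Lam ∩ C.Null) (hw' : w' ∈ C.Lam ∩ C.Null)
    (hb : C.Pos b w) (hc : C.Loop c b) (hb' : C.Pos b' w') (hc' : C.Loop c b') :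
    C.WhiteLT c w w' ↔ C.Planar c b b' := by
  constructor
  · rintro ⟨e, he, e', he', h⟩
    obtain rfl := eq_of_mem_γ he hb.1
    obtain rfl := eq_of_mem_γ he' hb'.1
    exact planar_of_loopLT h
  · exact fun h => ⟨b, hb.1, b', hb'.1, hC.loopLT_of_planar ⟨hc, w, hw, hb⟩ ⟨hc', w', hw', hb'⟩ h⟩

lemma isStrictTotalOrder_whiteLT (hC : C.IsDFC) (c : C.Cell) :
    IsStrictTotalOrder (C.White c) fun w w' => C.WhiteLT c w w' := by
  choose hw b hbw hcb using fun w : C.White c => hC.mem_white_iff.1 w.2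
  have hiff (w w' : C.White c) : C.WhiteLT c w w' ↔ C.Planar c (b w) (b w') :=
    hC.whiteLT_iff (hw w) (hw w') (hbw w) (hcb w) (hbw w') (hcb w')
  simp only [hiff]
  exact
    { trichotomous := fun w w' hww' hw'w => by
        by_contra hne
        have hbne : b w ≠ b w' := fun h =>
          hne (Subtype.ext (hC.eq_of_pos_of_pos (hw w).1 (hw w').1 (hbw w) (h ▸ hbw w')))
        exact (hC.planar_total (.inr ⟨w, hw w, hbw w⟩) (.inr ⟨w', hw w', hbw w'⟩) (hcb w).face
          (hcb w').face hbne).elim hww' hw'w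
      irrefl := fun _ => hC.planar_irrefl
      trans := fun _ _ _ => hC.planar_trans }

end IsDFC

/-! ### Connectedness of the tips above a cell -/

/-- The tips with a descending path to `b`. -/
def TipsAbove (C : MOP.{u}) (b : C.Cell) : Set C.Cell := {t | C.IsTip t ∧ C.Descends t b}

/-- `t` and `t'` are consecutive tips for the planar order over some cell. -/
def NextTip (C : MOP.{u}) (t t' : C.Cell) : Prop :=
  ∃ c, C.Face c t ∧ C.Face c t' ∧ C.Planar c t t' ∧
    ∀ s, C.IsTip s → C.Face c s → ¬ (C.Planar c t s ∧ C.Planar c s t')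

/-- `s` and `s'` are tips above `b` which are consecutive, in some order. -/
def TipAdj (C : MOP.{u}) (b s s' : C.Cell) : Prop :=
  s ∈ C.TipsAbove b ∧ s' ∈ C.TipsAbove b ∧ (C.NextTip s s' ∨ C.NextTip s' s)

/-- `d` and `d'` are sources of `a` with a common face. -/
def SharesFace (C : MOP.{u}) (a d d' : C.Cell) : Prop :=
  C.Neg d a ∧ C.Neg d' a ∧ ∃ c, C.Face c d ∧ C.Face c d'

lemma TipsAbove.mono (h : C.Descends d b) : C.TipsAbove d ⊆ C.TipsAbove b :=
  fun _ ht => ⟨ht.1, ht.2.trans h⟩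

lemma reflTransGen_tipAdj_mono (h : C.Descends d b) (hs : ReflTransGen (C.TipAdj d) s s') :
    ReflTransGen (C.TipAdj b) s s' :=
  ReflTransGen.mono (fun _ _ hadj => ⟨.mono h hadj.1, .mono h hadj.2.1, hadj.2.2⟩) _ _ hs

lemma reflTransGen_tipAdj_symm (h : ReflTransGen (C.TipAdj b) s s') :
    ReflTransGen (C.TipAdj b) s' s :=
  have : Std.Symm (C.TipAdj b) := ⟨fun _ _ h => ⟨h.2.1, h.1, h.2.2.symm⟩⟩
  ReflTransGen.stdSymm.symm _ _ h

namespace IsDFC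

lemma exists_neg_of_notMem_null (hC : C.IsDFC) (ha : a ∈ C.Lam) (h : a ∉ C.Null) :
    ∃ d, C.Neg d a := by
  obtain ⟨d, hd⟩ := Set.nonempty_iff_ne_empty.2 h
  exact ⟨d, (neg_or_loop_of_mem_δ hd).resolve_right (hC.not_loop_of_mem_lam ha)⟩

lemma exists_neg_face_of_pos (hC : C.IsDFC) (ha : a ∈ C.Lam) (hn : a ∉ C.Null) (hb : C.Pos b a)
    (hc : C.Face c b) : ∃ d, C.Neg d a ∧ C.Face c d := by
  rcases hc.neg_or_pos_or_loop with hc | hc | hc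
  · obtain ⟨d, hcd, hd⟩ := hC.exists_neg_neg_of_neg_pos hc hb
    exact ⟨d, hd, hcd.face⟩
  · obtain ⟨d, hcd, hd⟩ := hC.exists_pos_neg_of_pos_pos hc hb
    exact ⟨d, hd, hcd.face⟩
  · obtain ⟨d, hd⟩ := hC.exists_neg_of_notMem_null ha hn
    exact ⟨d, hd, (hC.loop_of_loop_pos hc hb hd).face⟩

lemma exists_mem_tipsAbove_face (hC : C.IsDFC) (hc : C.Face c b) :
    ∃ t ∈ C.TipsAbove b, C.Face c t := by
  induction b using hC.wellFounded_edgeStep.induction with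
  | _ b ih =>
  rcases hC.lam_or_pos b with hb | ⟨a, ha, hb⟩
  · exact ⟨b, ⟨.inl hb, .refl⟩, hc⟩
  by_cases hn : a ∈ C.Null
  · exact ⟨b, ⟨.inr ⟨a, ⟨ha, hn⟩, hb⟩, .refl⟩, hc⟩
  obtain ⟨d, hd, hcd⟩ := hC.exists_neg_face_of_pos ha hn hb hc
  have hdb : C.EdgeStep d b := ⟨a, ha, hd, hb⟩
  obtain ⟨t, ht, hct⟩ := ih d hdb hcd
  exact ⟨t, .mono (.single hdb) ht, hct⟩

lemma wellFounded_planar (hC : C.IsDFC) (c : C.Cell) : WellFounded (C.Planar c) :=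
  have := C.finite
  have : IsTrans C.Cell (C.Planar c) := ⟨fun _ _ _ => hC.planar_trans⟩
  have : Std.Irrefl (C.Planar c) := ⟨fun _ => hC.planar_irrefl⟩
  Finite.wellFounded_of_trans_of_irrefl _

lemma wellFounded_swap_planar (hC : C.IsDFC) (c : C.Cell) :
    WellFounded (Function.swap (C.Planar c)) :=
  have := C.finite
  have : IsTrans C.Cell (Function.swap (C.Planar c)) := ⟨fun _ _ _ h h' => hC.planar_trans h' h⟩
  have : Std.Irrefl (Function.swap (C.Planar c)) := ⟨fun _ => hC.planar_irrefl⟩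
  Finite.wellFounded_of_trans_of_irrefl _

lemma reflTransGen_tipAdj_of_planar (hC : C.IsDFC) (ht : t ∈ C.TipsAbove b) (hct : C.Face c t)
    (ht' : t' ∈ C.TipsAbove b) (hct' : C.Face c t') (h : C.Planar c t t') :
    ReflTransGen (C.TipAdj b) t t' := by
  induction t' using (hC.wellFounded_planar c).induction with
  | _ t' ih =>
  by_cases hbetween : ∃ s, C.IsTip s ∧ C.Face c s ∧ C.Planar c t s ∧ C.Planar c s t'
  · obtain ⟨s, ⟨hs, hcs, hts, hst'⟩, hmax⟩ := (hC.wellFounded_swap_planar c).has_min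
      {s | C.IsTip s ∧ C.Face c s ∧ C.Planar c t s ∧ C.Planar c s t'} hbetween
    have hsb : s ∈ C.TipsAbove b := ⟨hs, hC.descends_of_planar hts hst' ht.2 ht'.2⟩
    refine (ih s hst' hsb hcs hts).tail ⟨hsb, ht', .inl ⟨c, hcs, hct', hst', ?_⟩⟩
    exact fun r hr hcr hsr => hmax r ⟨hr, hcr, hC.planar_trans hts hsr.1, hsr.2⟩ hsr.1
  · exact .single ⟨ht, ht', .inl ⟨c, hct, hct', h, fun s hs hcs hss =>
      hbetween ⟨s, hs, hcs, hss⟩⟩⟩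

lemma reflTransGen_tipAdj_of_face (hC : C.IsDFC) (ht : t ∈ C.TipsAbove b) (hct : C.Face c t)
    (ht' : t' ∈ C.TipsAbove b) (hct' : C.Face c t') : ReflTransGen (C.TipAdj b) t t' := by
  rcases eq_or_ne t t' with rfl | hne
  · exact .refl
  rcases hC.planar_total ht.1 ht'.1 hct hct' hne with h | h
  · exact hC.reflTransGen_tipAdj_of_planar ht hct ht' hct' h
  · exact reflTransGen_tipAdj_symm (hC.reflTransGen_tipAdj_of_planar ht' hct' ht hct h)

/-- Following targets from source to source ends, by acyclicity, at the source `d₀` with the same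
target as `b`. -/
lemma reflTransGen_sharesFace_of_pos (hC : C.IsDFC) (hb : C.Pos b a) (hc₀ : C.Pos c₀ b)
    (hc₀d₀ : C.Pos c₀ d₀) (hd₀ : C.Neg d₀ a) (hzd : C.Pos z d) (hd : C.Neg d a) :
    ReflTransGen (C.SharesFace a) d d₀ := by
  have := C.finite
  have hdim : 1 ≤ C.dim a := by
    have := hd.face.dim_add_one
    have := hzd.face.dim_nonneg
    lia
  induction d using (wellFounded_of_acyclic (hC.acyclic a hdim)).induction generalizing z with
  | _ d ih =>
  obtain ⟨y, ⟨hzy, hy⟩ | ⟨hzy, hy⟩⟩ := hC.exists_neg_neg_or_pos_pos_of_pos_neg hzd hd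
  · obtain ⟨z', hz'⟩ := hzy.exists_pos
    exact .head ⟨hd, hy, z, hzd.face, hzy.face⟩ (ih y ⟨hy, hd, z, hzy, hzd⟩ hz' hy)
  · obtain rfl := hy.unique hb
    obtain rfl := hzy.unique hc₀
    rw [hC.pos_neg_unique hzd hd hc₀d₀ hd₀]

lemma exists_neg_reflTransGen_sharesFace (hC : C.IsDFC) (hb : C.Pos b a) (hd : C.Neg d a)
    (hdim : 0 ≤ C.dim b) :
    ∃ d₀, C.Neg d₀ a ∧ ∀ d, C.Neg d a → ReflTransGen (C.SharesFace a) d d₀ := by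
  obtain ⟨c₀, hc₀⟩ := exists_mem_γ hdim
  rcases pos_or_loop_of_mem_γ hc₀ with hc₀ | hc₀
  · obtain ⟨d₀, hc₀d₀, hd₀⟩ := hC.exists_pos_neg_of_pos_pos hc₀ hb
    have of_pos {d z : C.Cell} (hz : C.Pos z d) (hd : C.Neg d a) :=
      hC.reflTransGen_sharesFace_of_pos hb hc₀ hc₀d₀ hd₀ hz hd
    refine ⟨d₀, hd₀, fun d hd => ?_⟩
    obtain ⟨z, hz⟩ := exists_mem_γ (hd.face.dim_eq hb.face ▸ hdim)
    rcases pos_or_loop_of_mem_γ hz with hz | hz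
    · exact of_pos hz hd
    obtain ⟨y, ⟨hzy, hy⟩ | ⟨hzy, hy⟩ | ⟨hzy, hy⟩⟩ :=
      hC.exists_loop_pos_or_neg_neg_or_pos_neg hz hd
    · obtain rfl := hy.unique hb
      exact (hzy.not_pos hc₀).elim
    · obtain ⟨z', hz'⟩ := hzy.exists_pos
      exact .head ⟨hd, hy, z, hz.face, hzy.face⟩ (of_pos hz' hy)
    · exact .head ⟨hd, hy, z, hz.face, hzy.face⟩ (of_pos hzy hy)
  · have loop {d : C.Cell} (hd : C.Neg d a) : C.Loop c₀ d := hC.loop_of_loop_pos hc₀ hb hd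
    exact ⟨d, hd, fun d' hd' => .single ⟨hd', hd, c₀, (loop hd').face, (loop hd).face⟩⟩

lemma reflTransGen_tipAdj_of_sharesFace (hC : C.IsDFC) (ha : a ∈ C.Lam) (hb : C.Pos b a)
    (hconn : ∀ d, C.Neg d a → ∀ t ∈ C.TipsAbove d, ∀ t' ∈ C.TipsAbove d,
      ReflTransGen (C.TipAdj b) t t')
    (h : ReflTransGen (C.SharesFace a) d d') (hd : C.Neg d a) (ht : t ∈ C.TipsAbove d)
    (ht' : t' ∈ C.TipsAbove d') : ReflTransGen (C.TipAdj b) t t' := by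
  induction h generalizing t' with
  | refl => exact hconn d hd t ht t' ht'
  | @tail e e' _ hshares ih =>
    obtain ⟨he, he', c, hce, hce'⟩ := hshares
    have above {d t : C.Cell} (hd : C.Neg d a) (ht : t ∈ C.TipsAbove d) : t ∈ C.TipsAbove b :=
      .mono (.single ⟨a, ha, hd, hb⟩) ht
    obtain ⟨s, hs, hcs⟩ := hC.exists_mem_tipsAbove_face hce
    obtain ⟨s', hs', hcs'⟩ := hC.exists_mem_tipsAbove_face hce'
    calc
      ReflTransGen (C.TipAdj b) t s := ih hs
      ReflTransGen (C.TipAdj b) s s' :=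
        hC.reflTransGen_tipAdj_of_face (above he hs) hcs (above he' hs') hcs'
      ReflTransGen (C.TipAdj b) s' t' := hconn e' he' s' hs' t' ht'

lemma reflTransGen_tipAdj (hC : C.IsDFC) (hdim : 0 ≤ C.dim b) (ht : t ∈ C.TipsAbove b)
    (ht' : t' ∈ C.TipsAbove b) : ReflTransGen (C.TipAdj b) t t' := by
  induction b using hC.wellFounded_edgeStep.induction generalizing t t' with
  | _ b ih =>
  by_cases hb : C.IsTip b
  · rw [hC.eq_of_descends_of_isTip ht.2 hb, hC.eq_of_descends_of_isTip ht'.2 hb]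
  rcases ReflTransGen.cases_tail ht.2 with rfl | ⟨d, htd, a, ha, hda, hba⟩
  · exact (hb ht.1).elim
  rcases ReflTransGen.cases_tail ht'.2 with rfl | ⟨d', htd', a', ha', hda', hba'⟩
  · exact (hb ht'.1).elim
  obtain rfl := hC.eq_of_pos_of_pos ha ha' hba hba'
  have hconn (d : C.Cell) (hd : C.Neg d a) (t : C.Cell) (ht : t ∈ C.TipsAbove d) (t' : C.Cell)
      (ht' : t' ∈ C.TipsAbove d) : ReflTransGen (C.TipAdj b) t t' :=
    have hdb : C.EdgeStep d b := ⟨a, ha, hd, hba⟩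
    reflTransGen_tipAdj_mono (.single hdb) (ih d hdb (hdb.dim_eq ▸ hdim) ht ht')
  obtain ⟨d₀, hd₀, hpath⟩ := hC.exists_neg_reflTransGen_sharesFace hba hda hdim
  obtain ⟨c₀, hc₀⟩ := exists_mem_γ (hd₀.face.dim_eq hba.face ▸ hdim)
  obtain ⟨s, hs, -⟩ := hC.exists_mem_tipsAbove_face (.inr hc₀)
  exact (hC.reflTransGen_tipAdj_of_sharesFace ha hba hconn (hpath d hda) hda ⟨ht.1, htd⟩ hs).trans
    (reflTransGen_tipAdj_symm (hC.reflTransGen_tipAdj_of_sharesFace ha hba hconn (hpath d' hda')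
      hda' ⟨ht'.1, htd'⟩ hs))

end IsDFC

end MOP

/-! ### Rooted trees and constellations from relations -/

/-- A rooted tree presented by relations on names instead of maps between finite types: `tgt b a`
says that `b` is the target edge of the node `a`, and `src b a` that it is a source edge of `a`. The
relations are only meaningful on `nodes` and `edges`. -/
structure TreeData (α : Type u) where
  nodes : Finset α
  edges : Finset α
  tgt : α → α → Prop
  src : α → α → Prop
  root : α
  root_mem : root ∈ edges
  exists_tgt : ∀ a ∈ nodes, ∃ b ∈ edges, tgt b a
  tgt_unique : ∀ a ∈ nodes, ∀ b b', tgt b a → tgt b' a → b = b'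
  tgt_injective : ∀ a ∈ nodes, ∀ a' ∈ nodes, ∀ b, tgt b a → tgt b a' → a = a'
  src_unique : ∀ a ∈ nodes, ∀ a' ∈ nodes, ∀ b, src b a → src b a' → a = a'
  not_src_root : ∀ a ∈ nodes, ¬ src root a
  exists_path : ∀ b ∈ edges,
    Relation.ReflTransGen (fun b b' => ∃ a ∈ nodes, src b a ∧ tgt b' a) b root

namespace TreeData

variable {α : Type u} (D : TreeData α)

/-- The target edge of a node. -/
noncomputable def target (a : D.nodes) : D.edges :=
  ⟨(D.exists_tgt a a.2).choose, (D.exists_tgt a a.2).choose_spec.1⟩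

lemma target_eq_iff (a : D.nodes) (b : D.edges) : D.target a = b ↔ D.tgt b a := by
  have htarget : D.tgt (D.target a) a := (D.exists_tgt a a.2).choose_spec.2
  exact ⟨fun h => h ▸ htarget, fun h => Subtype.ext (D.tgt_unique a a.2 _ _ htarget h)⟩

open Classical in
/-- The target node of an edge, if there is one. -/
noncomputable def targetNode (b : D.edges) : Option D.nodes :=
  if h : ∃ a : D.nodes, D.src b a then some h.choose else none

lemma targetNode_eq_iff (b : D.edges) (a : D.nodes) :
    D.targetNode b = some a ↔ D.src b a := by
  unfold targetNode
  split_ifs with h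
  · rw [Option.some.injEq]
    exact ⟨fun ha => ha ▸ h.choose_spec,
      fun ha => Subtype.ext (D.src_unique _ h.choose.2 a a.2 b h.choose_spec ha)⟩
  · exact ⟨fun ha => by simp at ha, fun ha => (h ⟨a, ha⟩).elim⟩

lemma reflTransGen_target_targetNode (b : D.edges) :
    Relation.ReflTransGen (fun b b' => ∃ a, D.targetNode b = some a ∧ D.target a = b') b
      ⟨D.root, D.root_mem⟩ := by
  obtain ⟨b, hb⟩ := b
  induction D.exists_path b hb using Relation.ReflTransGen.head_induction_on with
  | refl => exact .refl
  | head hstep _ ih =>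
    obtain ⟨a, ha, hsrc, htgt⟩ := hstep
    obtain ⟨b', hb', htgt'⟩ := D.exists_tgt a ha
    obtain rfl := D.tgt_unique a ha _ _ htgt htgt'
    exact .head ⟨⟨a, ha⟩, (D.targetNode_eq_iff _ _).2 hsrc, (D.target_eq_iff _ _).2 htgt⟩ (ih hb')

/-- The rooted tree presented by the relations. -/
noncomputable def toDotTree : DotTree α where
  nodes := D.nodes
  edges := D.edges
  target := D.target
  targetNode := D.targetNode
  target_injective a a' h := Subtype.ext <| D.tgt_injective a a.2 a' a'.2 _
    ((D.target_eq_iff a _).1 h) ((D.target_eq_iff a' _).1 rfl)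
  root := ⟨D.root, D.root_mem⟩
  targetNode_root := Option.eq_none_iff_forall_ne_some.2 fun a ha =>
    D.not_src_root a a.2 ((D.targetNode_eq_iff _ a).1 ha)
  exists_path := D.reflTransGen_target_targetNode

lemma toDotTree_target_eq_iff (a : D.toDotTree.nodes) (b : D.toDotTree.edges) :
    D.toDotTree.target a = b ↔ D.tgt b a := D.target_eq_iff a b

lemma toDotTree_targetNode_eq_iff (b : D.toDotTree.edges) (a : D.toDotTree.nodes) :
    D.toDotTree.targetNode b = some a ↔ D.src b a := D.targetNode_eq_iff b a

end TreeData

namespace DotTree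

variable {α : Type u} {T : DotTree α}

/-- The step from an edge to the target edge of its target node, which allows the descending paths
of a tree to be read on its edges only. -/
def EdgeStep (T : DotTree α) (b b' : T.edges) : Prop :=
  ∃ a, T.targetNode b = some a ∧ T.target a = b'

lemma descends_of_edgeStep {b b' : T.edges} (h : Relation.ReflTransGen T.EdgeStep b b') :
    T.Descends (.inr b) (.inr b') := by
  induction h with
  | refl => exact .refl
  | tail _ h ih =>
    obtain ⟨a, ha, rfl⟩ := h
    exact (ih.tail (.edge _ a ha)).tail (.node a)

lemma edgeStep_of_descends {x : T.nodes ⊕ T.edges} {b' : T.edges}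
    (h : T.Descends x (.inr b')) :
    Relation.ReflTransGen T.EdgeStep (Sum.elim T.target id x) b' := by
  induction h using Relation.ReflTransGen.head_induction_on with
  | refl => exact .refl
  | head hstep _ ih =>
    cases hstep with
    | node a => exact ih
    | edge b a h => exact .head ⟨a, h, rfl⟩ ih

lemma descends_node_of_edgeStep {b : T.edges} {x : T.nodes}
    (h : Relation.TransGen T.EdgeStep b (T.target x)) : T.Descends (.inr b) (.inl x) := by
  obtain ⟨b', hpath, a, ha, htarget⟩ := Relation.TransGen.tail'_iff.1 h
  obtain rfl := T.target_injective htarget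
  exact (descends_of_edgeStep hpath).tail (.edge _ _ ha)

lemma leaf_descends_node_iff {b : T.edges} (hb : T.IsLeaf b) {x : T.nodes} :
    T.Descends (.inr b) (.inl x) ↔ Relation.ReflTransGen T.EdgeStep b (T.target x) := by
  refine ⟨fun h => edgeStep_of_descends (h.tail (.node x)), fun h => ?_⟩
  rcases Relation.reflTransGen_iff_eq_or_transGen.1 h with h | h
  · exact (hb x h).elim
  · exact descends_node_of_edgeStep h

lemma node_descends_node_iff {a x : T.nodes} :
    T.Descends (.inl a) (.inl x) ↔
      Relation.ReflTransGen T.EdgeStep (T.target a) (T.target x) := by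
  refine ⟨fun h => edgeStep_of_descends (h.tail (.node x)), fun h => ?_⟩
  rcases Relation.reflTransGen_iff_eq_or_transGen.1 h with h | h
  · rw [T.target_injective h]
    exact .refl
  · exact .head (.node a) (descends_node_of_edgeStep h)

namespace Subdivision

/-- The subdivision without whitedots. -/
def empty (T : DotTree α) : T.Subdivision where
  W _ := ∅
  lt _ _ _ := False
  lt_total _ :=
    { trichotomous := isEmptyElim
      irrefl := isEmptyElim
      trans := isEmptyElim }

lemma subsingleton_dot_empty (hT : T.nodes.card = 1) : Subsingleton (empty T).Dot where
  allEq
    | .inl a, .inl a' => congrArg _ (Subtype.ext (Finset.card_le_one.1 hT.le _ a.2 _ a'.2))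
    | .inr w, _ | _, .inr w => (Finset.notMem_empty _ w.2.2).elim

variable {S : T.Subdivision} {w w' : S.Whitedot}

lemma whiteLT_mk_iff {b : T.edges} {w w' : S.W b} : S.WhiteLT ⟨b, w⟩ ⟨b, w'⟩ ↔ S.lt b w w' :=
  ⟨fun h => by cases h; assumption, .mk b w w'⟩

lemma WhiteLT.fst_eq (h : S.WhiteLT w w') : w.1 = w'.1 := by
  cases h
  rfl

lemma whitedot_ext (h : w.1 = w'.1) (h' : (w.2 : α) = w'.2) : w = w' := by
  obtain ⟨b, w⟩ := w
  obtain ⟨b', w'⟩ := w'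
  obtain rfl : b = b' := h
  obtain rfl := Subtype.ext h'
  rfl

end Subdivision

end DotTree

namespace Constellation

variable {α : Type u} {T U : DotTree α}

/-- The edge or node of `U` with the same name as a dot of a subdivision of `T`. -/
def dotImage (S : T.Subdivision) (hblack : ∀ x ∈ T.nodes, x ∈ U.edges)
    (hwhite : ∀ b, ∀ x ∈ S.W b, x ∈ U.nodes) : S.Dot → U.nodes ⊕ U.edges :=
  Sum.elim (fun a => .inr ⟨a.1, hblack _ a.2⟩) (fun w => .inl ⟨w.2.1, hwhite _ _ w.2.2⟩)

/-- The exact constellation carried by a subdivision. -/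
noncomputable def ofExact (S : T.Subdivision)
    (hblack : ∀ x, x ∈ T.nodes ↔ ∃ h : x ∈ U.edges, U.IsLeaf ⟨x, h⟩)
    (hwhite : ∀ x, (∃ b, x ∈ S.W b) ↔ ∃ h : x ∈ U.nodes, U.IsNulldot ⟨x, h⟩)
    (hdisj : ∀ x b b', x ∈ S.W b → x ∈ S.W b' → b = b')
    (kernel : ∀ x : U.nodes, (S.graph.induce {t | U.Descends
      (dotImage S (fun x hx => ((hblack x).1 hx).1) (fun b x hx => ((hwhite x).1 ⟨b, hx⟩).1) t)
      (.inl x)}).Connected) :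
    Constellation T U where
  sub := S
  σBlack := Equiv.ofBijective
    (fun a => ⟨⟨a.1, ((hblack a.1).1 a.2).1⟩, ((hblack a.1).1 a.2).2⟩)
    ⟨fun _ _ h => Subtype.ext (congrArg (fun y => (y.1.1 : α)) h),
      fun y => ⟨⟨y.1.1, (hblack _).2 ⟨y.1.2, y.2⟩⟩, rfl⟩⟩
  σWhite := Equiv.ofBijective
    (fun w => ⟨⟨w.2.1, ((hwhite w.2.1).1 ⟨w.1, w.2.2⟩).1⟩, ((hwhite w.2.1).1 ⟨w.1, w.2.2⟩).2⟩)
    ⟨fun w w' h => by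
      have hname : (w.2 : α) = w'.2 := congrArg (fun y => (y.1.1 : α)) h
      exact DotTree.Subdivision.whitedot_ext (hdisj _ _ _ w.2.2 (hname ▸ w'.2.2)) hname,
    fun y => by
      obtain ⟨b, hb⟩ := (hwhite y.1.1).2 ⟨y.1.2, y.2⟩
      exact ⟨⟨b, y.1.1, hb⟩, rfl⟩⟩
  kernel := kernel

/-- The constellation without whitedots from a tree with a single node to a tree with a single leaf
and no nulldots. -/
noncomputable def ofUnary (T U : DotTree α) (hT : T.nodes.card = 1)
    (hblack : ∀ x, x ∈ T.nodes ↔ ∃ h : x ∈ U.edges, U.IsLeaf ⟨x, h⟩)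
    (hU : ∀ a, ¬ U.IsNulldot a)
    (kernel : ∀ x : U.nodes, ∃ b, U.IsLeaf b ∧ U.Descends (.inr b) (.inl x)) :
    Constellation T U :=
  ofExact (DotTree.Subdivision.empty T) hblack
    (fun x => ⟨fun ⟨_, h⟩ => (Finset.notMem_empty _ h).elim, fun ⟨_, h⟩ => (hU _ h).elim⟩)
    (fun _ _ _ h => (Finset.notMem_empty _ h).elim)
    (fun x => by
      obtain ⟨b, hb, hx⟩ := kernel x
      have := DotTree.Subdivision.subsingleton_dot_empty hT
      exact (SimpleGraph.connected_iff _).2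
        ⟨.of_subsingleton, ⟨⟨.inl ⟨b.1, (hblack _).2 ⟨b.2, hb⟩⟩, hx⟩⟩⟩)

end Constellation

/-! ### Isomorphisms given by a bijection between names -/

/-- The bijection `F` between names restricts to an isomorphism of rooted trees. -/
structure DotTree.IsIsoVia {α β : Type u} (F : α ≃ β) (T : DotTree α) (U : DotTree β) : Prop where
  mem_nodes : ∀ x, x ∈ T.nodes ↔ F x ∈ U.nodes
  mem_edges : ∀ x, x ∈ T.edges ↔ F x ∈ U.edges
  target : ∀ (a : T.nodes) (b : T.edges), T.target a = b →
    U.target ⟨F a, (mem_nodes a).1 a.2⟩ = ⟨F b, (mem_edges b).1 b.2⟩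
  targetNode : ∀ (b : T.edges) (a : T.nodes), T.targetNode b = some a ↔
    U.targetNode ⟨F b, (mem_edges b).1 b.2⟩ = some ⟨F a, (mem_nodes a).1 a.2⟩
  root : F T.root = U.root

/-- The isomorphism of rooted trees given by a bijection between names. -/
def DotTree.IsIsoVia.iso {α β : Type u} {F : α ≃ β} {T : DotTree α} {U : DotTree β}
    (h : DotTree.IsIsoVia F T U) : T.Iso U where
  node := F.subtypeEquiv h.mem_nodes
  edge := F.subtypeEquiv h.mem_edges
  map_target a := (h.target a _ rfl).symm
  map_targetNode b := by
    ext a'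
    obtain ⟨a, rfl⟩ := (F.subtypeEquiv h.mem_nodes).surjective a'
    simp only [Option.map_eq_some_iff, EmbeddingLike.apply_eq_iff_eq, exists_eq_right]
    exact h.targetNode b a
  map_root := Subtype.ext h.root

namespace KJBM

/-- The bijection `F` between names restricts to an isomorphism of opetopes. -/
structure IsIsoVia (X Y : KJBM.{u}) (F : X.Name ≃ Y.Name) : Prop where
  dim_eq : X.dim = Y.dim
  tree : ∀ k (h : k ≤ X.dim), DotTree.IsIsoVia F (X.tree k h) (Y.tree k (dim_eq ▸ h))
  mem_W : ∀ k (h : k + 1 ≤ X.dim) (b : (X.tree k (Nat.le_of_succ_le h)).edges) x,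
    x ∈ (X.con k h).sub.W b ↔
      F x ∈ (Y.con k (dim_eq ▸ h)).sub.W ((tree k (Nat.le_of_succ_le h)).iso.edge b)
  lt_iff : ∀ k (h : k + 1 ≤ X.dim) b (w w' : (X.con k h).sub.W b),
    (X.con k h).sub.lt b w w' ↔
      (Y.con k (dim_eq ▸ h)).sub.lt ((tree k (Nat.le_of_succ_le h)).iso.edge b)
        ⟨F w, (mem_W k h b w).1 w.2⟩ ⟨F w', (mem_W k h b w').1 w'.2⟩

/-- The isomorphism of opetopes given by a bijection between names. -/
def IsIsoVia.hom {X Y : KJBM.{u}} {F : X.Name ≃ Y.Name} (h : IsIsoVia X Y F) : X ⟶ Y where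
  dim_eq := h.dim_eq
  tree k hk := (h.tree k hk).iso
  white k hk := Equiv.sigmaCongr (h.tree k _).iso.edge
    fun b => F.subtypeEquiv (h.mem_W k hk b)
  white_edge k hk w := rfl
  white_lt k hk w w' := by
    obtain ⟨b, w⟩ := w
    obtain ⟨b', w'⟩ := w'
    by_cases hb : b = b'
    · subst hb
      exact DotTree.Subdivision.whiteLT_mk_iff.trans
        ((h.lt_iff k hk b w w').trans DotTree.Subdivision.whiteLT_mk_iff.symm)
    · exact iff_of_false (fun hlt => hb hlt.fst_eq)
        fun hlt => hb ((h.tree k _).iso.edge.injective hlt.fst_eq)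
  map_σBlack k hk a := Subtype.ext <| by
    rw [(Y.opetope.exact k _).1]
    exact congrArg F ((X.opetope.exact k hk).1 a)
  map_σWhite k hk w := Subtype.ext <| by
    rw [(Y.opetope.exact k _).2]
    exact congrArg F ((X.opetope.exact k hk).2 w)

lemma hom_ext_names {X Y : KJBM.{u}} {f g : X ⟶ Y}
    (hnode : ∀ k h a, ((f.tree k h).node a : Y.Name) = (g.tree k h).node a)
    (hedge : ∀ k h b, ((f.tree k h).edge b : Y.Name) = (g.tree k h).edge b)
    (hwhite : ∀ k h w, ((f.white k h w).2 : Y.Name) = (g.white k h w).2) : f = g := by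
  have htree : f.tree = g.tree := by
    funext k h
    refine DotTree.Iso.ext ?_ ?_
    · ext a
      exact hnode k h a
    · ext b
      exact hedge k h b
  refine Hom.ext htree ?_
  funext k h
  ext w : 1
  refine DotTree.Subdivision.whitedot_ext ?_ (hwhite k h w)
  rw [f.white_edge, g.white_edge, htree]

end KJBM

/-! ### The trees of a dendritic face complex -/

namespace TreeData

variable {α : Type u} {x l r : α} (hlr : l ≠ r)

/-- The tree with a single node `x`, leaf edge `l` and root edge `r`. -/
def unary (x : α) {l r : α} (hlr : l ≠ r) : TreeData α where
  nodes := {x}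
  edges := .cons l {r} (by simpa)
  tgt b _ := b = r
  src b _ := b = l
  root := r
  root_mem := by simp
  exists_tgt _ _ := ⟨r, by simp, rfl⟩
  tgt_unique _ _ _ _ h h' := h.trans h'.symm
  tgt_injective _ ha _ ha' _ _ _ :=
    (Finset.mem_singleton.1 ha).trans (Finset.mem_singleton.1 ha').symm
  src_unique _ ha _ ha' _ _ _ :=
    (Finset.mem_singleton.1 ha).trans (Finset.mem_singleton.1 ha').symm
  not_src_root _ _ := hlr.symm
  exists_path b hb := by
    rcases Finset.mem_cons.1 hb with rfl | hb
    · exact .single ⟨x, by simp, rfl, rfl⟩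
    · rw [Finset.mem_singleton.1 hb]

lemma mem_unary_edges {b : α} : b ∈ (unary x hlr).toDotTree.edges ↔ b = l ∨ b = r := by
  simp [unary, toDotTree]

lemma leaf_mem_unary_edges : l ∈ (unary x hlr).toDotTree.edges :=
  (mem_unary_edges hlr).2 (.inl rfl)

lemma unary_isLeaf_iff (b : (unary x hlr).toDotTree.edges) :
    (unary x hlr).toDotTree.IsLeaf b ↔ (b : α) = l := by
  refine ⟨fun h => ?_, fun h a ha => ?_⟩
  · exact ((mem_unary_edges hlr).1 b.2).resolve_right fun hb =>
      h ⟨x, Finset.mem_singleton_self x⟩ (((unary x hlr).toDotTree_target_eq_iff _ _).2 hb)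
  · exact hlr (h.symm.trans (((unary x hlr).toDotTree_target_eq_iff a b).1 ha))

lemma unary_isUnary : (unary x hlr).toDotTree.IsUnary :=
  ⟨Finset.card_singleton x, ⟨l, leaf_mem_unary_edges hlr⟩, (unary_isLeaf_iff hlr _).2 rfl,
    fun b hb => Subtype.ext ((unary_isLeaf_iff hlr b).1 hb)⟩

lemma unary_targetNode_leaf (a : (unary x hlr).toDotTree.nodes) :
    (unary x hlr).toDotTree.targetNode ⟨l, leaf_mem_unary_edges hlr⟩ = some a :=
  ((unary x hlr).toDotTree_targetNode_eq_iff _ _).2 rfl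

end TreeData

lemma FacetPoset.pos_of_dim_eq_zero {P : FacetPoset.{u}} {x y : P.Cell} (hx : P.dim x = 0)
    (hy : P.dim y = -1) : P.Pos y x := by
  change y ∈ P.γ x \ P.δ x
  exact P.γ_diff_δ_of_dim_zero y x hy hx ▸ Set.mem_singleton y

namespace MOP

variable {C : MOP.{u}} {a b c d : C.Cell} {k : ℕ}

open FacetPoset Relation

/-- The names used in `Z(C)`: the cells, which name everything from the nodes of `T₁` on, and two
additional names, which are needed because the edges of `T₀` and `T₁` are not cells. -/
abbrev ZoomName (C : MOP.{u}) : Type u := C.Cell ⊕ ULift.{u} Bool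

instance (C : MOP.{u}) : Finite C.Cell := C.finite

/-- The set `Λₖ₊₁`, as a set of names. -/
noncomputable def levelNodes (C : MOP.{u}) (k : ℕ) : Finset C.ZoomName :=
  (Set.toFinite (Sum.inl '' {a | a ∈ C.Lam ∧ C.dim a = k + 1})).toFinset

/-- The set `Cₖ`, as a set of names. -/
noncomputable def levelEdges (C : MOP.{u}) (k : ℕ) : Finset C.ZoomName :=
  (Set.toFinite (Sum.inl '' {c | C.dim c = k})).toFinset

lemma mem_levelNodes {x : C.ZoomName} :
    x ∈ C.levelNodes k ↔ ∃ a ∈ C.Lam, C.dim a = k + 1 ∧ .inl a = x := by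
  simp [levelNodes, and_assoc]

lemma mem_levelEdges {x : C.ZoomName} : x ∈ C.levelEdges k ↔ ∃ c, C.dim c = k ∧ .inl c = x := by
  simp [levelEdges]

lemma inl_mem_levelNodes : .inl a ∈ C.levelNodes k ↔ a ∈ C.Lam ∧ C.dim a = k + 1 := by
  simp [levelNodes]

lemma inl_mem_levelEdges : .inl c ∈ C.levelEdges k ↔ C.dim c = k := by
  simp [levelEdges]

lemma reflTransGen_levelNodes_of_descends (h : C.Descends b c) (hb : C.dim b = k) :
    ReflTransGen (fun x x' : C.ZoomName => ∃ y ∈ C.levelNodes k,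
      Sum.LiftRel C.Neg (fun _ _ => False) x y ∧ Sum.LiftRel C.Pos (fun _ _ => False) x' y)
      (.inl b) (.inl c) := by
  induction h using ReflTransGen.head_induction_on with
  | refl => exact .refl
  | head hstep _ ih =>
    have hdim := hstep.dim_eq
    obtain ⟨a, ha, hneg, hpos⟩ := hstep
    have hda : C.dim a = k + 1 := by rw [← hneg.face.dim_add_one, hb]
    exact .head ⟨.inl a, inl_mem_levelNodes.2 ⟨ha, hda⟩, .inl hneg, .inl hpos⟩
      (ih (hdim.symm.trans hb))

namespace IsDFC

/-- The dimension of a dendritic face complex, as a natural number. -/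
noncomputable def height (hC : C.IsDFC) : ℕ := (C.dim hC.greatest.choose).toNat

lemma exists_isGreatestCell (hC : C.IsDFC) : ∃ ω, C.IsGreatestCell ω ∧ C.dim ω = hC.height :=
  have hω := hC.greatest.choose_spec
  ⟨_, hω.1, (Int.toNat_of_nonneg hω.2.le).symm⟩

lemma hasDim_height (hC : C.IsDFC) : C.HasDim hC.height := by
  obtain ⟨ω, hω, hdim⟩ := hC.exists_isGreatestCell
  refine ⟨⟨ω, hdim⟩, ?_⟩
  rintro _ ⟨x, rfl⟩
  rcases (hω x).eq_or_dim_lt with rfl | h <;> lia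

lemma exists_isIteratedTarget_of_le_height (hC : C.IsDFC) (hk : k ≤ hC.height) :
    ∃ g, C.IsIteratedTarget g ∧ C.dim g = k := by
  obtain ⟨ω, hω, hdim⟩ := hC.exists_isGreatestCell
  exact hω.exists_isIteratedTarget (by lia) (by lia)

lemma existsUnique_neg_of_dim_eq_one (hC : C.IsDFC) (ha : a ∈ C.Lam) (hd : C.dim a = 1) :
    ∃! b, C.Neg b a := by
  obtain ⟨s, hs, -⟩ := C.existsUnique_bot
  have pos_s (y : C.Cell) (hy : C.Face y a) : C.Pos s y :=
    pos_of_dim_eq_zero (by linarith [hy.dim_add_one]) hs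
  obtain ⟨b, hb⟩ := hC.exists_pos_of_mem_lam ha (by lia)
  obtain ⟨d, hsd, hda⟩ := hC.exists_pos_neg_of_pos_pos (pos_s b hb.face) hb
  exact ⟨d, hda, fun d' hd'a => hC.pos_neg_unique (pos_s d' hd'a.face) hd'a hsd hda⟩

lemma existsUnique_lam_of_dim_eq_zero (hC : C.IsDFC) : ∃! a, a ∈ C.Lam ∧ C.dim a = 0 := by
  obtain ⟨s, hs, -⟩ := C.existsUnique_bot
  obtain ⟨g, hg, hdim⟩ := hC.exists_isIteratedTarget_of_le_height (Nat.zero_le _)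
  rw [Nat.cast_zero] at hdim
  have hlevel := (hC.isLevelRoot_of_isIteratedTarget hg).lam
  rw [hdim] at hlevel
  rcases hlevel with hlam | ⟨G, hG, hlam⟩
  · exact ⟨g, ⟨(hlam g hdim).2 rfl, hdim⟩, fun y hy => (hlam y hy.2).1 hy.1⟩
  · obtain ⟨d, hsd, hdG⟩ := hC.exists_pos_neg_of_pos_pos (pos_of_dim_eq_zero hdim hs) hG
    have hd : C.dim d = 0 := (hdG.face.dim_eq hG.face).trans hdim
    exact ⟨d, ⟨(hlam d hd).2 hdG, hd⟩, fun y hy => hC.pos_neg_unique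
      (pos_of_dim_eq_zero hy.2 hs) ((hlam y hy.2).1 hy.1) hsd hdG⟩

/-- The tree with nodes `Λₖ₊₁` and edges `Cₖ`, presented by the relations `≺⁺` and `≺⁻`. -/
noncomputable def levelData (hC : C.IsDFC) (k : ℕ) (hk : k ≤ hC.height) :
    TreeData C.ZoomName where
  nodes := C.levelNodes k
  edges := C.levelEdges k
  tgt := Sum.LiftRel C.Pos fun _ _ => False
  src := Sum.LiftRel C.Neg fun _ _ => False
  root := .inl (hC.exists_isIteratedTarget_of_le_height hk).choose
  root_mem := inl_mem_levelEdges.2 (hC.exists_isIteratedTarget_of_le_height hk).choose_spec.2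
  exists_tgt x hx := by
    obtain ⟨a, ha, hd, rfl⟩ := mem_levelNodes.1 hx
    obtain ⟨b, hb⟩ := hC.exists_pos_of_mem_lam ha (by lia)
    exact ⟨.inl b, inl_mem_levelEdges.2 (by linarith [hb.face.dim_add_one]), .inl hb⟩
  tgt_unique
    | _, _, _, _, .inl h, .inl h' => congrArg _ (h.unique h')
  tgt_injective
    | _, ha, _, ha', _, .inl h, .inl h' => congrArg _
      (hC.eq_of_pos_of_pos (inl_mem_levelNodes.1 ha).1 (inl_mem_levelNodes.1 ha').1 h h')
  src_unique
    | _, ha, _, ha', _, .inl h, .inl h' => congrArg _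
      (hC.eq_of_neg_of_neg (inl_mem_levelNodes.1 ha).1 (inl_mem_levelNodes.1 ha').1 h h')
  not_src_root
    | _, ha, .inl h => hC.not_neg_of_isIteratedTarget
      (hC.exists_isIteratedTarget_of_le_height hk).choose_spec.1 (inl_mem_levelNodes.1 ha).1 h
  exists_path x hx := by
    obtain ⟨b, hb, rfl⟩ := mem_levelEdges.1 hx
    obtain ⟨hroot, hdim⟩ := (hC.exists_isIteratedTarget_of_le_height hk).choose_spec
    obtain ⟨g, hg, hbg⟩ := hC.exists_descends_isIteratedTarget b
    obtain rfl := hC.isIteratedTarget_unique hg hroot (by rw [← Descends.dim_eq hbg, hb, hdim])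
    exact reflTransGen_levelNodes_of_descends hbg hb

/-- The tree with nodes `Λₖ₊₁` and edges `Cₖ`. -/
noncomputable abbrev levelTree (hC : C.IsDFC) (k : ℕ) (hk : k ≤ hC.height) :
    DotTree C.ZoomName := (hC.levelData k hk).toDotTree

variable (hC : C.IsDFC) (hk : k ≤ hC.height)

lemma levelTree_target_eq_iff {x : (hC.levelTree k hk).nodes} {y : (hC.levelTree k hk).edges}
    (hx : .inl a = x.1) (hy : .inl c = y.1) :
    (hC.levelTree k hk).target x = y ↔ C.Pos c a := by
  rw [TreeData.toDotTree_target_eq_iff, ← hx, ← hy]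
  exact Sum.liftRel_inl_inl

lemma levelTree_targetNode_eq_iff {x : (hC.levelTree k hk).nodes}
    {y : (hC.levelTree k hk).edges} (hx : .inl a = x.1) (hy : .inl c = y.1) :
    (hC.levelTree k hk).targetNode y = some x ↔ C.Neg c a := by
  rw [TreeData.toDotTree_targetNode_eq_iff, ← hx, ← hy]
  exact Sum.liftRel_inl_inl

lemma levelTree_isLeaf_iff {y : (hC.levelTree k hk).edges} (hy : .inl c = y.1) :
    (hC.levelTree k hk).IsLeaf y ↔ c ∈ C.Lam := by
  refine ⟨fun h => (hC.lam_or_pos c).resolve_right ?_, fun hc x hx => ?_⟩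
  · rintro ⟨a, ha, hca⟩
    have hdc : C.dim c = k := inl_mem_levelEdges.1 (hy ▸ y.2)
    exact h ⟨.inl a, inl_mem_levelNodes.2 ⟨ha, by rw [← hca.face.dim_add_one, hdc]⟩⟩
      ((hC.levelTree_target_eq_iff hk rfl hy).2 hca)
  · obtain ⟨a, -, -, hax⟩ := mem_levelNodes.1 x.2
    exact hc a ((hC.levelTree_target_eq_iff hk hax hy).1 hx)

lemma levelTree_isNulldot_iff {x : (hC.levelTree k hk).nodes} (hx : .inl a = x.1) :
    (hC.levelTree k hk).IsNulldot x ↔ a ∈ C.Null := by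
  obtain ⟨ha, hda⟩ : a ∈ C.Lam ∧ C.dim a = k + 1 := inl_mem_levelNodes.1 (hx ▸ x.2)
  refine ⟨fun h => by_contra fun hnull => ?_, fun hnull y hy => ?_⟩
  · obtain ⟨c, hca⟩ := hC.exists_neg_of_notMem_null ha hnull
    exact h ⟨.inl c, inl_mem_levelEdges.2 (by linarith [hca.face.dim_add_one])⟩
      ((hC.levelTree_targetNode_eq_iff hk hx rfl).2 hca)
  · obtain ⟨c, -, hcy⟩ := mem_levelEdges.1 y.2
    exact not_neg_of_mem_null hnull ((hC.levelTree_targetNode_eq_iff hk hx hcy).1 hy)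

lemma levelTree_edgeStep_iff {y y' : (hC.levelTree k hk).edges} (hy : .inl b = y.1)
    (hy' : .inl c = y'.1) : (hC.levelTree k hk).EdgeStep y y' ↔ C.EdgeStep b c := by
  constructor
  · rintro ⟨x, hyx, hxy'⟩
    obtain ⟨a, ha, -, hax⟩ := mem_levelNodes.1 x.2
    exact ⟨a, ha, (hC.levelTree_targetNode_eq_iff hk hax hy).1 hyx,
      (hC.levelTree_target_eq_iff hk hax hy').1 hxy'⟩
  · rintro ⟨a, ha, hba, hca⟩
    have hdb : C.dim b = k := inl_mem_levelEdges.1 (hy ▸ y.2)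
    have hda : C.dim a = k + 1 := by rw [← hba.face.dim_add_one, hdb]
    exact ⟨⟨.inl a, inl_mem_levelNodes.2 ⟨ha, hda⟩⟩,
      (hC.levelTree_targetNode_eq_iff hk rfl hy).2 hba,
      (hC.levelTree_target_eq_iff hk rfl hy').2 hca⟩

lemma levelTree_reflTransGen_edgeStep_iff {y y' : (hC.levelTree k hk).edges}
    (hy : .inl b = y.1) (hy' : .inl c = y'.1) :
    ReflTransGen (hC.levelTree k hk).EdgeStep y y' ↔ C.Descends b c := by
  constructor <;> intro h
  · induction h using ReflTransGen.head_induction_on generalizing b with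
    | refl => rw [Sum.inl_injective (hy.trans hy'.symm)]
    | @head y z hstep _ ih =>
      obtain ⟨d, -, hd⟩ := mem_levelEdges.1 z.2
      exact .head ((hC.levelTree_edgeStep_iff hk hy hd).1 hstep) (ih hd)
  · induction h using ReflTransGen.head_induction_on generalizing y with
    | refl => rw [Subtype.ext (hy.symm.trans hy')]
    | @head b d hstep _ ih =>
      have hdb : C.dim b = k := inl_mem_levelEdges.1 (hy ▸ y.2)
      have hd : Sum.inl d ∈ (hC.levelTree k hk).edges :=
        inl_mem_levelEdges.2 (hstep.dim_eq.symm.trans hdb)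
      exact .head ((hC.levelTree_edgeStep_iff hk hy (y' := ⟨_, hd⟩) rfl).2 hstep) (ih rfl)

lemma levelTree_zero_isLinear : (hC.levelTree 0 (Nat.zero_le _)).IsLinear := by
  intro x
  obtain ⟨a, ha, hd, hax⟩ := mem_levelNodes.1 x.2
  obtain ⟨b, hba, huniq⟩ := hC.existsUnique_neg_of_dim_eq_one ha (by simpa using hd)
  refine ⟨⟨.inl b, inl_mem_levelEdges.2 (by linarith [hba.face.dim_add_one])⟩,
    (hC.levelTree_targetNode_eq_iff _ hax rfl).2 hba, fun y hy => Subtype.ext ?_⟩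
  obtain ⟨b', -, hb'y⟩ := mem_levelEdges.1 y.2
  rw [← hb'y, huniq b' ((hC.levelTree_targetNode_eq_iff _ hax hb'y).1 hy)]

include hC in
lemma isStrictTotalOrder_name_whiteLT (c : C.Cell) {s : Finset C.ZoomName}
    (hs : ∀ x ∈ s, ∃ w ∈ C.White c, .inl w = x) :
    IsStrictTotalOrder s fun x x' => ∃ w w', .inl w = x.1 ∧ .inl w' = x'.1 ∧ C.WhiteLT c w w' := by
  choose w hw hwx using fun x : s => hs x x.2
  have := hC.isStrictTotalOrder_whiteLT c
  let e : (fun x x' : s => ∃ w w', .inl w = x.1 ∧ .inl w' = x'.1 ∧ C.WhiteLT c w w') ↪r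
      fun w w' : C.White c => C.WhiteLT c w w' :=
    { toFun x := ⟨w x, hw x⟩
      inj' x x' h := Subtype.ext <|
        (hwx x).symm.trans ((congrArg Sum.inl (congrArg Subtype.val h)).trans (hwx x'))
      map_rel_iff' {x x'} := by
        refine ⟨fun h => ⟨_, _, hwx x, hwx x', h⟩, ?_⟩
        rintro ⟨v, v', hv, hv', h⟩
        change C.WhiteLT c (w x) (w x')
        rwa [Sum.inl_injective ((hwx x).trans hv.symm),
          Sum.inl_injective ((hwx x').trans hv'.symm)] }
  exact e.isStrictTotalOrder

/-- The subdivision of the tree with edges `Cₖ` by the sets `W(c)`. -/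
noncomputable def levelSub (hC : C.IsDFC) (k : ℕ) (hk : k ≤ hC.height) :
    (hC.levelTree k hk).Subdivision where
  W y := (Set.toFinite {x | ∃ c, .inl c = y.1 ∧ ∃ w ∈ C.White c, .inl w = x}).toFinset
  lt y x x' := ∃ c, .inl c = y.1 ∧ ∃ w w', .inl w = x.1 ∧ .inl w' = x'.1 ∧ C.WhiteLT c w w'
  lt_total y := by
    obtain ⟨c, -, hc⟩ := mem_levelEdges.1 y.2
    simp only [← hc, Sum.inl.injEq, exists_eq_left]
    exact hC.isStrictTotalOrder_name_whiteLT c fun x hx => by simpa [← hc] using hx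

lemma mem_levelSub_W {y : (hC.levelTree k hk).edges} (hy : .inl c = y.1) {x : C.ZoomName} :
    x ∈ (hC.levelSub k hk).W y ↔ ∃ w ∈ C.White c, .inl w = x := by
  simp [levelSub, ← hy]

lemma levelSub_lt_iff {y : (hC.levelTree k hk).edges} (hy : .inl c = y.1)
    {x x' : (hC.levelSub k hk).W y} {w w' : C.Cell} (hw : .inl w = x.1) (hw' : .inl w' = x'.1) :
    (hC.levelSub k hk).lt y x x' ↔ C.WhiteLT c w w' := by
  simp [levelSub, ← hy, ← hw, ← hw']

end IsDFC

end MOP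

/-! ### The kernel rule -/

namespace MOP.IsDFC

variable {C : MOP.{u}} {hC : C.IsDFC} {k : ℕ} {hk : k ≤ hC.height} {b b' c g : C.Cell}

open FacetPoset Relation

/-- The tip `b` corresponds to the given dot: it is a blackdot, or the target of a whitedot. -/
def TipOf (hC : C.IsDFC) {hk : k ≤ hC.height} : (hC.levelSub k hk).Dot → C.Cell → Prop
  | .inl x, b => b ∈ C.Lam ∧ .inl b = x.1
  | .inr w, b => ∃ c, .inl c = w.1.1 ∧ ∃ a ∈ C.Lam ∩ C.Null, .inl a = w.2.1 ∧ C.Pos b a ∧ C.Loop c b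

lemma exists_tipOf (t : (hC.levelSub k hk).Dot) : ∃ b, hC.TipOf t b := by
  rcases t with x | w
  · obtain ⟨a, ha, -, hax⟩ := mem_levelNodes.1 x.2
    exact ⟨a, ha, hax⟩
  · obtain ⟨c, -, hc⟩ := mem_levelEdges.1 w.1.2
    obtain ⟨a, ha, haw⟩ := (hC.mem_levelSub_W hk hc).1 w.2.2
    obtain ⟨hnull, b, hb, hloop⟩ := hC.mem_white_iff.1 ha
    exact ⟨b, c, hc, a, hnull, haw, hb, hloop⟩

namespace TipOf

variable {t t' : (hC.levelSub k hk).Dot} {y : (hC.levelTree k hk).edges}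
  {w w' : (hC.levelSub k hk).W y}

lemma isTip (h : hC.TipOf t b) : C.IsTip b := by
  rcases t with x | w
  · exact .inl h.1
  · obtain ⟨-, -, a, ha, -, hb, -⟩ := h
    exact .inr ⟨a, ha, hb⟩

lemma dim_eq (h : hC.TipOf t b) : C.dim b = k + 1 := by
  rcases t with x | w
  · exact (inl_mem_levelNodes.1 (h.2 ▸ x.2)).2
  · obtain ⟨c, hc, -, -, -, -, hloop⟩ := h
    have hdc : C.dim c = k := inl_mem_levelEdges.1 (hc ▸ w.1.2)
    rw [← hloop.face.dim_add_one, hdc]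

lemma loop (h : hC.TipOf (.inr ⟨y, w⟩) b) (hy : .inl c = y.1) : C.Loop c b := by
  obtain ⟨c', hc', -, -, -, -, hloop⟩ := h
  rwa [Sum.inl_injective (hy.trans hc'.symm)]

lemma edge_eq (h : hC.TipOf (.inr ⟨y, w⟩) b) (hc : C.Face c b) : .inl c = y.1 := by
  obtain ⟨c', hc', -, -, -, -, hloop⟩ := h
  rw [hloop.eq_of_face hc, hc']

lemma lt_iff (h : hC.TipOf (.inr ⟨y, w⟩) b) (h' : hC.TipOf (.inr ⟨y, w'⟩) b') (hy : .inl c = y.1) :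
    (hC.levelSub k hk).lt y w w' ↔ C.Planar c b b' := by
  have hloop := h.loop hy
  have hloop' := h'.loop hy
  obtain ⟨-, -, a, ha, haw, hb, -⟩ := h
  obtain ⟨-, -, a', ha', haw', hb', -⟩ := h'
  rw [hC.levelSub_lt_iff hk hy haw haw', hC.whiteLT_iff ha ha' hb hloop hb' hloop']

lemma unique (h : hC.TipOf t b) (h' : hC.TipOf t' b) : t = t' := by
  rcases t with x | w <;> rcases t' with x' | w'
  · exact congrArg _ (Subtype.ext (h.2.symm.trans h'.2))
  · obtain ⟨-, -, a, -, -, hb, -⟩ := h'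
    exact (h.1 a hb).elim
  · obtain ⟨-, -, a, -, -, hb, -⟩ := h
    exact (h'.1 a hb).elim
  · obtain ⟨c, hc, a, ha, haw, hb, hloop⟩ := h
    obtain ⟨c', hc', a', ha', haw', hb', hloop'⟩ := h'
    obtain rfl := hC.eq_of_pos_of_pos ha.1 ha'.1 hb hb'
    obtain rfl := hloop.eq_of_face hloop'.face
    exact congrArg _ (DotTree.Subdivision.whitedot_ext (Subtype.ext (hc.symm.trans hc'))
      (haw.symm.trans haw'))

end TipOf

lemma exists_tipOf_of_isTip (hk : k ≤ hC.height) (hb : C.IsTip b) (hd : C.dim b = k + 1) :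
    ∃ t : (hC.levelSub k hk).Dot, hC.TipOf t b := by
  rcases hb with hb | ⟨a, ha, hba⟩
  · exact ⟨.inl ⟨.inl b, inl_mem_levelNodes.2 ⟨hb, hd⟩⟩, hb, rfl⟩
  · obtain ⟨c, hc⟩ := exists_mem_γ (P := C.toFacetPoset) (x := b) (by lia)
    have hwhite : a ∈ C.White c := ⟨ha, b, hba.1, hc⟩
    obtain ⟨-, b', hb', hloop⟩ := hC.mem_white_iff.1 hwhite
    obtain rfl := hba.unique hb'
    exact ⟨.inr ⟨⟨.inl c, inl_mem_levelEdges.2 (by linarith [hloop.face.dim_add_one])⟩,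
      ⟨.inl a, (hC.mem_levelSub_W hk rfl).2 ⟨a, hwhite, rfl⟩⟩⟩, c, rfl, a, ha, rfl, hba, hloop⟩

lemma levelSub_W_disjoint (x : C.ZoomName) (y y' : (hC.levelTree k hk).edges)
    (h : x ∈ (hC.levelSub k hk).W y) (h' : x ∈ (hC.levelSub k hk).W y') : y = y' := by
  obtain ⟨b, c, hc, a, -, hax, hb, hloop⟩ := exists_tipOf (.inr ⟨y, x, h⟩)
  obtain ⟨b', c', hc', a', -, hax', hb', hloop'⟩ := exists_tipOf (.inr ⟨y', x, h'⟩)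
  obtain rfl := Sum.inl_injective (hax.trans hax'.symm)
  obtain rfl := hb.unique hb'
  obtain rfl := hloop.eq_of_face hloop'.face
  exact Subtype.ext (hc.symm.trans hc')

namespace TipOf

variable {t : (hC.levelSub k hk).Dot} {y : (hC.levelTree k hk).edges} {w : (hC.levelSub k hk).W y}
  {e : C.Cell}

lemma planar_of_neg (ht : hC.TipOf t b) (hneg : C.Neg c b) (he : hC.TipOf (.inr ⟨y, w⟩) e)
    (hy : .inl c = y.1) : C.Planar c b e := by
  refine hC.planar_of_neg ht.isTip he.isTip hneg (he.loop hy).face ?_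
  rintro rfl
  exact (he.loop hy).not_neg hneg

lemma planar_of_pos (ht : hC.TipOf t b) (hpos : C.Pos c b) (he : hC.TipOf (.inr ⟨y, w⟩) e)
    (hy : .inl c = y.1) : C.Planar c e b := by
  refine hC.planar_of_pos he.isTip ht.isTip (he.loop hy).face hpos ?_
  rintro rfl
  exact (he.loop hy).not_pos hpos

end TipOf

lemma step_of_nextTip {t t' : (hC.levelSub k hk).Dot} (ht : hC.TipOf t b) (ht' : hC.TipOf t' b')
    (h : C.NextTip b b') : (hC.levelSub k hk).Step t t' := by
  obtain ⟨c, hcb, hcb', hpl, hcov⟩ := h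
  have hbetween (y : (hC.levelTree k hk).edges) (hy : .inl c = y.1) (v e)
      (he : hC.TipOf (.inr ⟨y, v⟩) e) : ¬ (C.Planar c b e ∧ C.Planar c e b') :=
    hcov e he.isTip (he.loop hy).face
  rcases t with x | ⟨y, w⟩ <;> rcases t' with x' | ⟨y', w'⟩
  · have hdc : C.dim c = k := by linarith [hcb.dim_add_one, ht.dim_eq]
    let y : (hC.levelTree k hk).edges := ⟨.inl c, inl_mem_levelEdges.2 hdc⟩
    have hneg := hC.neg_of_planar ht.1 ht'.isTip hcb hcb' hpl
    have hpos := hC.pos_of_planar ht.isTip ht'.1 hcb hcb' hpl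
    have hsrc := (hC.levelTree_targetNode_eq_iff hk ht.2 (y := y) rfl).2 hneg
    have htgt := (hC.levelTree_target_eq_iff hk ht'.2 (y := y) rfl).2 hpos
    refine .node_node y x x' hsrc htgt (Finset.eq_empty_of_forall_notMem fun v hv => ?_)
    obtain ⟨e, he⟩ := exists_tipOf (hC := hC) (hk := hk) (.inr ⟨y, v, hv⟩)
    exact hbetween y rfl _ e he ⟨ht.planar_of_neg hneg he rfl, ht'.planar_of_pos hpos he rfl⟩
  · have hy := ht'.edge_eq hcb'
    have hneg := hC.neg_of_planar ht.1 ht'.isTip hcb hcb' hpl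
    have htgt := (hC.levelTree_targetNode_eq_iff hk ht.2 hy).2 hneg
    refine .node_white y' x w' htgt fun v hv => ?_
    obtain ⟨e, he⟩ := exists_tipOf (.inr ⟨y', v⟩)
    exact hbetween y' hy v e he ⟨ht.planar_of_neg hneg he hy, (he.lt_iff ht' hy).1 hv⟩
  · have hy := ht.edge_eq hcb
    have hpos := hC.pos_of_planar ht.isTip ht'.1 hcb hcb' hpl
    have hsrc := (hC.levelTree_target_eq_iff hk ht'.2 hy).2 hpos
    refine .white_node y w x' hsrc fun v hv => ?_
    obtain ⟨e, he⟩ := exists_tipOf (.inr ⟨y, v⟩)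
    exact hbetween y hy v e he ⟨(ht.lt_iff he hy).1 hv, ht'.planar_of_pos hpos he hy⟩
  · have hy := ht.edge_eq hcb
    obtain rfl : y = y' := Subtype.ext (hy.symm.trans (ht'.edge_eq hcb'))
    refine .white_white y w w' ((ht.lt_iff ht' hy).2 hpl) fun v hv => ?_
    obtain ⟨e, he⟩ := exists_tipOf (.inr ⟨y, v⟩)
    exact hbetween y hy v e he ⟨(ht.lt_iff he hy).1 hv.1, (he.lt_iff ht' hy).1 hv.2⟩

lemma connected_induce_tipsAbove {s : Set (hC.levelSub k hk).Dot} (hdg : C.dim g = k + 1)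
    (hs : ∀ t b, hC.TipOf t b → (t ∈ s ↔ C.Descends b g)) :
    ((hC.levelSub k hk).graph.induce s).Connected := by
  refine (SimpleGraph.connected_iff _).2 ⟨?_, ?_⟩
  · rintro ⟨t, ht⟩ ⟨t', ht'⟩
    obtain ⟨b, hb⟩ := exists_tipOf t
    obtain ⟨b', hb'⟩ := exists_tipOf t'
    have hpath := hC.reflTransGen_tipAdj (by lia) ⟨hb.isTip, (hs t b hb).1 ht⟩
      ⟨hb'.isTip, (hs t' b' hb').1 ht'⟩
    induction hpath generalizing t' with
    | refl =>
      obtain rfl := hb.unique hb'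
      exact .refl _
    | @tail a b' _ hadj ih =>
      obtain ⟨⟨ha, hag⟩, -, hnext⟩ := hadj
      obtain ⟨r, hr⟩ := exists_tipOf_of_isTip hk ha (hag.dim_eq.trans hdg)
      have hrs := (hs r a hr).2 hag
      rcases eq_or_ne r t' with rfl | hne
      · exact ih r hrs hr
      · refine (ih r hrs hr).trans (SimpleGraph.Adj.reachable ?_)
        change (hC.levelSub k hk).graph.Adj r t'
        rw [DotTree.Subdivision.graph, SimpleGraph.fromRel_adj]
        exact ⟨hne, hnext.imp (step_of_nextTip hr hb') (step_of_nextTip hb' hr)⟩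
  · obtain ⟨c, hc⟩ := exists_mem_γ (P := C.toFacetPoset) (x := g) (by lia)
    obtain ⟨b, ⟨hb, hbg⟩, -⟩ := hC.exists_mem_tipsAbove_face (.inr hc)
    obtain ⟨t, ht⟩ := exists_tipOf_of_isTip hk hb (hbg.dim_eq.trans hdg)
    exact ⟨⟨t, (hs t b ht).2 hbg⟩⟩

lemma mem_levelTree_nodes_iff_isLeaf (hk : k + 1 ≤ hC.height) (x : C.ZoomName) :
    x ∈ (hC.levelTree k (Nat.le_of_succ_le hk)).nodes ↔
      ∃ h : x ∈ (hC.levelTree (k + 1) hk).edges, (hC.levelTree (k + 1) hk).IsLeaf ⟨x, h⟩ := by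
  constructor
  · intro hx
    obtain ⟨a, ha, hd, rfl⟩ := mem_levelNodes.1 hx
    exact ⟨inl_mem_levelEdges.2 (by exact_mod_cast hd), (hC.levelTree_isLeaf_iff hk rfl).2 ha⟩
  · rintro ⟨h, hleaf⟩
    obtain ⟨a, hd, rfl⟩ := mem_levelEdges.1 h
    exact inl_mem_levelNodes.2
      ⟨(hC.levelTree_isLeaf_iff hk rfl).1 hleaf, by exact_mod_cast hd⟩

lemma exists_mem_levelSub_W_iff (hk : k + 1 ≤ hC.height) (x : C.ZoomName) :
    (∃ y, x ∈ (hC.levelSub k (Nat.le_of_succ_le hk)).W y) ↔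
      ∃ h : x ∈ (hC.levelTree (k + 1) hk).nodes, (hC.levelTree (k + 1) hk).IsNulldot ⟨x, h⟩ := by
  constructor
  · rintro ⟨y, hy⟩
    obtain ⟨b, hbx⟩ := exists_tipOf (.inr ⟨y, x, hy⟩)
    have hdb := hbx.dim_eq
    obtain ⟨c, -, a, ha, hax, hb, -⟩ := hbx
    obtain rfl : .inl a = x := hax
    exact ⟨inl_mem_levelNodes.2 ⟨ha.1, by push_cast; linarith [hb.face.dim_add_one]⟩,
      (hC.levelTree_isNulldot_iff hk rfl).2 ha.2⟩
  · rintro ⟨h, hnull⟩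
    obtain ⟨a, ha, hd, rfl⟩ := mem_levelNodes.1 h
    push_cast at hd
    obtain ⟨b, hba⟩ := hC.exists_pos_of_mem_lam ha (by lia)
    obtain ⟨z | w, ht⟩ := exists_tipOf_of_isTip (Nat.le_of_succ_le hk)
      (.inr ⟨a, ⟨ha, (hC.levelTree_isNulldot_iff hk rfl).1 hnull⟩, hba⟩)
      (by linarith [hba.face.dim_add_one])
    · exact (ht.1 a hba).elim
    · obtain ⟨-, -, a', ha', haw, hba', -⟩ := ht
      obtain rfl := hC.eq_of_pos_of_pos ha ha'.1 hba hba'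
      exact ⟨w.1, haw ▸ w.2.2⟩

lemma inl_eq_target {x : (hC.levelTree k hk).nodes} {a : C.Cell} (hx : .inl a = x.1)
    (hg : C.Pos g a) : .inl g = ((hC.levelTree k hk).target x).1 := by
  have hda : C.dim a = k + 1 := (inl_mem_levelNodes.1 (hx ▸ x.2)).2
  have hg' : Sum.inl g ∈ (hC.levelTree k hk).edges :=
    inl_mem_levelEdges.2 (by linarith [hg.face.dim_add_one])
  exact congrArg Subtype.val ((hC.levelTree_target_eq_iff hk hx (y := ⟨_, hg'⟩) rfl).2 hg).symm

lemma descends_dotImage_iff (hk : k + 1 ≤ hC.height)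
    {t : (hC.levelSub k (Nat.le_of_succ_le hk)).Dot} (ht : hC.TipOf t b)
    {x : (hC.levelTree (k + 1) hk).nodes} (hg : .inl g = ((hC.levelTree (k + 1) hk).target x).1)
    (hblack hwhite) :
    (hC.levelTree (k + 1) hk).Descends (Constellation.dotImage _ hblack hwhite t) (.inl x) ↔
      C.Descends b g := by
  rcases t with z | w
  · exact (DotTree.leaf_descends_node_iff ((hC.levelTree_isLeaf_iff hk ht.2).2 ht.1)).trans
      (hC.levelTree_reflTransGen_edgeStep_iff hk ht.2 hg)
  · obtain ⟨-, -, a, -, haw, hba, -⟩ := ht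
    exact DotTree.node_descends_node_iff.trans
      (hC.levelTree_reflTransGen_edgeStep_iff hk (inl_eq_target haw hba) hg)

/-- The constellation from the tree with edges `Cₖ` to the tree with edges `Cₖ₊₁`. -/
noncomputable def levelCon (hC : C.IsDFC) (k : ℕ) (hk : k + 1 ≤ hC.height) :
    Constellation (hC.levelTree k (Nat.le_of_succ_le hk)) (hC.levelTree (k + 1) hk) :=
  Constellation.ofExact (hC.levelSub k (Nat.le_of_succ_le hk))
    (mem_levelTree_nodes_iff_isLeaf hk) (exists_mem_levelSub_W_iff hk) levelSub_W_disjoint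
    fun x => by
      obtain ⟨g, hdg, hg⟩ := mem_levelEdges.1 ((hC.levelTree (k + 1) hk).target x).2
      exact connected_induce_tipsAbove (by exact_mod_cast hdg)
        fun t b ht => descends_dotImage_iff hk ht hg _ _

end MOP.IsDFC

/-! ### The opetope of a dendritic face complex -/

lemma TreeData.unary_not_isNulldot {α : Type u} {x l r : α} (hlr : l ≠ r)
    (a : (unary x hlr).toDotTree.nodes) : ¬ (unary x hlr).toDotTree.IsNulldot a :=
  fun h => h _ (unary_targetNode_leaf hlr a)

/-- The constellation between two trees with a single node, the node of the first one being the leaf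
of the second one. -/
noncomputable def TreeData.unaryCon {α : Type u} (x : α) {l r : α} (hlr : l ≠ r) :
    Constellation (unary l hlr).toDotTree (unary x hlr).toDotTree :=
  .ofUnary _ _ (Finset.card_singleton l)
    (fun y => by
      simp only [unary_isLeaf_iff, mem_unary_edges, exists_prop, or_and_right, and_self]
      exact Finset.mem_singleton.trans ⟨.inl, (·.elim id (·.2))⟩)
    (unary_not_isNulldot hlr)
    (fun a => ⟨_, (unary_isLeaf_iff hlr _).2 rfl,
      .single (.edge _ _ (unary_targetNode_leaf hlr a))⟩)

namespace MOP

variable {C : MOP.{u}} {a : C.Cell}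

/-- The name of the leaf edges of `T₀` and `T₁`, and of the node of `T₀`. -/
abbrev leafName (C : MOP.{u}) : C.ZoomName := .inr ⟨false⟩

/-- The name of the root edges of `T₀` and `T₁`. -/
abbrev rootName (C : MOP.{u}) : C.ZoomName := .inr ⟨true⟩

lemma leafName_ne_rootName : C.leafName ≠ C.rootName := by simp

namespace IsDFC

/-- The unique element of `Λ₀`. -/
noncomputable def lamZero (hC : C.IsDFC) : C.Cell := hC.existsUnique_lam_of_dim_eq_zero.choose

lemma eq_lamZero_iff (hC : C.IsDFC) : a = hC.lamZero ↔ a ∈ C.Lam ∧ C.dim a = 0 := by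
  obtain ⟨hlam, huniq⟩ := hC.existsUnique_lam_of_dim_eq_zero.choose_spec
  exact ⟨fun ha => ha ▸ hlam, huniq a⟩

lemma exists_lam_descends_of_dim_eq_zero (hC : C.IsDFC) {b : C.Cell} (hb : C.dim b = 0) :
    ∃ t ∈ C.Lam, C.dim t = 0 ∧ C.Descends t b := by
  obtain ⟨s, hs, -⟩ := C.existsUnique_bot
  obtain ⟨g, hg, hdim⟩ := hC.exists_isIteratedTarget_dim_eq b
  obtain ⟨t, ht, htb, ht0⟩ := (hC.isLevelRoot_of_isIteratedTarget hg).exists_lam_descends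
    (p := fun y => C.dim y = 0)
    (fun hy hyx => by
      obtain ⟨y', -, hy'x⟩ := hC.exists_pos_neg_of_pos_pos (FacetPoset.pos_of_dim_eq_zero hy hs) hyx
      exact ⟨y', (hy'x.face.dim_eq hyx.face).trans hy, hy'x⟩) hdim.symm hb
  exact ⟨t, ht, ht0, htb⟩

lemma levelTree_zero_exists_leaf_descends (hC : C.IsDFC)
    (x : (hC.levelTree 0 (Nat.zero_le _)).nodes) :
    ∃ b, (hC.levelTree 0 _).IsLeaf b ∧ (hC.levelTree 0 _).Descends (.inr b) (.inl x) := by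
  obtain ⟨b, hbx, -⟩ := hC.levelTree_zero_isLinear x
  obtain ⟨c, hc, hcb⟩ := mem_levelEdges.1 b.2
  obtain ⟨t, ht, ht0, htc⟩ := hC.exists_lam_descends_of_dim_eq_zero hc
  refine ⟨⟨.inl t, inl_mem_levelEdges.2 ht0⟩, (hC.levelTree_isLeaf_iff _ rfl).2 ht, ?_⟩
  exact .tail (DotTree.descends_of_edgeStep
    ((hC.levelTree_reflTransGen_edgeStep_iff _ rfl hcb).2 htc)) (.edge _ _ hbx)

/-- The constellation `T₁ ⟶ T₂`. -/
noncomputable def levelZeroCon (hC : C.IsDFC) :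
    Constellation (TreeData.unary (.inl hC.lamZero) (leafName_ne_rootName (C := C))).toDotTree
      (hC.levelTree 0 (Nat.zero_le _)) :=
  .ofUnary _ _ (Finset.card_singleton _)
    (fun x => by
      refine Finset.mem_singleton.trans ⟨?_, fun ⟨hx, hleaf⟩ => ?_⟩
      · rintro rfl
        obtain ⟨hlam, hdim⟩ := hC.eq_lamZero_iff.1 rfl
        exact ⟨inl_mem_levelEdges.2 hdim, (hC.levelTree_isLeaf_iff _ rfl).2 hlam⟩
      · obtain ⟨c, hc, rfl⟩ := mem_levelEdges.1 hx
        exact congrArg _ (hC.eq_lamZero_iff.2 ⟨(hC.levelTree_isLeaf_iff _ rfl).1 hleaf, hc⟩))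
    (fun a h => (hC.levelTree_zero_isLinear a).exists.elim h)
    hC.levelTree_zero_exists_leaf_descends

/-- The trees of the opetope `Z(C)`. -/
noncomputable def zoomTree (hC : C.IsDFC) : ∀ k, k ≤ hC.height → DotTree C.ZoomName
  | 0, _ => (TreeData.unary C.leafName leafName_ne_rootName).toDotTree
  | 1, _ => (TreeData.unary (.inl hC.lamZero) leafName_ne_rootName).toDotTree
  | k + 2, hk => hC.levelTree k (by lia)

/-- The constellations of the opetope `Z(C)`. -/
noncomputable def zoomCon (hC : C.IsDFC) : ∀ (k : ℕ) (hk : k + 1 ≤ hC.height),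
    Constellation (hC.zoomTree k (Nat.le_of_succ_le hk)) (hC.zoomTree (k + 1) hk)
  | 0, _ => TreeData.unaryCon _ _
  | 1, _ => hC.levelZeroCon
  | k + 2, _ => hC.levelCon k (by lia)

/-- The opetope `Z(C)`. -/
noncomputable def zoomObj (hC : C.IsDFC) : KJBM.{u} where
  Name := C.ZoomName
  dim := hC.height
  opetope :=
    { tree := hC.zoomTree
      con := hC.zoomCon
      exact
        | 0, _ | 1, _ | _ + 2, _ => ⟨fun _ => rfl, fun _ => rfl⟩
      unary_zero := TreeData.unary_isUnary _
      unary_one := fun _ => TreeData.unary_isUnary _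
      linear_two := fun _ => hC.levelTree_zero_isLinear }

lemma isZoomOf (hC : C.IsDFC) : IsZoomOf C hC.zoomObj .inl where
  hasDim := hC.hasDim_height
  mem_nodes_one h x := by
    simp_rw [← and_assoc, ← hC.eq_lamZero_iff, exists_eq_left]
    exact Finset.mem_singleton.trans eq_comm
  mem_nodes _ _ _ := mem_levelNodes
  mem_edges _ _ _ := mem_levelEdges
  target_iff _ _ _ _ _ _ := hC.levelTree_target_eq_iff _
  targetNode_iff _ _ _ _ _ _ := hC.levelTree_targetNode_eq_iff _
  root_eq _ h :=
    have hroot := (hC.exists_isIteratedTarget_of_le_height (le_of_add_le_left h)).choose_spec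
    ⟨_, hroot.1, hroot.2, rfl⟩
  mem_white _ _ _ _ hc _ := hC.mem_levelSub_W _ hc
  white_lt_iff _ _ _ _ hc _ _ _ _ := hC.levelSub_lt_iff _ hc

end IsDFC

end MOP

/-! ### Functoriality -/

lemma TreeData.unary_isIsoVia {α β : Type u} (F : α ≃ β) {x l r : α} {x' l' r' : β} {hlr : l ≠ r}
    {hlr' : l' ≠ r'} (hx : F x = x') (hl : F l = l') (hr : F r = r') :
    DotTree.IsIsoVia F (unary x hlr).toDotTree (unary x' hlr').toDotTree where
  mem_nodes _ := by
    subst hx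
    exact Finset.mem_singleton.trans (F.apply_eq_iff_eq.symm.trans Finset.mem_singleton.symm)
  mem_edges _ := by
    subst hl hr
    simp only [mem_unary_edges, F.apply_eq_iff_eq]
  target _ _ h := by
    rw [toDotTree_target_eq_iff] at h ⊢
    exact (congrArg F h).trans hr
  targetNode _ _ := by
    subst hl
    simp only [toDotTree_targetNode_eq_iff]
    exact F.apply_eq_iff_eq.symm
  root := hr

namespace MOP

section RelIso

variable {α β : Type*} {r : α → α → Prop} {s : β → β → Prop} (e : r ≃r s) {a b : α}

lemma transGen_relIso_iff : Relation.TransGen s (e a) (e b) ↔ Relation.TransGen r a b := by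
  refine ⟨fun h => ?_, fun h => h.lift e fun _ _ => e.map_rel_iff.2⟩
  simpa [Function.onFun] using h.lift e.symm (p := r) fun _ _ => e.symm.map_rel_iff.2

lemma reflTransGen_relIso_iff :
    Relation.ReflTransGen s (e a) (e b) ↔ Relation.ReflTransGen r a b := by
  simp only [Relation.reflTransGen_iff_eq_or_transGen, transGen_relIso_iff,
    EmbeddingLike.apply_eq_iff_eq]

end RelIso

variable {C D : MOP.{u}}

lemma Hom.map_mem_δ (f : C ⟶ D) {x y : C.Cell} (h : y ∈ C.δ x) : f.toFun y ∈ D.δ (f.toFun x) :=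
  (f.bijOn_δ x (by linarith [C.neg_one_le_dim y, C.dim_of_mem_δ _ _ h])).mapsTo h

lemma Hom.map_mem_γ (f : C ⟶ D) {x y : C.Cell} (h : y ∈ C.γ x) : f.toFun y ∈ D.γ (f.toFun x) := by
  rw [← f.map_γ x (by linarith [C.neg_one_le_dim y, C.dim_of_mem_γ _ _ h])]
  exact Set.mem_image_of_mem _ h

/-- The bijection between cells underlying an isomorphism. -/
def cellEquiv (i : C ≅ D) : C.Cell ≃ D.Cell where
  toFun := i.hom.toFun
  invFun := i.inv.toFun
  left_inv := congrFun (congrArg Hom.toFun i.hom_inv_id)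
  right_inv := congrFun (congrArg Hom.toFun i.inv_hom_id)

/-- The bijection between names underlying an isomorphism. -/
def nameEquiv (i : C ≅ D) : C.ZoomName ≃ D.ZoomName := (cellEquiv i).sumCongr (Equiv.refl _)

section Invariance

variable (i : C ≅ D) {c x y z : C.Cell}

lemma dim_cellEquiv : D.dim (cellEquiv i x) = C.dim x := i.hom.map_dim x

lemma mem_δ_cellEquiv_iff : cellEquiv i y ∈ D.δ (cellEquiv i x) ↔ y ∈ C.δ x := by
  refine ⟨fun h => ?_, Hom.map_mem_δ i.hom⟩
  rw [← (cellEquiv i).symm_apply_apply x, ← (cellEquiv i).symm_apply_apply y]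
  exact Hom.map_mem_δ i.inv h

lemma mem_γ_cellEquiv_iff : cellEquiv i y ∈ D.γ (cellEquiv i x) ↔ y ∈ C.γ x := by
  refine ⟨fun h => ?_, Hom.map_mem_γ i.hom⟩
  rw [← (cellEquiv i).symm_apply_apply x, ← (cellEquiv i).symm_apply_apply y]
  exact Hom.map_mem_γ i.inv h

lemma localLT_cellEquiv_iff :
    D.LocalLT (cellEquiv i x) (cellEquiv i y) (cellEquiv i z) ↔ C.LocalLT x y z := by
  refine ⟨fun h => ?_, i.hom.map_localLT _ _ _⟩
  rw [← (cellEquiv i).symm_apply_apply x, ← (cellEquiv i).symm_apply_apply y,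
    ← (cellEquiv i).symm_apply_apply z]
  exact i.inv.map_localLT _ _ _ h

lemma pos_cellEquiv_iff : D.Pos (cellEquiv i y) (cellEquiv i x) ↔ C.Pos y x :=
  and_congr (mem_γ_cellEquiv_iff i) (not_congr (mem_δ_cellEquiv_iff i))

lemma neg_cellEquiv_iff : D.Neg (cellEquiv i y) (cellEquiv i x) ↔ C.Neg y x :=
  and_congr (mem_δ_cellEquiv_iff i) (not_congr (mem_γ_cellEquiv_iff i))

lemma loop_cellEquiv_iff : D.Loop (cellEquiv i y) (cellEquiv i x) ↔ C.Loop y x :=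
  and_congr (mem_δ_cellEquiv_iff i) (mem_γ_cellEquiv_iff i)

lemma cellEquiv_mem_lam_iff : cellEquiv i x ∈ D.Lam ↔ x ∈ C.Lam := by
  simp only [FacetPoset.Lam, Set.mem_ofPred_eq, (cellEquiv i).surjective.forall, pos_cellEquiv_iff]

lemma cellEquiv_mem_null_iff : cellEquiv i x ∈ D.Null ↔ x ∈ C.Null := by
  simp only [FacetPoset.Null, Set.mem_ofPred_eq, Set.eq_empty_iff_forall_notMem,
    (cellEquiv i).surjective.forall, mem_δ_cellEquiv_iff]

lemma loopInclEq_cellEquiv_iff :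
    D.LoopInclEq (cellEquiv i x) (cellEquiv i y) ↔ C.LoopInclEq x y := by
  refine reflTransGen_relIso_iff ⟨cellEquiv i, ?_⟩
  simp only [LoopIncl, (cellEquiv i).surjective.exists, pos_cellEquiv_iff, neg_cellEquiv_iff,
    loop_cellEquiv_iff, cellEquiv_mem_lam_iff, implies_true]

lemma transGen_zigStep_cellEquiv_iff :
    Relation.TransGen (D.ZigStep (cellEquiv i c)) (cellEquiv i x) (cellEquiv i y) ↔
      Relation.TransGen (C.ZigStep c) x y := by
  refine transGen_relIso_iff ⟨cellEquiv i, ?_⟩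
  simp only [ZigStep, (cellEquiv i).surjective.exists, pos_cellEquiv_iff, neg_cellEquiv_iff,
    cellEquiv_mem_lam_iff, implies_true]

lemma loopLT₁_cellEquiv_iff :
    D.LoopLT₁ (cellEquiv i c) (cellEquiv i x) (cellEquiv i y) ↔ C.LoopLT₁ c x y := by
  simp only [LoopLT₁, (cellEquiv i).surjective.exists, neg_cellEquiv_iff, loop_cellEquiv_iff,
    loopInclEq_cellEquiv_iff, transGen_zigStep_cellEquiv_iff]

lemma cellEquiv_mem_minLoops_iff :
    cellEquiv i x ∈ D.MinLoops (cellEquiv i c) ↔ x ∈ C.MinLoops c := by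
  simp only [MinLoops, Set.mem_ofPred_eq, Set.mem_inter_iff, (cellEquiv i).surjective.exists,
    pos_cellEquiv_iff, loop_cellEquiv_iff, cellEquiv_mem_lam_iff, cellEquiv_mem_null_iff]

lemma loopLT_cellEquiv_iff :
    D.LoopLT (cellEquiv i c) (cellEquiv i x) (cellEquiv i y) ↔ C.LoopLT c x y := by
  simp only [LoopLT, LoopLT₂, (cellEquiv i).surjective.exists, neg_cellEquiv_iff,
    loop_cellEquiv_iff, loopInclEq_cellEquiv_iff, loopLT₁_cellEquiv_iff,
    cellEquiv_mem_minLoops_iff, cellEquiv_mem_lam_iff, localLT_cellEquiv_iff, ne_eq,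
    EmbeddingLike.apply_eq_iff_eq]

lemma cellEquiv_mem_white_iff : cellEquiv i x ∈ D.White (cellEquiv i c) ↔ x ∈ C.White c := by
  simp only [White, Set.mem_ofPred_eq, Set.mem_inter_iff, (cellEquiv i).surjective.exists,
    mem_γ_cellEquiv_iff, cellEquiv_mem_lam_iff, cellEquiv_mem_null_iff]

lemma whiteLT_cellEquiv_iff :
    D.WhiteLT (cellEquiv i c) (cellEquiv i x) (cellEquiv i y) ↔ C.WhiteLT c x y := by
  simp only [WhiteLT, (cellEquiv i).surjective.exists, mem_γ_cellEquiv_iff, loopLT_cellEquiv_iff]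

lemma isGreatestCell_cellEquiv_iff : D.IsGreatestCell (cellEquiv i x) ↔ C.IsGreatestCell x := by
  simp only [FacetPoset.IsGreatestCell, FacetPoset.Le, (cellEquiv i).surjective.forall]
  refine forall_congr' fun y => reflTransGen_relIso_iff ⟨cellEquiv i, ?_⟩
  simp only [Set.mem_union, mem_γ_cellEquiv_iff, mem_δ_cellEquiv_iff, implies_true]

lemma isIteratedTarget_cellEquiv_iff :
    D.IsIteratedTarget (cellEquiv i x) ↔ C.IsIteratedTarget x := by
  simp only [FacetPoset.IsIteratedTarget, (cellEquiv i).surjective.exists,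
    isGreatestCell_cellEquiv_iff]
  exact exists_congr fun ω => and_congr_right fun _ =>
    reflTransGen_relIso_iff ⟨cellEquiv i, mem_γ_cellEquiv_iff i⟩

end Invariance

namespace IsDFC

variable (hC : C.IsDFC) (hD : D.IsDFC) (i : C ≅ D) {k : ℕ}

include i in
lemma height_eq : hC.height = hD.height := by
  have hrange : Set.range D.dim = Set.range C.dim := by
    ext d
    simp only [Set.mem_range, (cellEquiv i).surjective.exists, dim_cellEquiv]
  have hdim := hD.hasDim_height
  rw [FacetPoset.HasDim, hrange] at hdim
  exact_mod_cast hC.hasDim_height.unique hdim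

lemma levelTree_isIsoVia (hk : k ≤ hC.height) (hk' : k ≤ hD.height) :
    DotTree.IsIsoVia (nameEquiv i) (hC.levelTree k hk) (hD.levelTree k hk') where
  mem_nodes x := by
    change x ∈ C.levelNodes k ↔ nameEquiv i x ∈ D.levelNodes k
    rcases x with a | x
    · simp [mem_levelNodes, nameEquiv, cellEquiv_mem_lam_iff, dim_cellEquiv]
    · simp [mem_levelNodes, nameEquiv]
  mem_edges x := by
    change x ∈ C.levelEdges k ↔ nameEquiv i x ∈ D.levelEdges k
    rcases x with c | x
    · simp [mem_levelEdges, nameEquiv, dim_cellEquiv]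
    · simp [mem_levelEdges, nameEquiv]
  target x y h := by
    obtain ⟨a, -, -, ha⟩ := mem_levelNodes.1 x.2
    obtain ⟨c, -, hc⟩ := mem_levelEdges.1 y.2
    have hpos := (pos_cellEquiv_iff i).2 ((hC.levelTree_target_eq_iff hk ha hc).1 h)
    exact Iff.mpr (hD.levelTree_target_eq_iff hk' (congrArg (nameEquiv i) ha)
      (congrArg (nameEquiv i) hc)) hpos
  targetNode y x := by
    obtain ⟨a, -, -, ha⟩ := mem_levelNodes.1 x.2
    obtain ⟨c, -, hc⟩ := mem_levelEdges.1 y.2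
    rw [hC.levelTree_targetNode_eq_iff hk ha hc, ← neg_cellEquiv_iff i]
    exact Iff.symm (hD.levelTree_targetNode_eq_iff hk' (congrArg (nameEquiv i) ha)
      (congrArg (nameEquiv i) hc))
  root := by
    obtain ⟨hroot, hdim⟩ := (hC.exists_isIteratedTarget_of_le_height hk).choose_spec
    obtain ⟨hroot', hdim'⟩ := (hD.exists_isIteratedTarget_of_le_height hk').choose_spec
    exact congrArg Sum.inl (hD.isIteratedTarget_unique ((isIteratedTarget_cellEquiv_iff i).2 hroot)
      hroot' ((dim_cellEquiv i).trans (hdim.trans hdim'.symm)))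

lemma cellEquiv_lamZero : cellEquiv i hC.lamZero = hD.lamZero := by
  rw [hD.eq_lamZero_iff, cellEquiv_mem_lam_iff, dim_cellEquiv, ← hC.eq_lamZero_iff]

lemma zoomTree_isIsoVia : ∀ (k : ℕ) (hk : k ≤ hC.height) (hk' : k ≤ hD.height),
    DotTree.IsIsoVia (nameEquiv i) (hC.zoomTree k hk) (hD.zoomTree k hk')
  | 0, _, _ => TreeData.unary_isIsoVia _ rfl rfl rfl
  | 1, _, _ => TreeData.unary_isIsoVia _ (congrArg _ (hC.cellEquiv_lamZero hD i)) rfl rfl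
  | _ + 2, _, _ => hC.levelTree_isIsoVia hD i _ _

lemma nameEquiv_mem_levelSub_W_iff {hk : k ≤ hC.height} {hk' : k ≤ hD.height}
    {y : (hC.levelTree k hk).edges} {y' : (hD.levelTree k hk').edges} (hy : nameEquiv i y.1 = y'.1)
    (x : C.ZoomName) :
    x ∈ (hC.levelSub k hk).W y ↔ nameEquiv i x ∈ (hD.levelSub k hk').W y' := by
  obtain ⟨c, -, hc⟩ := mem_levelEdges.1 y.2
  have hc' : Sum.inl (cellEquiv i c) = y'.1 := (congrArg (nameEquiv i) hc).trans hy
  rw [hC.mem_levelSub_W hk hc, hD.mem_levelSub_W hk' hc']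
  rcases x with w | x
  · simp [nameEquiv, cellEquiv_mem_white_iff]
  · simp [nameEquiv]

lemma levelSub_lt_nameEquiv_iff {hk : k ≤ hC.height} {hk' : k ≤ hD.height}
    {y : (hC.levelTree k hk).edges} {y' : (hD.levelTree k hk').edges} (hy : nameEquiv i y.1 = y'.1)
    {x₁ x₂ : (hC.levelSub k hk).W y} {x₁' x₂' : (hD.levelSub k hk').W y'}
    (hx₁ : nameEquiv i x₁.1 = x₁'.1) (hx₂ : nameEquiv i x₂.1 = x₂'.1) :
    (hC.levelSub k hk).lt y x₁ x₂ ↔ (hD.levelSub k hk').lt y' x₁' x₂' := by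
  obtain ⟨c, -, hc⟩ := mem_levelEdges.1 y.2
  obtain ⟨w₁, -, hw₁⟩ := (hC.mem_levelSub_W hk hc).1 x₁.2
  obtain ⟨w₂, -, hw₂⟩ := (hC.mem_levelSub_W hk hc).1 x₂.2
  rw [hC.levelSub_lt_iff hk hc hw₁ hw₂, ← whiteLT_cellEquiv_iff i]
  exact (hD.levelSub_lt_iff hk' ((congrArg (nameEquiv i) hc).trans hy)
    ((congrArg (nameEquiv i) hw₁).trans hx₁) ((congrArg (nameEquiv i) hw₂).trans hx₂)).symm

lemma zoomObj_isIsoVia : KJBM.IsIsoVia hC.zoomObj hD.zoomObj (nameEquiv i) where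
  dim_eq := hC.height_eq hD i
  tree k hk := hC.zoomTree_isIsoVia hD i k hk _
  mem_W
    | 0, _, _, _ | 1, _, _, _ => iff_of_false (Finset.notMem_empty _) (Finset.notMem_empty _)
    | _ + 2, _, _, x => hC.nameEquiv_mem_levelSub_W_iff hD i rfl x
  lt_iff
    | 0, _, _, w, _ | 1, _, _, w, _ => (Finset.notMem_empty _ w.2).elim
    | _ + 2, _, _, _, _ => hC.levelSub_lt_nameEquiv_iff hD i rfl rfl rfl

end IsDFC

/-- The isomorphism of many-to-one posets underlying an isomorphism of dendritic face complexes. -/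
abbrev cellIso {C D : Core DFC.{u}} (f : C ⟶ D) : C.of.obj ≅ D.of.obj :=
  (ObjectProperty.ι (C := MOP.{u}) MOP.IsDFC).mapIso f.iso

/-- The functor `Z` from dendritic face complexes to opetopes. -/
noncomputable def zoomFunctor : Core DFC.{u} ⥤ KJBM.{u} where
  obj C := C.of.property.zoomObj
  map {C D} f := (C.of.property.zoomObj_isIsoVia D.of.property (cellIso f)).hom
  map_id C := by
    have hid (x : C.of.obj.ZoomName) : nameEquiv (cellIso (𝟙 C)) x = x := by
      rcases x <;> rfl
    exact KJBM.hom_ext_names (fun _ _ a => hid a.1) (fun _ _ b => hid b.1) fun _ _ w => hid w.2.1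
  map_comp {C D E} f g := by
    have hcomp (x : C.of.obj.ZoomName) : nameEquiv (cellIso (f ≫ g)) x =
        nameEquiv (cellIso g) (nameEquiv (cellIso f) x) := by
      rcases x <;> rfl
    exact KJBM.hom_ext_names (fun _ _ a => hcomp a.1) (fun _ _ b => hcomp b.1)
      fun _ _ w => hcomp w.2.1

lemma zoomFunctor_map_actsAs {C D : Core DFC.{u}} (f : C ⟶ D) :
    ActsAs (.inl : C.of.obj.Cell ↪ C.of.obj.ZoomName) (.inl : D.of.obj.Cell ↪ D.of.obj.ZoomName)
      f.iso.hom.hom (zoomFunctor.map f) := by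
  have hmap {v : C.of.obj.ZoomName} {x : C.of.obj.Cell} (hx : .inl x = v) :
      nameEquiv (cellIso f) v = .inl (f.iso.hom.hom.toFun x) :=
    (congrArg (nameEquiv _) hx).symm
  exact
    { node_one _ _ _ hx := hmap hx
      node _ _ _ _ hx := hmap hx
      edge _ _ _ _ hx := hmap hx
      white _ _ _ _ hx := hmap hx }

end MOP

theorem mainTheorem2 :
    ∃ (Z : Core DFC.{u} ⥤ KJBM.{u})
      (ι : ∀ C : Core DFC.{u}, C.of.obj.Cell ↪ (Z.obj C).Name),
      (∀ C : Core DFC.{u}, IsZoomOf C.of.obj (Z.obj C) (ι C)) ∧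
      ∀ (C D : Core DFC.{u}) (f : C ⟶ D),
        ActsAs (ι C) (ι D) f.iso.hom.hom (Z.map f) :=
  ⟨MOP.zoomFunctor, fun _ => .inl, fun C => C.of.property.isZoomOf,
    fun _ _ => MOP.zoomFunctor_map_actsAs⟩
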